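/- Let $d,m\ge 1$ be integers, $1<p<\infty$ and $p'=p/(p-1)$. An $m\times m$ matrix weight is a measurable function $W:\mathbb{R}^d\to M_{m\times m}(\mathbb{C})$ that is positive definite almost everywhere; put $\|\vec f\|_{L^p(W)}=\big(\int_{\mathbb{R}^d}|W^{1/p}(x)\vec f(x)|^p\,dx\big)^{1/p}$ for $\vec f:\mathbb{R}^d\to\mathbb{C}^m$ and $W'=W^{-p'/p}$. For matrix weights $U,V$ and a locally integrable $B:\mathbb{R}^d\to M_{m\times m}(\mathbb{C})$ define $$\|B\|_{\widetilde{\mathrm{BMO}}^p_{V,U}}=\sup_{Q}\left(\frac{1}{|Q|}\int_Q\Big(\frac{1}{|Q|}\int_Q\big\|V^{1/p}(x)\,(B(x)-B(y))\,U^{-1/p}(y)\big\|^{p'}dy\Big)^{p/p'}dx\right)^{1/p}\in[0,\infty],$$ where the supremum is over all (axis-parallel) cubes $Q\subset\mathbb{R}^d$ and $\|\cdot\|$ is the operator norm on $\mathbb{C}^m$. Let $R_\ell g(x)=\mathrm{p.v.}\int \frac{x_\ell-y_\ell}{|x-y|^{d+1}}g(y)\,dy$, $1\le\ell\le d$, be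 the Riesz transforms, let $R_\ell\otimes I_m$ be their componentwise action on $\mathbb{C}^m$-valued functions, let $[M_B,R_\ell\otimes I_m]\vec f=B\,(R_\ell\otimes I_m)\vec f-(R_\ell\otimes I_m)(B\vec f)$, and let $\|[M_B,R_\ell\otimes I_m]\|_{L^p(U)\to L^p(V)}\in[0,\infty]$ be the supremum of $\|[M_B,R_\ell\otimes I_m]\vec f\|_{L^p(V)}$ over the bounded compactly supported $\vec f$ with $\|\vec f\|_{L^p(U)}\le1$ (bounded compactly supported functions are dense in $L^p(U)$). **Theorem.** There is a constant $C<\infty$ depending only on $d$, $m$ and $p$ such that for all (not necessarily $A_p$) $m\times m$ matrix weights $U,V$ on $\mathbb{R}^d$ and every locally integrable $B:\mathbb{R}^d\to M_{m\times m}(\mathbb{C})$, $$\max\Big\{\|B\|_{\widetilde{\mathrm{BMO}}^p_{V,U}},\ \|B^*\|_{\widetilde{\mathrm{BMO}}^{p'}_{U',V'}}\Big\}\le C\max_{1\le\ell\le d}\big\|[M_B,R_\ell\otimes I_m]\big\|_{L^p(U)\to L^p(V)}.$$ Here $B^*(x)$ is the conjugate transpose of $B(x)$; explicitly $$\|B^*\|_{\widetilde{\mathrm{BMO}}^{p'}_{U',V'}}=\sup_Q\left(\frac{1}{|Q|}\int_Q\Big(\frac{1}{|Q|}\int_Q\big\|V^{1/p}(x)\,(B(x)-B(y))\,U^{-1/p}(y)\big\|^{p}dx\Big)^{p'/p}dy\right)^{1/p'}.$$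 -/

import Mathlib

open MeasureTheory Filter Topology
open scoped ENNReal NNReal Matrix ComplexOrder

noncomputable section

namespace MatrixWeight

/-- The space `ℝ^d` with its Euclidean norm. -/
abbrev Rd (d : ℕ) : Type := EuclideanSpace ℝ (Fin d)

/-- The space `ℂ^m` with its Hermitian norm. -/
abbrev Cm (m : ℕ) : Type := EuclideanSpace ℂ (Fin m)

/-- Complex `m × m` matrices. -/
abbrev Mat (m : ℕ) : Type := Matrix (Fin m) (Fin m) ℂ

/-- A matrix acting on a vector of `ℂ^m`. -/
def act {m : ℕ} (A : Mat m) (v : Cm m) : Cm m := WithLp.toLp 2 (A *ᵥ v.ofLp)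

/-- The operator norm of a matrix on `ℂ^m` (with its Hermitian norm), as an extended
nonnegative real. -/
def opENorm {m : ℕ} (A : Mat m) : ℝ≥0∞ :=
  ‖Matrix.toEuclideanCLM (n := Fin m) (𝕜 := ℂ) A‖ₑ

/-- The real power `A ^ s` of a positive definite matrix, through its spectral decomposition
(functional calculus for Hermitian matrices, applied to `t ↦ t ^ s`). -/
def matPow {m : ℕ} (A : Mat m) (s : ℝ) : Mat m := cfc (fun t : ℝ => t ^ s) A

/-- A matrix weight: a (Lebesgue) measurable matrix function that is positive definite almost
everywhere.  No integrability and no `A_p` condition is imposed. -/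
structure IsMatrixWeight {d m : ℕ} (W : Rd d → Mat m) : Prop where
  measurable : ∀ i j, AEMeasurable (fun x => W x i j) volume
  posDef : ∀ᵐ x ∂(volume : Measure (Rd d)), (W x).PosDef

/-- A locally integrable matrix function. -/
def IsLocInt {d m : ℕ} (B : Rd d → Mat m) : Prop :=
  ∀ i j, LocallyIntegrable (fun x => B x i j) volume

/-- The dual weight `W' = W ^ (-p'/p)`, where `p' = p / (p - 1)`. -/
def dualWeight {d m : ℕ} (p : ℝ) (W : Rd d → Mat m) : Rd d → Mat m :=
  fun x => matPow (W x) (-(p.conjExponent / p))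

/-- The norm `(∫ |W^{1/p}(x) f(x)|^p dx)^{1/p}` of `L^p(W)`. -/
def wNorm {d m : ℕ} (p : ℝ) (W : Rd d → Mat m) (f : Rd d → Cm m) : ℝ≥0∞ :=
  (∫⁻ x, ‖act (matPow (W x) (1 / p)) (f x)‖ₑ ^ p) ^ (1 / p)

/-- The closed axis-parallel cube with lower corner `a` and side length `r`. -/
def cube {d : ℕ} (a : Rd d) (r : ℝ) : Set (Rd d) :=
  {x | ∀ i, a i ≤ x i ∧ x i ≤ a i + r}

/-- The weighted BMO quantity
`(sup_Q ⨍_Q (⨍_Q ‖V^{1/p}(x) (B(x) - B(y)) U^{-1/p}(y)‖^{p'} dy)^{p/p'} dx)^{1/p}`,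
the supremum being over all cubes. -/
def bmoTilde {d m : ℕ} (p : ℝ) (V U B : Rd d → Mat m) : ℝ≥0∞ :=
  (⨆ (a : Rd d) (r : ℝ) (_ : 0 < r),
    ⨍⁻ x in cube a r,
      (⨍⁻ y in cube a r,
        opENorm (matPow (V x) (1 / p) * (B x - B y) * matPow (U y) (-(1 / p)))
          ^ p.conjExponent ∂volume) ^ (p / p.conjExponent) ∂volume) ^ (1 / p)

/-- The kernel `K_l(x, y) = (x_l - y_l) / |x - y|^{d+1}` of the `l`-th Riesz transform. -/
def rieszKernel {d : ℕ} (l : Fin d) (x y : Rd d) : ℝ := (x l - y l) / ‖x - y‖ ^ (d + 1)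

/-- The `l`-th Riesz transform of a scalar function, as a principal value.  For integrable `g`
the limit exists for almost every `x`. -/
def riesz {d : ℕ} (l : Fin d) (g : Rd d → ℂ) (x : Rd d) : ℂ :=
  limUnder (𝓝[>] (0 : ℝ))
    (fun ε : ℝ => ∫ y in {y : Rd d | ε < ‖x - y‖}, (rieszKernel l x y : ℂ) * g y)

/-- The canonical extension `R_l ⊗ I_m` to `ℂ^m`-valued functions (componentwise action). -/
def rieszExt {d m : ℕ} (l : Fin d) (f : Rd d → Cm m) (x : Rd d) : Cm m :=
  WithLp.toLp 2 (fun i => riesz l (fun y => f y i) x)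

/-- The commutator `[M_B, R_l ⊗ I_m] f = B (R_l ⊗ I_m) f - (R_l ⊗ I_m) (B f)`. -/
def commutator {d m : ℕ} (B : Rd d → Mat m) (l : Fin d) (f : Rd d → Cm m) (x : Rd d) : Cm m :=
  act (B x) (rieszExt l f x) - rieszExt l (fun y => act (B y) (f y)) x

/-- The (possibly infinite) operator norm of `[M_B, R_l ⊗ I_m]` from `L^p(U)` to `L^p(V)`.
The supremum is over the bounded functions with compact support in the unit ball of `L^p(U)`:
they are dense in `L^p(U)` for every matrix weight `U`, and on them the commutator is defined
almost everywhere for every locally integrable `B`, because `f` and `B f` are integrable. -/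
def commutatorNorm {d m : ℕ} (p : ℝ) (U V B : Rd d → Mat m) (l : Fin d) : ℝ≥0∞ :=
  ⨆ (f : Rd d → Cm m) (_ : MemLp f ∞ volume) (_ : HasCompactSupport f)
    (_ : wNorm p U f ≤ 1), wNorm p V (commutator B l f)

end MatrixWeight

end

/-! Put k(x,y) = V^{1/p}(x) (B(x) - B(y)) U^{-1/p}(y) and let K_l be the kernel of the l-th Riesz
transform. Testing the commutator on f(y) U^{-1/p}(y) e_j and pairing the i-th entry of V^{1/p}
times the result with g shows that the kernel k_{ij}(x,y) K_l(x-y) is bounded, as a bilinear form on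
unweighted L^{p'} × L^p, by the norm N of the commutators. The weights have been absorbed into k,
which is why no A_p condition is needed. It remains to remove K_l and to turn an operator bound for
k into a bound for its mixed norm.

Removing the kernel. On a cube of side r, multiplication by (x_l - y_l)/r is a difference of
multiplications by functions bounded by one in x and in y. Since the sum over l of (x_l - y_l)
K_l(x-y) is |x-y|^{1-d}, the kernel r^{-1} |x-y|^{1-d} k is bounded by 2dN
(`norm_integral_fracKernel_le`). Next, |z| = c ∫ (1 - cos⟨z,ξ⟩) |ξ|^{-d-1} dξ, and trigonometric
addition makes multiplication by |x-y| a Schur multiplier on a ball, with norm of the order of the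
radius (`exists_schurBound_norm_sub`). Applying this d-1 times leaves k itself, bounded by C r^d N
(`exists_norm_integral_tensor_le`).

Finite rank. Expanding B(x) - B(y) writes each entry of k as a sum of 2m products a(x) b(y). A
kernel of rank n that is bounded by M as a form on L^{p'} × L^p has L^p(L^{p'}) mixed norm at most
C_n M (`exists_mixed_le`): subtracting the rank-one kernel built from a nearly extremal pair lowers
the rank by one and enlarges the form by a factor of at most three. The same lemma applied to the
transposed kernel gives the dual quantity. In the averages over the cube the factor r^d cancels.

Two points need care. The weights and B are unbounded, so the argument runs on sets where they are
bounded; the constants do not see these sets and monotone convergence removes them. Also, `riesz` is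
defined through a limit, so the principal values must be shown to exist almost everywhere for
bounded integrable functions (`ae_exists_tendsto_truncRiesz`). For this the Riesz kernel is written
as a superposition of odd Gaussian kernels. The partial superpositions have uniformly bounded
symbols, which gives a weak L² limit v. The truncation at scale δ differs from an average of v at
scale δ by a convolution with a dilated, odd, integrable kernel, and at common Lebesgue points this
error tends to zero. -/

noncomputable section

namespace MatrixWeight

/-! ### Radial integrability -/

section Radial

variable {d : ℕ}

/-- In polar coordinates the Jacobian cancels |u|^{1-d} exactly and leaves the constant 1. This
local integrability serves both the fractional integral kernel and the regularized Riesz kernel. -/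
theorem integrableOn_norm_mul_inv_pow [NeZero d] (R : ℝ) :
    IntegrableOn (fun u : Rd d => ‖u‖ * (‖u‖ ^ d)⁻¹) (Metric.ball 0 R) := by
  have : Nontrivial (Rd d) := inferInstance
  rw [integrableOn_fun_norm_addHaar volume (f := fun y : ℝ => y * (y ^ d)⁻¹)]
  have h : IntegrableOn (fun _ : ℝ => (1 : ℝ)) (Set.Ioo 0 R) := by simp
  refine h.congr_fun (fun y hy => ?_) measurableSet_Ioo
  have hy0 : y ≠ 0 := hy.1.ne'
  obtain ⟨k, rfl⟩ := Nat.exists_eq_succ_of_ne_zero (NeZero.ne d)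
  simp only [finrank_euclideanSpace, Fintype.card_fin, smul_eq_mul, Nat.succ_eq_add_one,
    Nat.add_sub_cancel]
  field_simp
  ring

/-- The radial density is min(2, y²)/y², which is bounded near zero and O(y^{-2}) at infinity. The
quadratic smallness at the origin is what every frequency estimate for the Schur multiplier must
preserve. -/
theorem integrable_min_mul_inv_pow [NeZero d] :
    Integrable (fun ξ : Rd d => min 2 (‖ξ‖ ^ 2) * (‖ξ‖ ^ (d + 1))⁻¹) := by
  have : Nontrivial (Rd d) := inferInstance
  rw [integrable_fun_norm_addHaar volume (f := fun y : ℝ => min 2 (y ^ 2) * (y ^ (d + 1))⁻¹)]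
  have key : ∀ y : ℝ, 0 < y → y ^ (Module.finrank ℝ (Rd d) - 1) •
      (min 2 (y ^ 2) * (y ^ (d + 1))⁻¹) = min 2 (y ^ 2) * (y ^ 2)⁻¹ := by
    intro y hy
    have hy0 : y ≠ 0 := hy.ne'
    obtain ⟨k, rfl⟩ := Nat.exists_eq_succ_of_ne_zero (NeZero.ne d)
    simp only [finrank_euclideanSpace, Fintype.card_fin, smul_eq_mul, Nat.succ_eq_add_one,
      Nat.add_sub_cancel]
    field_simp
    ring
  have hme : Measurable (fun y : ℝ => min 2 (y ^ 2) * (y ^ 2)⁻¹) := by fun_prop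
  have h : IntegrableOn (fun y : ℝ => min 2 (y ^ 2) * (y ^ 2)⁻¹) (Set.Ioi 0) := by
    rw [← Set.Ioc_union_Ioi_eq_Ioi (zero_le_one (α := ℝ))]
    refine IntegrableOn.union ?_ ?_
    · refine Measure.integrableOn_of_bounded (M := 1) (by simp) hme.aestronglyMeasurable ?_
      filter_upwards [ae_restrict_mem measurableSet_Ioc] with y hy
      have : 0 < y ^ 2 := by have := hy.1; positivity
      rw [Real.norm_of_nonneg (by positivity), ← div_eq_mul_inv, div_le_one this]
      exact min_le_right _ _
    · have := (integrableOn_Ioi_rpow_of_lt (a := -2) (by norm_num) (zero_lt_one (α := ℝ))).const_mul 2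
      refine this.mono' hme.aestronglyMeasurable ?_
      filter_upwards [ae_restrict_mem measurableSet_Ioi] with y hy
      have hy : 1 < y := hy
      have h0 : 0 < y := by linarith
      rw [Real.norm_of_nonneg (by positivity), Real.rpow_neg h0.le]
      norm_num
      gcongr
      exact min_le_left _ _
  exact h.congr_fun (fun y hy => (key y hy).symm) measurableSet_Ioi

theorem integrable_inv_one_add_norm_pow (d : ℕ) :
    Integrable (fun u : Rd d => ((1 + ‖u‖) ^ (d + 1))⁻¹) := by
  have := integrable_one_add_norm (E := Rd d) (μ := volume) (r := d + 1) (by simp)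
  refine this.congr (Eventually.of_forall fun u => ?_)
  have h : 0 ≤ 1 + ‖u‖ := by positivity
  simp only
  rw [Real.rpow_neg h]
  norm_cast

end Radial

/-! ### The Euclidean norm as a superposition of cosines -/

section NormFormula

variable {d : ℕ}

theorem one_sub_cos_le (t : ℝ) : 1 - Real.cos t ≤ min 2 (t ^ 2) := by
  refine le_min (by linarith [Real.neg_one_le_cos t]) ?_
  have := Real.one_sub_sq_div_two_le_cos (x := t)
  nlinarith [sq_nonneg t]

theorem integrable_one_sub_cos_inner [NeZero d] (z : Rd d) :
    Integrable (fun ξ : Rd d => (1 - Real.cos (inner ℝ z ξ)) * (‖ξ‖ ^ (d + 1))⁻¹) := by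
  refine ((integrable_min_mul_inv_pow (d := d)).const_mul (1 + ‖z‖ ^ 2)).mono'
    (by fun_prop) (Eventually.of_forall fun ξ => ?_)
  have h1 := one_sub_cos_le (inner ℝ z ξ)
  have h0 : 0 ≤ 1 - Real.cos (inner ℝ z ξ) := by linarith [Real.cos_le_one (inner ℝ z ξ)]
  rw [Real.norm_of_nonneg (by positivity), ← mul_assoc]
  gcongr
  have h2 : (inner ℝ z ξ) ^ 2 ≤ ‖z‖ ^ 2 * ‖ξ‖ ^ 2 := by
    rw [← mul_pow]; exact sq_le_sq' (neg_le_of_abs_le (abs_real_inner_le_norm z ξ)) (real_inner_le_norm z ξ)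
  rcases le_total 2 (‖ξ‖ ^ 2) with h | h
  · rw [min_eq_left h]
    nlinarith [min_le_left 2 ((inner ℝ z ξ) ^ 2), sq_nonneg ‖z‖]
  · rw [min_eq_right h]
    nlinarith [min_le_right 2 ((inner ℝ z ξ) ^ 2), sq_nonneg ‖z‖, sq_nonneg ‖ξ‖]

/-- The norm is a positive multiple of `∫ (1 - cos ⟨z, ξ⟩) |ξ|^{-d-1} dξ`. -/
theorem exists_norm_eq_integral_one_sub_cos [NeZero d] : ∃ c : ℝ, 0 ≤ c ∧ ∀ z : Rd d,
    ‖z‖ = c * ∫ ξ : Rd d, (1 - Real.cos (inner ℝ z ξ)) * (‖ξ‖ ^ (d + 1))⁻¹ := by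
  set I : Rd d → ℝ := fun z => ∫ ξ : Rd d, (1 - Real.cos (inner ℝ z ξ)) * (‖ξ‖ ^ (d + 1))⁻¹ with hI
  have hnn : ∀ z ξ : Rd d, 0 ≤ (1 - Real.cos (inner ℝ z ξ)) * (‖ξ‖ ^ (d + 1))⁻¹ := fun z ξ => by
    have h0 : 0 ≤ 1 - Real.cos (inner ℝ z ξ) := by linarith [Real.cos_le_one (inner ℝ z ξ)]
    positivity
  -- Both the norm and `I` are invariant under isometries and homogeneous of degree one, so they are
  -- proportional. The reflection in the hyperplane orthogonal to z - w exchanges two vectors of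
  -- equal length.
  have hrot : ∀ z w : Rd d, ‖z‖ = ‖w‖ → I z = I w := by
    intro z w hzw
    set r := (ℝ ∙ (z - w))ᗮ.reflection
    have hr : r z = w := Submodule.reflection_sub hzw
    have := (r.measurePreserving).integral_comp r.toHomeomorph.measurableEmbedding
      (fun ξ : Rd d => (1 - Real.cos (inner ℝ w ξ)) * (‖ξ‖ ^ (d + 1))⁻¹)
    simp only [hI]
    rw [← this]
    congr 1
    ext ξ
    rw [← hr, LinearIsometryEquiv.inner_map_map, LinearIsometryEquiv.norm_map]
  -- Under ξ ↦ tξ the Jacobian t^d meets t^{-(d+1)} from the density, which leaves one factor t.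
  have hsc : ∀ (t : ℝ) (z : Rd d), 0 < t → I (t • z) = t * I z := by
    intro t z ht
    have := Measure.integral_comp_smul (volume : Measure (Rd d))
      (fun ξ : Rd d => (1 - Real.cos (inner ℝ z ξ)) * (‖ξ‖ ^ (d + 1))⁻¹) t
    simp only [finrank_euclideanSpace, Fintype.card_fin, smul_eq_mul] at this
    rw [abs_of_pos (by positivity)] at this
    have h2 : I z = t ^ d * ∫ ξ : Rd d, (1 - Real.cos (inner ℝ z (t • ξ))) * (‖t • ξ‖ ^ (d + 1))⁻¹ := by
      rw [this]; simp only [hI]; field_simp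
    rw [h2, ← mul_assoc, ← pow_succ', ← integral_const_mul]
    simp only [hI]
    congr 1
    ext ξ
    rw [inner_smul_left, inner_smul_right, norm_smul, Real.norm_of_nonneg ht.le, mul_pow]
    simp only [conj_trivial]
    field_simp
  obtain ⟨e, he⟩ : ∃ e : Rd d, ‖e‖ = 1 := by
    have : Nontrivial (Rd d) := inferInstance
    exact exists_norm_eq (Rd d) zero_le_one
  have hIe : 0 < I e := by
    simp only [hI]
    rw [integral_pos_iff_support_of_nonneg (hnn e) (integrable_one_sub_cos_inner e)]
    have hopen : IsOpen {ξ : Rd d | ξ ≠ 0 ∧ Real.cos (inner ℝ e ξ) < 1} := by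
      refine IsOpen.inter isOpen_ne ?_
      have hc : Continuous fun ξ : Rd d => Real.cos (inner ℝ e ξ) := by fun_prop
      exact isOpen_lt hc continuous_const
    refine lt_of_lt_of_le (hopen.measure_pos volume ⟨e, ?_, ?_⟩) (measure_mono ?_)
    · intro h; simp [h] at he
    · rw [real_inner_self_eq_norm_sq, he]; have := Real.cos_one_le; norm_num; linarith
    · rintro ξ ⟨h1, h2⟩
      have : ‖ξ‖ ≠ 0 := by simpa using h1
      simp only [Function.mem_support]
      have : 1 - Real.cos (inner ℝ e ξ) ≠ 0 := by linarith
      positivity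
  refine ⟨(I e)⁻¹, by positivity, fun z => ?_⟩
  change ‖z‖ = (I e)⁻¹ * I z
  rcases eq_or_ne z 0 with rfl | hz
  · simp [hI]
  · have hz' : 0 < ‖z‖ := norm_pos_iff.2 hz
    have h1 : I z = I (‖z‖ • e) := hrot _ _ (by rw [norm_smul, he]; simp)
    rw [h1, hsc _ _ hz']
    field_simp

end NormFormula

/-! ### Multiplication by |x - y| as a Schur multiplier -/

section Schur

variable {d : ℕ}

/-- `G` pairs with products `a(x) b(y)` of bounded functions with constant `A`. -/
def SchurBound (S : Set (Rd d)) (G : Rd d × Rd d → ℂ) (A : ℝ) : Prop :=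
  ∀ (a b : Rd d → ℝ) (α β : ℝ), Measurable a → Measurable b → (∀ x ∈ S, |a x| ≤ α) →
    (∀ y ∈ S, |b y| ≤ β) → ‖∫ q : Rd d × Rd d, ((a q.1 * b q.2 : ℝ) : ℂ) * G q‖ ≤ α * β * A

/-- Each of the three products separates the variables and is small to second order, the last
because it is a product of two sines. This keeps the integral against |ξ|^{-d-1} convergent at ξ =
0. -/
theorem one_sub_cos_sub (X Y : ℝ) : 1 - Real.cos (X - Y) =
    (1 - Real.cos X) + Real.cos X * (1 - Real.cos Y) - Real.sin X * Real.sin Y := by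
  rw [Real.cos_sub]; ring

theorem integrable_ofReal_mul_of_bound {G : Rd d × Rd d → ℂ} (hG : Integrable G)
    {S : Set (Rd d)} (hsupp : ∀ q, ¬ (q.1 ∈ S ∧ q.2 ∈ S) → G q = 0)
    {φ : Rd d × Rd d → ℝ} {M : ℝ} (hφ : Measurable φ)
    (hM : ∀ q, q.1 ∈ S → q.2 ∈ S → |φ q| ≤ M) :
    Integrable (fun q => ((φ q : ℝ) : ℂ) * G q) := by
  refine (hG.norm.const_mul M).mono'
    ((Complex.measurable_ofReal.comp hφ).aestronglyMeasurable.mul hG.aestronglyMeasurable)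
    (Eventually.of_forall fun q => ?_)
  rw [norm_mul, Complex.norm_real, Real.norm_eq_abs]
  by_cases h : q.1 ∈ S ∧ q.2 ∈ S
  · exact mul_le_mul_of_nonneg_right (hM q h.1 h.2) (norm_nonneg _)
  · simp [hsupp q h]

/-- Multiplication by `|x - y|` is a Schur multiplier on a ball, with norm comparable to the
radius. -/
theorem exists_schurBound_norm_sub [NeZero d] : ∃ C : ℝ, 0 ≤ C ∧ ∀ (x₀ : Rd d) (ρ : ℝ)
    (G : Rd d × Rd d → ℂ) (A : ℝ), 0 < ρ → 0 ≤ A → Integrable G →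
    (∀ q, ¬ (q.1 ∈ Metric.closedBall x₀ ρ ∧ q.2 ∈ Metric.closedBall x₀ ρ) → G q = 0) →
    SchurBound (Metric.closedBall x₀ ρ) G A →
    SchurBound (Metric.closedBall x₀ ρ) (fun q => (‖q.1 - q.2‖ : ℂ) * G q) (C * ρ * A) := by
  obtain ⟨c, hc, hcz⟩ := exists_norm_eq_integral_one_sub_cos (d := d)
  set J := ∫ ξ : Rd d, min 2 (‖ξ‖ ^ 2) * (‖ξ‖ ^ (d + 1))⁻¹ with hJ
  have hJ0 : 0 ≤ J := integral_nonneg fun ξ => by positivity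
  refine ⟨c * (3 * J), by positivity, ?_⟩
  intro x₀ ρ G A hρ hA hG hsupp hSB a b α β ha hb hα hβ
  set S := Metric.closedBall x₀ ρ with hS
  have hx₀ : x₀ ∈ S := by simp [hS, hρ.le]
  have hα0 : 0 ≤ α := (abs_nonneg _).trans (hα x₀ hx₀)
  have hβ0 : 0 ≤ β := (abs_nonneg _).trans (hβ x₀ hx₀)
  set κ : Rd d → ℝ := fun ξ => (‖ξ‖ ^ (d + 1))⁻¹ with hκ
  have hκ0 : ∀ ξ, 0 ≤ κ ξ := fun ξ => by positivity
  -- Centering and dividing by ρ gives phases bounded by |ξ| on the ball. Undoing the scaling by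
  -- homogeneity of the norm produces the factor ρ in the conclusion.
  set P : Rd d → Rd d → ℝ := fun ξ x => inner ℝ (ρ⁻¹ • (x - x₀)) ξ with hP
  have hPm : ∀ ξ, Measurable (P ξ) := fun ξ => by fun_prop
  have hPle : ∀ ξ, ∀ x ∈ S, |P ξ x| ≤ ‖ξ‖ := by
    intro ξ x hx
    have h1 : ‖ρ⁻¹ • (x - x₀)‖ ≤ 1 := by
      rw [norm_smul, norm_inv, Real.norm_of_nonneg hρ.le, inv_mul_le_iff₀ hρ]
      simpa [hS, dist_eq_norm] using hx
    calc |P ξ x| ≤ ‖ρ⁻¹ • (x - x₀)‖ * ‖ξ‖ := abs_real_inner_le_norm _ _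
      _ ≤ 1 * ‖ξ‖ := by gcongr
      _ = ‖ξ‖ := one_mul _
  have hPsub : ∀ ξ x y, inner ℝ (ρ⁻¹ • (x - y)) ξ = P ξ x - P ξ y := by
    intro ξ x y
    simp only [hP, ← inner_sub_left, ← smul_sub]
    congr 2; abel
  have hnorm : ∀ x y : Rd d, ‖x - y‖ = ρ * (c * ∫ ξ, (1 - Real.cos (P ξ x - P ξ y)) * κ ξ) := by
    intro x y
    have := hcz (ρ⁻¹ • (x - y))
    rw [norm_smul, norm_inv, Real.norm_of_nonneg hρ.le, inv_mul_eq_iff_eq_mul₀ hρ.ne'] at this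
    rw [this]
    simp only [hPsub, hκ]
  -- bounds for a single frequency
  have hone : ∀ ξ, ‖∫ q : Rd d × Rd d, ((a q.1 * b q.2 * (1 - Real.cos (P ξ q.1 - P ξ q.2)) : ℝ) : ℂ)
      * G q‖ ≤ 3 * min 2 (‖ξ‖ ^ 2) * (α * β * A) := by
    intro ξ
    set M := min 2 (‖ξ‖ ^ 2) with hM
    have hM0 : 0 ≤ M := by positivity
    have hcos : ∀ x ∈ S, |1 - Real.cos (P ξ x)| ≤ M := by
      intro x hx
      rw [abs_of_nonneg (by linarith [Real.cos_le_one (P ξ x)])]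
      refine (one_sub_cos_le _).trans (min_le_min le_rfl ?_)
      rw [← sq_abs]; gcongr; exact hPle ξ x hx
    -- A single sine is small only to first order; the sines in x and in y contribute √M each, so
    -- their product again costs M.
    have hsin : ∀ x ∈ S, |Real.sin (P ξ x)| ≤ √M := by
      intro x hx
      apply Real.le_sqrt_of_sq_le
      refine le_min ?_ ?_
      · rw [sq_abs]; nlinarith [Real.sin_sq_add_cos_sq (P ξ x), sq_nonneg (Real.cos (P ξ x))]
      · have := (Real.abs_sin_le_abs (x := P ξ x)).trans (hPle ξ x hx)
        gcongr
    have e1 := hSB (fun x => a x * (1 - Real.cos (P ξ x))) b (α * M) β (by fun_prop) hb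
      (fun x hx => by rw [abs_mul]; exact mul_le_mul (hα x hx) (hcos x hx) (abs_nonneg _) hα0) hβ
    have e2 := hSB (fun x => a x * Real.cos (P ξ x)) (fun y => b y * (1 - Real.cos (P ξ y))) α (β * M)
      (by fun_prop) (by fun_prop)
      (fun x hx => by
        rw [abs_mul]
        exact (mul_le_mul (hα x hx) (Real.abs_cos_le_one _) (abs_nonneg _) hα0).trans_eq (mul_one _))
      (fun x hx => by rw [abs_mul]; exact mul_le_mul (hβ x hx) (hcos x hx) (abs_nonneg _) hβ0)
    have e3 := hSB (fun x => a x * Real.sin (P ξ x)) (fun y => b y * Real.sin (P ξ y))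
      (α * √M) (β * √M) (by fun_prop) (by fun_prop)
      (fun x hx => by rw [abs_mul]; exact mul_le_mul (hα x hx) (hsin x hx) (abs_nonneg _) hα0)
      (fun x hx => by rw [abs_mul]; exact mul_le_mul (hβ x hx) (hsin x hx) (abs_nonneg _) hβ0)
    have hab : ∀ (u v : Rd d → ℝ) (s t : ℝ), Measurable u → Measurable v → (∀ x ∈ S, |u x| ≤ s) →
        (∀ x ∈ S, |v x| ≤ t) →
        Integrable (fun q : Rd d × Rd d => ((u q.1 * v q.2 : ℝ) : ℂ) * G q) := by
      intro u v s t hu hv hs ht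
      refine integrable_ofReal_mul_of_bound hG hsupp (M := s * t) (by fun_prop) ?_
      intro q h1 h2
      rw [abs_mul]
      exact mul_le_mul (hs _ h1) (ht _ h2) (abs_nonneg _) ((abs_nonneg _).trans (hs _ h1))
    have i1 := hab (fun x => a x * (1 - Real.cos (P ξ x))) b (α * M) β (by fun_prop) hb
      (fun x hx => by rw [abs_mul]; exact mul_le_mul (hα x hx) (hcos x hx) (abs_nonneg _) hα0) hβ
    have i2 := hab (fun x => a x * Real.cos (P ξ x)) (fun y => b y * (1 - Real.cos (P ξ y))) α (β * M)
      (by fun_prop) (by fun_prop)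
      (fun x hx => by
        rw [abs_mul]
        exact (mul_le_mul (hα x hx) (Real.abs_cos_le_one _) (abs_nonneg _) hα0).trans_eq (mul_one _))
      (fun x hx => by rw [abs_mul]; exact mul_le_mul (hβ x hx) (hcos x hx) (abs_nonneg _) hβ0)
    have i3 := hab (fun x => a x * Real.sin (P ξ x)) (fun y => b y * Real.sin (P ξ y))
      (α * √M) (β * √M) (by fun_prop) (by fun_prop)
      (fun x hx => by rw [abs_mul]; exact mul_le_mul (hα x hx) (hsin x hx) (abs_nonneg _) hα0)
      (fun x hx => by rw [abs_mul]; exact mul_le_mul (hβ x hx) (hsin x hx) (abs_nonneg _) hβ0)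
    have hsplit : (∫ q : Rd d × Rd d, ((a q.1 * b q.2 * (1 - Real.cos (P ξ q.1 - P ξ q.2)) : ℝ) : ℂ)
        * G q) = (∫ q : Rd d × Rd d, ((a q.1 * (1 - Real.cos (P ξ q.1)) * b q.2 : ℝ) : ℂ) * G q)
        + (∫ q : Rd d × Rd d, ((a q.1 * Real.cos (P ξ q.1) * (b q.2 * (1 - Real.cos (P ξ q.2))) : ℝ) : ℂ) * G q)
        - (∫ q : Rd d × Rd d, ((a q.1 * Real.sin (P ξ q.1) * (b q.2 * Real.sin (P ξ q.2)) : ℝ) : ℂ) * G q) := by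
      rw [← integral_add i1 i2]
      refine Eq.trans ?_ (integral_sub (i1.add i2) i3)
      congr 1
      ext q
      rw [one_sub_cos_sub]
      push_cast
      ring
    rw [hsplit]
    refine (norm_sub_le _ _).trans ((add_le_add ((norm_add_le _ _).trans (add_le_add e1 e2)) e3).trans
      (le_of_eq ?_))
    have : √M * √M = M := Real.mul_self_sqrt hM0
    linear_combination (α * β * A) * this
  -- Fubini
  have hFub : (∫ q : Rd d × Rd d, ((a q.1 * b q.2 : ℝ) : ℂ) * ((‖q.1 - q.2‖ : ℂ) * G q))
      = (ρ * c : ℝ) * ∫ ξ, (κ ξ : ℂ) * ∫ q : Rd d × Rd d,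
        ((a q.1 * b q.2 * (1 - Real.cos (P ξ q.1 - P ξ q.2)) : ℝ) : ℂ) * G q := by
    have hint : Integrable (Function.uncurry fun (q : Rd d × Rd d) (ξ : Rd d) =>
        (κ ξ : ℂ) * (((a q.1 * b q.2 * (1 - Real.cos (P ξ q.1 - P ξ q.2)) : ℝ) : ℂ) * G q))
        ((volume : Measure (Rd d × Rd d)).prod volume) := by
      have hdom := ((hG.norm.const_mul (α * β)).mul_prod
        ((integrable_min_mul_inv_pow (d := d)).const_mul 4))
      refine hdom.mono' ?_ (Eventually.of_forall fun w => ?_)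
      · have hκm : Measurable κ := by fun_prop
        refine AEStronglyMeasurable.mul
          (Complex.measurable_ofReal.comp (hκm.comp measurable_snd)).aestronglyMeasurable (AEStronglyMeasurable.mul ?_
          hG.aestronglyMeasurable.comp_fst)
        refine Measurable.aestronglyMeasurable ?_
        simp only [hP]
        fun_prop
      · obtain ⟨q, ξ⟩ := w
        simp only [Function.uncurry]
        by_cases h : q.1 ∈ S ∧ q.2 ∈ S
        · rw [norm_mul, norm_mul, Complex.norm_real, Complex.norm_real, Real.norm_of_nonneg (hκ0 ξ),
            Real.norm_eq_abs, abs_mul, abs_mul]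
          have hd : |1 - Real.cos (P ξ q.1 - P ξ q.2)| ≤ 4 * min 2 (‖ξ‖ ^ 2) := by
            rw [abs_of_nonneg (by linarith [Real.cos_le_one (P ξ q.1 - P ξ q.2)])]
            have h1 := one_sub_cos_le (P ξ q.1 - P ξ q.2)
            have h2 : (P ξ q.1 - P ξ q.2) ^ 2 ≤ 4 * ‖ξ‖ ^ 2 := by
              have := abs_sub (P ξ q.1) (P ξ q.2)
              have h3 : |P ξ q.1 - P ξ q.2| ≤ 2 * ‖ξ‖ := by
                linarith [hPle ξ _ h.1, hPle ξ _ h.2]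
              rw [← sq_abs]
              calc _ ≤ (2 * ‖ξ‖) ^ 2 := by gcongr
                _ = _ := by ring
            rcases le_total 2 (‖ξ‖ ^ 2) with h | h
            · rw [min_eq_left h]; linarith [min_le_left 2 ((P ξ q.1 - P ξ q.2) ^ 2)]
            · rw [min_eq_right h]; linarith [min_le_right 2 ((P ξ q.1 - P ξ q.2) ^ 2)]
          have h1 := hα _ h.1
          have h2 := hβ _ h.2
          calc κ ξ * (|a q.1| * |b q.2| * |1 - Real.cos (P ξ q.1 - P ξ q.2)| * ‖G q‖)
              ≤ κ ξ * (α * β * (4 * min 2 (‖ξ‖ ^ 2)) * ‖G q‖) := by gcongr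
            _ = _ := by simp only [hκ]; ring
        · rw [hsupp q h]; simp
    rw [← integral_const_mul]
    simp_rw [← integral_const_mul]
    rw [← integral_integral_swap (hint.const_mul ((ρ * c : ℝ) : ℂ))]
    congr 1
    ext q
    rw [hnorm q.1 q.2]
    have : ((ρ * (c * ∫ ξ, (1 - Real.cos (P ξ q.1 - P ξ q.2)) * κ ξ) : ℝ) : ℂ)
        = ((ρ * c : ℝ) : ℂ) * ∫ ξ, (((1 - Real.cos (P ξ q.1 - P ξ q.2)) * κ ξ : ℝ) : ℂ) := by
      rw [integral_complex_ofReal]; push_cast; ring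
    rw [this, ← integral_const_mul, ← integral_mul_const, ← integral_const_mul]
    congr 1
    ext ξ
    push_cast
    ring
  rw [hFub, norm_mul, Complex.norm_real, Real.norm_of_nonneg (by positivity)]
  set I : Rd d → ℂ := fun ξ => ∫ q : Rd d × Rd d,
    ((a q.1 * b q.2 * (1 - Real.cos (P ξ q.1 - P ξ q.2)) : ℝ) : ℂ) * G q with hI
  have hlast : ‖∫ ξ, (κ ξ : ℂ) * I ξ‖
      ≤ ∫ ξ : Rd d, (3 * (α * β * A)) * (min 2 (‖ξ‖ ^ 2) * (‖ξ‖ ^ (d + 1))⁻¹) := by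
    refine norm_integral_le_of_norm_le ((integrable_min_mul_inv_pow (d := d)).const_mul _)
      (Eventually.of_forall fun ξ => ?_)
    rw [norm_mul, Complex.norm_real, Real.norm_of_nonneg (hκ0 ξ)]
    refine (mul_le_mul_of_nonneg_left (hone ξ) (hκ0 ξ)).trans (le_of_eq ?_)
    simp only [hκ]
    ring
  rw [integral_const_mul, ← hJ] at hlast
  refine (mul_le_mul_of_nonneg_left hlast (by positivity)).trans (le_of_eq ?_)
  ring

/-- Iterated form of `exists_schurBound_norm_sub`. -/
theorem exists_schurBound_norm_sub_pow [NeZero d] (n : ℕ) : ∃ C : ℝ, 0 ≤ C ∧ ∀ (x₀ : Rd d) (ρ : ℝ)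
    (G : Rd d × Rd d → ℂ) (A : ℝ), 0 < ρ → 0 ≤ A → Integrable G →
    (∀ q, ¬ (q.1 ∈ Metric.closedBall x₀ ρ ∧ q.2 ∈ Metric.closedBall x₀ ρ) → G q = 0) →
    SchurBound (Metric.closedBall x₀ ρ) G A →
    SchurBound (Metric.closedBall x₀ ρ) (fun q => ((‖q.1 - q.2‖ ^ n : ℝ) : ℂ) * G q)
      (C * ρ ^ n * A) := by
  induction n with
  | zero => exact ⟨1, zero_le_one, fun x₀ ρ G A _ _ _ _ h => by simpa using h⟩
  | succ n ih =>
    obtain ⟨C₁, hC₁, h₁⟩ := ih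
    obtain ⟨C₂, hC₂, h₂⟩ := exists_schurBound_norm_sub (d := d)
    refine ⟨C₂ * C₁, by positivity, fun x₀ ρ G A hρ hA hG hsupp hSB => ?_⟩
    have hG' : Integrable (fun q : Rd d × Rd d => ((‖q.1 - q.2‖ ^ n : ℝ) : ℂ) * G q) := by
      refine integrable_ofReal_mul_of_bound hG hsupp (M := (2 * ρ) ^ n) (by fun_prop) ?_
      intro q h1 h2
      rw [abs_of_nonneg (by positivity), ← dist_eq_norm]
      gcongr
      linarith [dist_triangle_right q.1 q.2 x₀, Metric.mem_closedBall.1 h1, Metric.mem_closedBall.1 h2]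
    have := h₂ x₀ ρ _ (C₁ * ρ ^ n * A) hρ (by positivity) hG'
      (fun q hq => by simp [hsupp q hq]) (h₁ x₀ ρ G A hρ hA hG hsupp hSB)
    convert this using 1
    · ext q; push_cast; ring
    · ring

end Schur

/-! ### Fourier analysis of the Riesz kernel -/

section Fourier

open scoped FourierTransform Real

/-! ### Odd Gaussian kernels and their symbols -/

section GaussianKernel

variable {d : ℕ}

theorem integrable_exp_neg_mul_norm_sq {b : ℝ} (hb : 0 < b) :
    Integrable (fun v : Rd d => Real.exp (-b * ‖v‖ ^ 2)) := by
  have h := (GaussianFourier.integrable_cexp_neg_mul_sq_norm_add (V := Rd d) (b := b)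
    (by simpa using hb) 0 0).norm
  refine h.congr (Eventually.of_forall fun v => ?_)
  simp only [zero_mul, add_zero, Complex.norm_exp]
  congr 1
  rw [← Complex.ofReal_pow, ← Complex.ofReal_neg, ← Complex.ofReal_mul, Complex.ofReal_re]

theorem integrable_norm_mul_exp_neg_mul_norm_sq {b : ℝ} (hb : 0 < b) :
    Integrable (fun v : Rd d => ‖v‖ * Real.exp (-b * ‖v‖ ^ 2)) := by
  refine ((integrable_exp_neg_mul_norm_sq (d := d) (half_pos hb)).const_mul
    (1 + (b / 2)⁻¹)).mono' (by fun_prop) (Eventually.of_forall fun v => ?_)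
  rw [Real.norm_of_nonneg (by positivity)]
  have h1 : Real.exp (-b * ‖v‖ ^ 2) = Real.exp (-(b / 2) * ‖v‖ ^ 2) * Real.exp (-(b / 2) * ‖v‖ ^ 2) := by
    rw [← Real.exp_add]; ring_nf
  have h2 : ‖v‖ * Real.exp (-(b / 2) * ‖v‖ ^ 2) ≤ 1 + (b / 2)⁻¹ := by
    have h3 : b / 2 * ‖v‖ ^ 2 + 1 ≤ Real.exp (b / 2 * ‖v‖ ^ 2) := Real.add_one_le_exp _
    have hpos := Real.exp_pos (b / 2 * ‖v‖ ^ 2)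
    rw [neg_mul, Real.exp_neg, ← div_eq_mul_inv, div_le_iff₀ hpos]
    have h4 : ‖v‖ ≤ 1 + ‖v‖ ^ 2 := by nlinarith [sq_nonneg (‖v‖ - 1), norm_nonneg v]
    have hb2 : 0 < b / 2 := half_pos hb
    have h5 : (1 + (b / 2)⁻¹) * (b / 2 * ‖v‖ ^ 2 + 1) ≤ (1 + (b / 2)⁻¹) * Real.exp (b / 2 * ‖v‖ ^ 2) := by
      gcongr
    have h6 : (1 + (b / 2)⁻¹) * (b / 2 * ‖v‖ ^ 2 + 1) = b / 2 * ‖v‖ ^ 2 + 1 + ‖v‖ ^ 2 + (b / 2)⁻¹ := by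
      field_simp
      ring
    have : 0 ≤ b / 2 * ‖v‖ ^ 2 := by positivity
    have : 0 ≤ (b / 2)⁻¹ := by positivity
    linarith
  rw [h1, ← mul_assoc]
  gcongr

theorem fourier_gaussian_real {s : ℝ} (hs : 0 < s) (w : Rd d) :
    𝓕 (fun v : Rd d => ((Real.exp (-(π / s ^ 2) * ‖v‖ ^ 2) : ℝ) : ℂ)) w
      = ((s ^ d * Real.exp (-(π * s ^ 2) * ‖w‖ ^ 2) : ℝ) : ℂ) := by
  have hb : 0 < ((π / s ^ 2 : ℝ) : ℂ).re := by
    rw [Complex.ofReal_re]; positivity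
  have h := fourier_gaussian_innerProductSpace (V := Rd d) hb w
  have e1 : (fun v : Rd d => ((Real.exp (-(π / s ^ 2) * ‖v‖ ^ 2) : ℝ) : ℂ))
      = fun v : Rd d => Complex.exp (-((π / s ^ 2 : ℝ) : ℂ) * (‖v‖ : ℂ) ^ 2) := by
    ext v; push_cast; rfl
  rw [e1, h]
  have hs' : (s : ℂ) ≠ 0 := by exact_mod_cast hs.ne'
  have hpi : (π : ℂ) ≠ 0 := by exact_mod_cast Real.pi_ne_zero
  have e2 : (π : ℂ) / ((π / s ^ 2 : ℝ) : ℂ) = ((s ^ 2 : ℝ) : ℂ) := by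
    push_cast; field_simp
  have e3 : ((s ^ 2 : ℝ) : ℂ) ^ ((Module.finrank ℝ (Rd d) : ℂ) / 2) = ((s ^ d : ℝ) : ℂ) := by
    have : ((Module.finrank ℝ (Rd d) : ℂ) / 2) = ((d / 2 : ℝ) : ℂ) := by
      simp
    rw [this, ← Complex.ofReal_cpow (by positivity)]
    congr 1
    rw [← Real.rpow_natCast, ← Real.rpow_natCast, ← Real.rpow_mul hs.le]
    congr 1
    push_cast; ring
  rw [e2, e3]
  push_cast
  congr 2
  field_simp

/-- The Gaussian average of the symbol of the Riesz transform. -/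
def gaussSymbol (l : Fin d) (s : ℝ) (ξ : Rd d) : ℂ :=
  -Complex.I * ((ξ l * (s ^ 2)⁻¹ * Real.exp (-(π / s ^ 2) * ‖ξ‖ ^ 2) : ℝ) : ℂ)

theorem abs_coord_le (l : Fin d) (z : Rd d) : |z l| ≤ ‖z‖ := by
  simpa using EuclideanSpace.norm_eq z ▸ (PiLp.norm_apply_le z l)

/-- Differentiating the Fourier transform of a Gaussian in the direction e_l brings down a multiple
of the l-th coordinate, and evaluating at -z turns the transform into its inverse. -/
theorem fourierInv_gaussSymbol (l : Fin d) {s : ℝ} (hs : 0 < s) (z : Rd d) :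
    𝓕⁻ (gaussSymbol l s) z = ((z l * s ^ d * Real.exp (-(π * s ^ 2) * ‖z‖ ^ 2) : ℝ) : ℂ) := by
  set f : Rd d → ℂ := fun v => ((Real.exp (-(π / s ^ 2) * ‖v‖ ^ 2) : ℝ) : ℂ) with hf
  have hb : 0 < π / s ^ 2 := by positivity
  have hfi : Integrable f := (integrable_exp_neg_mul_norm_sq hb).ofReal
  have hfi' : Integrable (fun v => ‖v‖ * ‖f v‖) := by
    refine (integrable_norm_mul_exp_neg_mul_norm_sq hb).congr (Eventually.of_forall fun v => ?_)
    simp only [hf, Complex.norm_real, Real.norm_of_nonneg (Real.exp_pos _).le]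
  set e : Rd d := EuclideanSpace.single l (1 : ℝ) with he
  have h1 := congrArg (fun D : Rd d → (Rd d →L[ℝ] ℂ) => D (-z) e) (Real.fderiv_fourier hfi hfi')
  have h2 : 𝓕 f = fun w => ((s ^ d * Real.exp (-(π * s ^ 2) * ‖w‖ ^ 2) : ℝ) : ℂ) := by
    ext w; exact fourier_gaussian_real hs w
  have h3 : HasFDerivAt (fun w : Rd d => ((s ^ d * Real.exp (-(π * s ^ 2) * ‖w‖ ^ 2) : ℝ) : ℂ))
      (Complex.ofRealCLM.comp ((s ^ d * (Real.exp (-(π * s ^ 2) * ‖-z‖ ^ 2) * (-(π * s ^ 2)))) •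
        (2 • (innerSL ℝ (-z))))) (-z) := by
    refine Complex.ofRealCLM.hasFDerivAt.comp (-z) ?_
    have := ((((hasStrictFDerivAt_norm_sq (-z : Rd d)).hasFDerivAt.const_mul
      (-(π * s ^ 2))).exp).const_mul (s ^ d))
    refine this.congr_fderiv ?_
    ext v
    simp
    ring
  rw [h2, h3.fderiv, Real.fourier_eq, ContinuousLinearMap.integral_apply] at h1
  · rw [Real.fourierInv_eq]
    have h4 : ∀ v : Rd d, (𝐞 (-(inner ℝ v (-z))) • VectorFourier.fourierSMulRight (innerSL ℝ) f v) e
        = (2 * π * s ^ 2 : ℂ) * (𝐞 (inner ℝ v z) • gaussSymbol l s v) := by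
      intro v
      have hs' : (s : ℂ) ≠ 0 := by exact_mod_cast hs.ne'
      have hve : (innerSL ℝ v) e = v l := by
        rw [innerSL_apply_apply ℝ, he]; simp [EuclideanSpace.inner_single_right]
      simp only [inner_neg_right, neg_neg, Circle.smul_def, _root_.smul_apply,
        VectorFourier.fourierSMulRight_apply, hve, gaussSymbol, hf, smul_eq_mul, Complex.real_smul]
      push_cast
      simp
      field_simp
    simp_rw [h4] at h1
    rw [integral_const_mul] at h1
    have hne : (2 * π * s ^ 2 : ℂ) ≠ 0 := by
      have : (s : ℂ) ≠ 0 := by exact_mod_cast hs.ne'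
      have hpi : (π : ℂ) ≠ 0 := by exact_mod_cast Real.pi_ne_zero
      positivity
    refine mul_left_cancel₀ hne (h1.symm.trans ?_)
    simp [he, EuclideanSpace.inner_single_right]
    ring
  · refine (Real.fourierIntegral_convergent_iff (-z)).2 ?_
    refine (hfi'.const_mul (2 * π * ‖innerSL ℝ (E := Rd d)‖)).mono'
      hfi.aestronglyMeasurable.fourierSMulRight (Eventually.of_forall fun v => ?_)
    exact (VectorFourier.norm_fourierSMulRight_le _ _ _).trans (le_of_eq (by ring))

end GaussianKernel

/-! ### The Riesz kernel as a superposition of Gaussian kernels -/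

section CutKernel

variable {d : ℕ}

/-- The convolution kernel `z_l / |z|^{d+1}` of the `l`-th Riesz transform. -/
def rieszK (l : Fin d) (z : Rd d) : ℝ := z l / ‖z‖ ^ (d + 1)

theorem measurable_rieszK (l : Fin d) : Measurable (rieszK l) := by
  unfold rieszK; fun_prop

theorem rieszK_neg (l : Fin d) (z : Rd d) : rieszK l (-z) = -rieszK l z := by
  simp [rieszK, neg_div]

theorem abs_rieszK_le (l : Fin d) (z : Rd d) : |rieszK l z| ≤ (‖z‖ ^ d)⁻¹ := by
  rcases eq_or_ne z 0 with rfl | hz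
  · simp [rieszK]
  · have : 0 < ‖z‖ := norm_pos_iff.2 hz
    rw [rieszK, abs_div, abs_of_pos (pow_pos this _), div_le_iff₀ (pow_pos this _), pow_succ]
    rw [inv_mul_cancel_left₀ (by positivity)]
    exact abs_coord_le l z

/-- An exhausting sequence of compact parameter intervals in `(0, ∞)`. -/
def cutSet (j : ℕ) : Set ℝ := Set.Ioc ((j + 1 : ℝ)⁻¹) (j + 1)

theorem cutSet_pos {j : ℕ} {s : ℝ} (hs : s ∈ cutSet j) : 0 < s :=
  lt_of_le_of_lt (by positivity) hs.1

theorem measurableSet_cutSet (j : ℕ) : MeasurableSet (cutSet j) := measurableSet_Ioc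

theorem cutSet_subset (j : ℕ) : cutSet j ⊆ Set.Ioi 0 := fun _ hs => cutSet_pos hs

theorem volume_cutSet_lt_top (j : ℕ) : volume (cutSet j) < ⊤ := by simp [cutSet]

theorem aecover_cutSet : AECover (volume.restrict (Set.Ioi (0 : ℝ))) atTop cutSet := by
  refine ⟨?_, measurableSet_cutSet⟩
  filter_upwards [ae_restrict_mem measurableSet_Ioi] with s hs
  have hs : 0 < s := hs
  obtain ⟨n, hn⟩ := exists_nat_gt (max s s⁻¹)
  filter_upwards [eventually_ge_atTop n] with j hj
  have hj' : (n : ℝ) ≤ j := by exact_mod_cast hj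
  refine ⟨?_, ?_⟩
  · rw [inv_lt_comm₀ (by positivity) hs]
    linarith [le_max_right s s⁻¹]
  · linarith [le_max_left s s⁻¹]

/-- The radial profile `s ^ d exp (-π s² r²)`. -/
def gaussProfile (d : ℕ) (r s : ℝ) : ℝ := s ^ d * Real.exp (-(π * s ^ 2) * r ^ 2)

theorem gaussProfile_nonneg {r s : ℝ} (hs : 0 < s) : 0 ≤ gaussProfile d r s := by
  unfold gaussProfile; positivity

theorem integrableOn_gaussProfile {r : ℝ} (hr : 0 < r) :
    IntegrableOn (gaussProfile d r) (Set.Ioi 0) := by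
  have h := integrableOn_rpow_mul_exp_neg_mul_sq (b := π * r ^ 2) (by positivity) (s := d)
    (by have : (0 : ℝ) ≤ d := Nat.cast_nonneg d; linarith)
  refine h.congr_fun (fun s _ => ?_) measurableSet_Ioi
  simp only [gaussProfile, Real.rpow_natCast]
  congr 2; ring

/-- The substitution s ↦ rs shows homogeneity of degree -(d+1). Hence integrating the odd kernels
z_l s^d exp(-π s² |z|²) over all scales s reproduces z_l / |z|^{d+1} up to the constant
`gaussConst`. -/
theorem integral_gaussProfile {r : ℝ} (hr : 0 < r) :
    ∫ s in Set.Ioi 0, gaussProfile d r s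
      = (r ^ (d + 1))⁻¹ * ∫ s in Set.Ioi 0, gaussProfile d 1 s := by
  have h := integral_comp_mul_left_Ioi (gaussProfile d 1) 0 hr
  have h2 : ∫ s in Set.Ioi (0 : ℝ), gaussProfile d 1 (r * s)
      = r ^ d * ∫ s in Set.Ioi 0, gaussProfile d r s := by
    rw [← integral_const_mul]
    congr 1; ext s
    simp only [gaussProfile, mul_pow, one_pow, mul_one]
    rw [mul_assoc]; congr 3; ring
  rw [h2, mul_zero, smul_eq_mul] at h
  rw [pow_succ, mul_inv, mul_assoc, ← h]
  field_simp

/-- The normalizing constant of the Gaussian superposition. -/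
def gaussConst (d : ℕ) : ℝ := ∫ s in Set.Ioi 0, gaussProfile d 1 s

theorem gaussConst_pos : 0 < gaussConst d := by
  unfold gaussConst
  rw [setIntegral_pos_iff_support_of_nonneg_ae]
  · refine lt_of_lt_of_le (b := volume (Set.Ioi (0 : ℝ))) (by simp) (measure_mono fun s hs => ⟨?_, hs⟩)
    have hs : 0 < s := hs
    simp only [Function.mem_support, gaussProfile]
    positivity
  · filter_upwards [ae_restrict_mem measurableSet_Ioi] with s hs using gaussProfile_nonneg hs
  · exact integrableOn_gaussProfile one_pos

/-- Smooth cutoff functions increasing to `1`. -/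
def cutoff (d : ℕ) (j : ℕ) (z : Rd d) : ℝ :=
  (gaussConst d)⁻¹ * (‖z‖ ^ (d + 1) * ∫ s in cutSet j, gaussProfile d ‖z‖ s)

theorem cutoff_neg (j : ℕ) (z : Rd d) : cutoff d j (-z) = cutoff d j z := by simp [cutoff]

theorem measurable_integral_gaussProfile (j : ℕ) :
    Measurable fun z : Rd d => ∫ s in cutSet j, gaussProfile d ‖z‖ s := by
  have : StronglyMeasurable (Function.uncurry fun (z : Rd d) s => gaussProfile d ‖z‖ s) := by
    unfold gaussProfile
    apply Continuous.stronglyMeasurable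
    fun_prop
  exact this.integral_prod_right.measurable

theorem measurable_cutoff (j : ℕ) : Measurable (cutoff d j) := by
  have := measurable_integral_gaussProfile (d := d) j
  unfold cutoff; fun_prop

theorem integral_cutSet_nonneg (j : ℕ) (r : ℝ) : 0 ≤ ∫ s in cutSet j, gaussProfile d r s :=
  setIntegral_nonneg (measurableSet_cutSet j) fun _ hs => gaussProfile_nonneg (cutSet_pos hs)

theorem cutoff_nonneg (j : ℕ) (z : Rd d) : 0 ≤ cutoff d j z := by
  have := gaussConst_pos (d := d)
  have := integral_cutSet_nonneg (d := d) j ‖z‖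
  unfold cutoff; positivity

theorem norm_pow_mul_integral_gaussProfile {z : Rd d} (hz : z ≠ 0) :
    (gaussConst d)⁻¹ * (‖z‖ ^ (d + 1) * ∫ s in Set.Ioi 0, gaussProfile d ‖z‖ s) = 1 := by
  have h0 : 0 < ‖z‖ := norm_pos_iff.2 hz
  have := gaussConst_pos (d := d)
  rw [integral_gaussProfile h0, ← gaussConst]
  field_simp

theorem cutoff_le_one (j : ℕ) (z : Rd d) : cutoff d j z ≤ 1 := by
  rcases eq_or_ne z 0 with rfl | hz
  · simp [cutoff]
  · have h0 : 0 < ‖z‖ := norm_pos_iff.2 hz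
    have := gaussConst_pos (d := d)
    rw [← norm_pow_mul_integral_gaussProfile hz, cutoff]
    refine mul_le_mul_of_nonneg_left (mul_le_mul_of_nonneg_left ?_ (by positivity)) (by positivity)
    refine setIntegral_mono_set (integrableOn_gaussProfile h0) ?_ (cutSet_subset j).eventuallyLE
    filter_upwards [ae_restrict_mem measurableSet_Ioi] with s hs using gaussProfile_nonneg hs

theorem tendsto_cutoff {z : Rd d} (hz : z ≠ 0) :
    Tendsto (fun j => cutoff d j z) atTop (𝓝 1) := by
  have h0 : 0 < ‖z‖ := norm_pos_iff.2 hz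
  rw [← norm_pow_mul_integral_gaussProfile hz]
  refine Tendsto.const_mul _ (Tendsto.const_mul _ ?_)
  have h := aecover_cutSet.integral_tendsto_of_countably_generated
    (integrableOn_gaussProfile (d := d) h0)
  refine h.congr fun j => ?_
  rw [Measure.restrict_restrict (measurableSet_cutSet j), Set.inter_eq_left.2 (cutSet_subset j)]

theorem cutoff_mul_rieszK (l : Fin d) (j : ℕ) (z : Rd d) :
    cutoff d j z * rieszK l z
      = (gaussConst d)⁻¹ * (z l * ∫ s in cutSet j, gaussProfile d ‖z‖ s) := by
  rcases eq_or_ne z 0 with rfl | hz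
  · simp [rieszK]
  · have h0 : 0 < ‖z‖ := norm_pos_iff.2 hz
    rw [cutoff, rieszK]
    field_simp

/-- The symbol of the cut off Riesz transform. -/
def cutSymbol (l : Fin d) (j : ℕ) (ξ : Rd d) : ℂ := ∫ s in cutSet j, gaussSymbol l s ξ

theorem norm_gaussSymbol (l : Fin d) (s : ℝ) (ξ : Rd d) : ‖gaussSymbol l s ξ‖
    = |ξ l| * (s ^ 2)⁻¹ * Real.exp (-(π / s ^ 2) * ‖ξ‖ ^ 2) := by
  rw [gaussSymbol, norm_mul, norm_neg, Complex.norm_I, one_mul, Complex.norm_real,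
    Real.norm_eq_abs, abs_mul, abs_mul, abs_of_nonneg (by positivity : 0 ≤ (s ^ 2)⁻¹), Real.abs_exp]

theorem measurable_gaussSymbol_uncurry (l : Fin d) :
    Measurable (Function.uncurry fun (s : ℝ) (ξ : Rd d) => gaussSymbol l s ξ) := by
  unfold gaussSymbol
  refine Measurable.const_mul (Complex.measurable_ofReal.comp ?_) _
  fun_prop

/-- For s in the j-th interval the Gaussian factor is largest at s = j + 1 and s^{-2} is at most
(j+1)². The resulting bound is useless as j grows, but for fixed j it permits Fubini. -/
theorem integrable_gaussSymbol_prod (l : Fin d) (j : ℕ) :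
    Integrable (Function.uncurry fun (s : ℝ) (ξ : Rd d) => gaussSymbol l s ξ)
      ((volume.restrict (cutSet j)).prod volume) := by
  have hb : 0 < π / (j + 1 : ℝ) ^ 2 := by positivity
  have h1 : Integrable (fun _ : ℝ => ((j + 1 : ℝ)) ^ 2) (volume.restrict (cutSet j)) :=
    integrableOn_const (volume_cutSet_lt_top j).ne
  refine (h1.mul_prod (integrable_norm_mul_exp_neg_mul_norm_sq (d := d) hb)).mono'
    (measurable_gaussSymbol_uncurry l).aestronglyMeasurable ?_
  have hae : ∀ᵐ w : ℝ × Rd d ∂((volume.restrict (cutSet j)).prod volume), w.1 ∈ cutSet j :=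
    (Measure.quasiMeasurePreserving_fst).ae (ae_restrict_mem (measurableSet_cutSet j))
  filter_upwards [hae] with w hw
  obtain ⟨s, ξ⟩ := w
  simp only at hw
  have hs := cutSet_pos hw
  simp only [Function.uncurry, norm_gaussSymbol]
  have e1 : (s ^ 2)⁻¹ ≤ ((j + 1 : ℝ)) ^ 2 := by
    rw [inv_le_comm₀ (by positivity) (by positivity), ← inv_pow]
    have := hw.1.le
    gcongr
  have e2 : Real.exp (-(π / s ^ 2) * ‖ξ‖ ^ 2) ≤ Real.exp (-(π / (j + 1 : ℝ) ^ 2) * ‖ξ‖ ^ 2) := by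
    have := hw.2
    gcongr
  have e3 := abs_coord_le l ξ
  calc _ ≤ ‖ξ‖ * ((j + 1 : ℝ)) ^ 2 * Real.exp (-(π / (j + 1 : ℝ) ^ 2) * ‖ξ‖ ^ 2) := by gcongr
    _ = _ := by ring

theorem integrable_cutSymbol (l : Fin d) (j : ℕ) : Integrable (cutSymbol l j) :=
  (integrable_gaussSymbol_prod l j).integral_prod_right

theorem fourierInv_cutSymbol (l : Fin d) (j : ℕ) (z : Rd d) :
    𝓕⁻ (cutSymbol l j) z = ((z l * ∫ s in cutSet j, gaussProfile d ‖z‖ s : ℝ) : ℂ) := by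
  have h1 : 𝓕⁻ (cutSymbol l j) z = ∫ s in cutSet j, 𝓕⁻ (gaussSymbol l s) z := by
    simp_rw [Real.fourierInv_eq, cutSymbol]
    rw [integral_integral_swap]
    · congr 1; ext ξ
      simp only [Circle.smul_def, integral_smul]
    · refine (integrable_gaussSymbol_prod l j).mono ?_ (Eventually.of_forall fun w => ?_)
      · refine AEStronglyMeasurable.smul ?_ (measurable_gaussSymbol_uncurry l).aestronglyMeasurable
        apply Continuous.aestronglyMeasurable
        fun_prop
      · simp [Function.uncurry]
  rw [h1, ← integral_const_mul, ← integral_complex_ofReal]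
  refine setIntegral_congr_fun (measurableSet_cutSet j) fun s hs => ?_
  simp only
  rw [fourierInv_gaussSymbol l (cutSet_pos hs), gaussProfile]
  push_cast; ring

/-- From e^t ≥ 1 + t the integrand is at most 1/(s² + r²), whose integral over the line is π/r. This
yields the bound π for the symbols, uniformly in the cutoff and in the frequency. -/
theorem integrableOn_symbolProfile {r : ℝ} (hr : 0 < r) :
    IntegrableOn (fun s : ℝ => (s ^ 2)⁻¹ * Real.exp (-(π / s ^ 2) * r ^ 2)) (Set.Ioi 0) ∧
    ∫ s in Set.Ioi 0, (s ^ 2)⁻¹ * Real.exp (-(π / s ^ 2) * r ^ 2) ≤ r⁻¹ * π := by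
  have hI : IntegrableOn (fun s : ℝ => (r ^ 2)⁻¹ * (1 + (s / r) ^ 2)⁻¹) (Set.Ioi 0) :=
    ((integrable_inv_one_add_sq.comp_div hr.ne').const_mul _).integrableOn
  have hle : ∀ s ∈ Set.Ioi (0 : ℝ), (s ^ 2)⁻¹ * Real.exp (-(π / s ^ 2) * r ^ 2)
      ≤ (r ^ 2)⁻¹ * (1 + (s / r) ^ 2)⁻¹ := by
    intro s hs
    have hs : 0 < s := hs
    have h1 : r ^ 2 / s ^ 2 + 1 ≤ Real.exp ((π / s ^ 2) * r ^ 2) := by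
      refine le_trans ?_ (Real.add_one_le_exp _)
      have : r ^ 2 / s ^ 2 ≤ π * (r ^ 2 / s ^ 2) :=
        le_mul_of_one_le_left (by positivity) (by linarith [Real.pi_gt_three])
      calc _ ≤ π * (r ^ 2 / s ^ 2) + 1 := by linarith
        _ = _ := by ring
    rw [neg_mul, Real.exp_neg, ← mul_inv, ← mul_inv]
    refine inv_anti₀ (by positivity) ?_
    calc r ^ 2 * (1 + (s / r) ^ 2) = s ^ 2 * (r ^ 2 / s ^ 2 + 1) := by field_simp
      _ ≤ _ := by gcongr
  have hint : IntegrableOn (fun s : ℝ => (s ^ 2)⁻¹ * Real.exp (-(π / s ^ 2) * r ^ 2)) (Set.Ioi 0) := by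
    refine hI.mono' (by fun_prop) ?_
    filter_upwards [ae_restrict_mem measurableSet_Ioi] with s hs
    rw [Real.norm_of_nonneg (by positivity)]
    exact hle s hs
  refine ⟨hint, (setIntegral_mono_on hint hI measurableSet_Ioi hle).trans ?_⟩
  have h2 : ∫ s in Set.Ioi (0 : ℝ), (r ^ 2)⁻¹ * (1 + (s / r) ^ 2)⁻¹
      ≤ ∫ s : ℝ, (r ^ 2)⁻¹ * (1 + (s / r) ^ 2)⁻¹ :=
    setIntegral_le_integral ((integrable_inv_one_add_sq.comp_div hr.ne').const_mul _)
      (Eventually.of_forall fun s => by positivity)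
  refine h2.trans (le_of_eq ?_)
  rw [integral_const_mul, Measure.integral_comp_div (fun s : ℝ => (1 + s ^ 2)⁻¹),
    integral_univ_inv_one_add_sq, abs_of_pos hr, smul_eq_mul]
  field_simp

/-- The limit of the symbols `cutSymbol l j`. -/
def limSymbol (l : Fin d) (ξ : Rd d) : ℂ := ∫ s in Set.Ioi 0, gaussSymbol l s ξ

theorem measurable_limSymbol (l : Fin d) : Measurable (limSymbol l) := by
  have : StronglyMeasurable (Function.uncurry fun (s : ℝ) (ξ : Rd d) => gaussSymbol l s ξ) :=
    (measurable_gaussSymbol_uncurry l).stronglyMeasurable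
  exact this.integral_prod_left.measurable

theorem integrableOn_gaussSymbol (l : Fin d) (ξ : Rd d) :
    IntegrableOn (fun s => gaussSymbol l s ξ) (Set.Ioi 0) := by
  rcases eq_or_ne ξ 0 with rfl | hξ
  · simp [gaussSymbol]
  · have h := ((integrableOn_symbolProfile (norm_pos_iff.2 hξ)).1.const_mul (ξ l)).ofReal
      (𝕜 := ℂ)
    refine (h.const_mul (-Complex.I)).congr (Eventually.of_forall fun s => ?_)
    simp [gaussSymbol, mul_assoc]

theorem integral_norm_gaussSymbol_le (l : Fin d) (ξ : Rd d) :
    ∫ s in Set.Ioi 0, ‖gaussSymbol l s ξ‖ ≤ π := by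
  rcases eq_or_ne ξ 0 with rfl | hξ
  · simp [gaussSymbol, Real.pi_pos.le]
  · have h0 := norm_pos_iff.2 hξ
    simp_rw [norm_gaussSymbol, mul_assoc]
    rw [integral_const_mul]
    calc _ ≤ ‖ξ‖ * (‖ξ‖⁻¹ * π) := by
          gcongr
          · exact abs_coord_le l ξ
          · exact (integrableOn_symbolProfile h0).2
      _ = π := by field_simp

theorem norm_limSymbol_le (l : Fin d) (ξ : Rd d) : ‖limSymbol l ξ‖ ≤ π :=
  (norm_integral_le_integral_norm _).trans (integral_norm_gaussSymbol_le l ξ)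

theorem norm_cutSymbol_le (l : Fin d) (j : ℕ) (ξ : Rd d) : ‖cutSymbol l j ξ‖ ≤ π :=
  (norm_integral_le_integral_norm _).trans
    ((setIntegral_mono_set (integrableOn_gaussSymbol l ξ).norm
      (Eventually.of_forall fun _ => norm_nonneg _) (cutSet_subset j).eventuallyLE).trans
    (integral_norm_gaussSymbol_le l ξ))

theorem tendsto_cutSymbol (l : Fin d) (ξ : Rd d) :
    Tendsto (fun j => cutSymbol l j ξ) atTop (𝓝 (limSymbol l ξ)) := by
  have h := aecover_cutSet.integral_tendsto_of_countably_generated (integrableOn_gaussSymbol l ξ)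
  refine h.congr fun j => ?_
  rw [Measure.restrict_restrict (measurableSet_cutSet j), Set.inter_eq_left.2 (cutSet_subset j),
    cutSymbol]

end CutKernel

/-! ### Weak L² limits of the cut off Riesz transforms -/

section WeakLimit

variable {d : ℕ}

theorem continuous_fourier_of_integrable {g : Rd d → ℂ} (hg : Integrable g) : Continuous (𝓕 g) :=
  VectorFourier.fourierIntegral_continuous Real.continuous_fourierChar
    (by exact continuous_inner) hg

theorem integral_fourier_mul_eq {f g : Rd d → ℂ} (hf : Integrable f) (hg : Integrable g) :
    ∫ ξ, 𝓕 f ξ * g ξ = ∫ x, f x * 𝓕 g x := by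
  have := VectorFourier.integral_fourierIntegral_smul_eq_flip (μ := volume) (ν := volume)
    (L := innerₗ (Rd d)) Real.continuous_fourierChar continuous_inner hf hg
  simpa using! this

/-- On `L¹ ∩ L²` the Fourier transform of `L²` is the Fourier integral. -/
theorem fourier_toLp_ae_eq {g : Rd d → ℂ} (hg : Integrable g) (hg2 : MemLp g 2) :
    ((𝓕 (hg2.toLp g) : Lp ℂ 2 (volume : Measure (Rd d))) : Rd d → ℂ) =ᵐ[volume] 𝓕 g := by
  -- The two transforms agree as tempered distributions, so it suffices to pair them with smooth
  -- compactly supported functions.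
  refine ae_eq_of_integral_contDiff_smul_eq ?_
    (continuous_fourier_of_integrable hg).locallyIntegrable fun φ hφ hφc => ?_
  · exact (Lp.memLp _).locallyIntegrable (by norm_num)
  · have hφC : ContDiff ℝ (⊤ : ℕ∞) (fun x => (φ x : ℂ)) := Complex.ofRealCLM.contDiff.comp hφ
    have hφcC : HasCompactSupport (fun x => (φ x : ℂ)) :=
      hφc.comp_left (g := fun t : ℝ => (t : ℂ)) Complex.ofReal_zero
    set ψ : SchwartzMap (Rd d) ℂ := hφcC.toSchwartzMap hφC with hψ
    have hψφ : ∀ x, ψ x = (φ x : ℂ) := fun x => rfl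
    have h1 := congrArg (fun T : TemperedDistribution (Rd d) ℂ => T ψ)
      (Lp.fourier_toTemperedDistribution_eq (hg2.toLp g))
    simp only [TemperedDistribution.fourier_apply, Lp.toTemperedDistribution_apply] at h1
    have h2 : ∫ x, φ x • ((𝓕 (hg2.toLp g) : Lp ℂ 2 (volume : Measure (Rd d))) : Rd d → ℂ) x
        = ∫ x, (𝓕 ψ) x • (hg2.toLp g : Rd d → ℂ) x := by
      rw [h1]
      congr 1
    have h3 : ∫ x, (𝓕 ψ) x • (hg2.toLp g : Rd d → ℂ) x = ∫ x, 𝓕 (ψ : Rd d → ℂ) x * g x := by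
      refine integral_congr_ae ?_
      filter_upwards [hg2.coeFn_toLp] with x hx
      rw [hx, SchwartzMap.fourier_coe, smul_eq_mul]
    rw [h2, h3, integral_fourier_mul_eq ψ.integrable hg]
    rfl

theorem memLp_fourier {g : Rd d → ℂ} (hg : Integrable g) (hg2 : MemLp g 2) : MemLp (𝓕 g) 2 :=
  (memLp_congr_ae (fourier_toLp_ae_eq hg hg2)).1 (Lp.memLp _)

/-- Pairing with a convolution in terms of Fourier integrals. -/
theorem integral_mul_integral_fourierInv {μ g φ : Rd d → ℂ} (hμ : Integrable μ) (hg : Integrable g) (hφ : Integrable φ) :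
    ∫ x, φ x * ∫ y, 𝓕⁻ μ (x - y) * g y = ∫ ξ, μ ξ * 𝓕 g ξ * 𝓕⁻ φ ξ := by
  have hc := continuous_fourier_of_integrable hg
  have hb : ∀ ξ, ‖𝓕 g ξ‖ ≤ ∫ y, ‖g y‖ := fun ξ =>
    VectorFourier.norm_fourierIntegral_le_integral_norm _ _ _ _ _
  have hprod : Integrable (fun ξ => μ ξ * 𝓕 g ξ) := by
    refine hμ.mul_bdd (c := ∫ y, ‖g y‖) hc.aestronglyMeasurable (Eventually.of_forall hb)
  have h1 : ∀ x, ∫ y, 𝓕⁻ μ (x - y) * g y = 𝓕⁻ (fun ξ => μ ξ * 𝓕 g ξ) x := by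
    intro x
    set μx : Rd d → ℂ := fun ξ => 𝐞 (inner ℝ ξ x) • μ ξ with hμx
    have hμxi : Integrable μx := by
      refine hμ.norm.mono' ?_ (Eventually.of_forall fun ξ => by simp [hμx])
      refine AEStronglyMeasurable.smul ?_ hμ.aestronglyMeasurable
      apply Continuous.aestronglyMeasurable
      fun_prop
    have h2 : ∀ y, 𝓕⁻ μ (x - y) = 𝓕 μx y := by
      intro y
      rw [Real.fourierInv_eq, Real.fourier_eq]
      congr 1; ext ξ
      simp only [hμx, Circle.smul_def, smul_eq_mul, inner_sub_right]
      rw [← mul_assoc, sub_eq_neg_add, AddChar.map_add_eq_mul]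
      simp
    simp_rw [h2]
    rw [integral_fourier_mul_eq hμxi hg, Real.fourierInv_eq]
    congr 1; ext ξ
    simp only [hμx, Circle.smul_def, smul_eq_mul]
    ring
  simp_rw [h1]
  have h3 : ∀ x, 𝓕⁻ (fun ξ => μ ξ * 𝓕 g ξ) x = 𝓕 (fun ξ => μ (-ξ) * 𝓕 g (-ξ)) x := fun x => by
    rw [Real.fourierInv_eq_fourier_comp_neg]
  simp_rw [h3]
  rw [← integral_fourier_mul_eq hφ hprod.comp_neg, ← integral_neg_eq_self]
  congr 1; ext ξ
  rw [neg_neg, Real.fourierInv_eq_fourier_neg]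
  ring

theorem fourierInv_ofReal_eq_conj (φ : Rd d → ℝ) (ξ : Rd d) :
    𝓕⁻ (fun x => (φ x : ℂ)) ξ = starRingEnd ℂ (𝓕 (fun x => (φ x : ℂ)) ξ) := by
  rw [Real.fourierInv_eq, Real.fourier_eq, ← integral_conj]
  congr 1; ext x
  simp [Circle.smul_def, ← Circle.coe_inv_eq_conj, AddChar.map_neg_eq_inv]

/-- The cut off Riesz transforms of a function in `L¹ ∩ L²` converge weakly in `L²`. -/
theorem exists_weak_limit (l : Fin d) {g : Rd d → ℂ} (hg : Integrable g) (hg2 : MemLp g 2) :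
    ∃ v : Rd d → ℂ, MemLp v 2 ∧ ∀ φ : Rd d → ℝ, Integrable φ → MemLp φ 2 →
      Tendsto (fun j => ∫ x, (φ x : ℂ) * ∫ y, ((cutoff d j (x - y) * rieszK l (x - y) : ℝ) : ℂ) * g y)
        atTop (𝓝 (∫ x, (φ x : ℂ) * v x)) := by
  have hm : MemLp (fun ξ => limSymbol l ξ * 𝓕 g ξ) 2 :=
    (memLp_fourier hg hg2).of_le_mul (c := π)
      ((measurable_limSymbol l).aestronglyMeasurable.mul (memLp_fourier hg hg2).1)
      (Eventually.of_forall fun ξ => by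
        rw [norm_mul]; gcongr; exact norm_limSymbol_le l ξ)
  set w : Lp ℂ 2 (volume : Measure (Rd d)) := 𝓕⁻ (hm.toLp _) with hw
  refine ⟨fun x => ((gaussConst d)⁻¹ : ℂ) * w x, (Lp.memLp w).const_mul _, fun φ hφ hφ2 => ?_⟩
  have hφC : Integrable (fun x => (φ x : ℂ)) := hφ.ofReal
  have hφC2 : MemLp (fun x => (φ x : ℂ)) 2 := hφ2.ofReal
  have hF := memLp_fourier hφC hφC2
  have hcut : ∀ (j : ℕ) (z : Rd d), ((cutoff d j z * rieszK l z : ℝ) : ℂ)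
      = ((gaussConst d)⁻¹ : ℂ) * 𝓕⁻ (cutSymbol l j) z := by
    intro j z
    rw [cutoff_mul_rieszK, fourierInv_cutSymbol]
    push_cast; ring
  have hpair : ∀ j, (∫ x, (φ x : ℂ) *
      ∫ y, ((cutoff d j (x - y) * rieszK l (x - y) : ℝ) : ℂ) * g y)
      = ((gaussConst d)⁻¹ : ℂ) * ∫ ξ, cutSymbol l j ξ * 𝓕 g ξ * 𝓕⁻ (fun x => (φ x : ℂ)) ξ := by
    intro j
    rw [← integral_mul_integral_fourierInv (integrable_cutSymbol l j) hg
      hφC, ← integral_const_mul]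
    congr 1; ext x
    simp_rw [hcut, mul_assoc]
    rw [integral_const_mul]
    ring
  have hlim : ∫ x, (φ x : ℂ) * (((gaussConst d)⁻¹ : ℂ) * w x) = ((gaussConst d)⁻¹ : ℂ) *
      ∫ ξ, limSymbol l ξ * 𝓕 g ξ * 𝓕⁻ (fun x => (φ x : ℂ)) ξ := by
    -- Plancherel moves the pairing to the frequency side, where the transform of `w` is by
    -- construction the limit symbol times the transform of `g`.
    have h1 : inner ℂ (hφC2.toLp _) w = inner ℂ (𝓕 (hφC2.toLp _)) (hm.toLp _) := by
      rw [← Lp.inner_fourier_eq, hw, FourierTransform.fourier_fourierInv_eq]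
    rw [L2.inner_def, L2.inner_def] at h1
    have h2 : ∫ x, (φ x : ℂ) * w x = ∫ x, inner ℂ ((hφC2.toLp _ : Lp ℂ 2 volume) x) (w x) := by
      refine integral_congr_ae ?_
      filter_upwards [hφC2.coeFn_toLp] with x hx
      rw [hx]; simp [mul_comm]
    have h3 : ∫ ξ, inner ℂ ((𝓕 (hφC2.toLp _) : Lp ℂ 2 (volume : Measure (Rd d))) ξ)
        ((hm.toLp _ : Lp ℂ 2 volume) ξ)
        = ∫ ξ, limSymbol l ξ * 𝓕 g ξ * 𝓕⁻ (fun x => (φ x : ℂ)) ξ := by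
      refine integral_congr_ae ?_
      filter_upwards [hm.coeFn_toLp, fourier_toLp_ae_eq hφC hφC2] with ξ h4 h5
      rw [h4, h5, fourierInv_ofReal_eq_conj]
      simp
    rw [← h3, ← h1, ← h2, ← integral_const_mul]
    congr 1; ext x; ring
  rw [hlim]
  simp_rw [hpair]
  refine Tendsto.const_mul _ ?_
  have hFi : MemLp (𝓕⁻ (fun x => (φ x : ℂ))) 2 := by
    have : 𝓕⁻ (fun x => (φ x : ℂ)) = fun ξ => starRingEnd ℂ (𝓕 (fun x => (φ x : ℂ)) ξ) := by
      ext ξ; exact fourierInv_ofReal_eq_conj φ ξ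
    rw [this]; exact hF.star
  -- The symbols are bounded by π for every j, so the product of two L² functions dominates the
  -- integrands.
  have hdom : Integrable (fun ξ => π * (‖𝓕 g ξ‖ * ‖𝓕⁻ (fun x => (φ x : ℂ)) ξ‖)) :=
    ((memLp_fourier hg hg2).norm.integrable_mul hFi.norm).const_mul _
  refine tendsto_integral_of_dominated_convergence _ (fun j => ?_) hdom (fun j => ?_) ?_
  · exact ((integrable_cutSymbol l j).aestronglyMeasurable.mul
      (memLp_fourier hg hg2).1).mul hFi.1
  · refine Eventually.of_forall fun ξ => ?_
    rw [norm_mul, norm_mul, mul_assoc]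
    gcongr
    exact norm_cutSymbol_le l j ξ
  · exact Eventually.of_forall fun ξ => ((tendsto_cutSymbol l ξ).mul_const _).mul_const _

end WeakLimit

end Fourier

/-! ### Dilations and Lebesgue points -/

section Dilation

variable {d : ℕ} {F : Type*} [NormedAddCommGroup F] [NormedSpace ℝ F]

theorem integral_comp_sub_smul (f : Rd d → F) (x : Rd d) {δ : ℝ} (hδ : 0 < δ) :
    ∫ y, f y = δ ^ d • ∫ u, f (x - δ • u) := by
  rw [Measure.integral_comp_smul volume (fun u => f (x - u)) δ, integral_sub_left_eq_self f volume x,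
    smul_smul, finrank_euclideanSpace, Fintype.card_fin, abs_of_pos (by positivity),
    mul_inv_cancel₀ (by positivity), one_smul]

theorem integrable_comp_sub_smul {f : Rd d → ℂ} (hf : Integrable f) (x : Rd d) {δ : ℝ}
    (hδ : δ ≠ 0) : Integrable (fun u => f (x - δ • u)) :=
  (hf.comp_sub_left x).comp_smul hδ

/-- Lebesgue's differentiation theorem in dilation form. -/
theorem ae_tendsto_integral_norm_sub {f : Rd d → ℂ} (hf : LocallyIntegrable f) :
    ∀ᵐ x, ∀ R : ℝ, 0 < R → Tendsto (fun δ : ℝ => ∫ u in Metric.closedBall (0 : Rd d) R,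
      ‖f (x - δ • u) - f x‖) (𝓝[>] 0) (𝓝 0) := by
  filter_upwards [IsUnifLocDoublingMeasure.ae_tendsto_average_norm_sub (μ := volume) hf 1]
    with x hx R hR
  have h1 : Tendsto (fun δ : ℝ => R * δ) (𝓝[>] 0) (𝓝[>] 0) := by
    refine tendsto_nhdsWithin_iff.2 ⟨?_, ?_⟩
    · have : Tendsto (fun δ : ℝ => R * δ) (𝓝 0) (𝓝 (R * 0)) := tendsto_id.const_mul R
      rw [mul_zero] at this
      exact this.mono_left nhdsWithin_le_nhds
    · filter_upwards [self_mem_nhdsWithin] with δ hδ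
      exact mul_pos hR hδ
  have h2 := hx (l := 𝓝[>] (0 : ℝ)) (fun _ => x) (fun δ => R * δ) h1 (by
    filter_upwards [self_mem_nhdsWithin] with δ hδ
    have hδ : 0 < δ := hδ
    simp only [one_mul, Metric.mem_closedBall, dist_self]
    positivity)
  have h3 := h2.const_mul (volume.real (Metric.closedBall (0 : Rd d) R))
  rw [mul_zero] at h3
  refine h3.congr' ?_
  filter_upwards [self_mem_nhdsWithin] with δ hδ
  have hδ : 0 < δ := hδ
  have e1 : ∫ y in Metric.closedBall x (R * δ), ‖f y - f x‖
      = δ ^ d * ∫ u in Metric.closedBall (0 : Rd d) R, ‖f (x - δ • u) - f x‖ := by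
    rw [← integral_indicator Metric.isClosed_closedBall.measurableSet,
      ← integral_indicator Metric.isClosed_closedBall.measurableSet,
      integral_comp_sub_smul _ x hδ, smul_eq_mul]
    congr 2; ext u
    have : (x - δ • u ∈ Metric.closedBall x (R * δ)) ↔ u ∈ Metric.closedBall (0 : Rd d) R := by
      simp only [Metric.mem_closedBall, dist_eq_norm, sub_zero, sub_sub_cancel_left, norm_neg,
        norm_smul, Real.norm_of_nonneg hδ.le]
      rw [mul_comm R δ, mul_le_mul_iff_right₀ hδ]
    by_cases h : u ∈ Metric.closedBall (0 : Rd d) R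
    · rw [Set.indicator_of_mem h, Set.indicator_of_mem (this.2 h)]
    · rw [Set.indicator_of_notMem h, Set.indicator_of_notMem (fun h' => h (this.1 h'))]
  have e2 : volume.real (Metric.closedBall x (R * δ))
      = δ ^ d * volume.real (Metric.closedBall (0 : Rd d) R) := by
    rw [mul_comm R δ, measureReal_def, Measure.addHaar_closedBall_mul volume x hδ.le hR.le,
      ENNReal.toReal_mul, ENNReal.toReal_ofReal (by positivity), finrank_euclideanSpace,
      Fintype.card_fin, measureReal_def]
  have hv : 0 < volume.real (Metric.closedBall (0 : Rd d) R) := by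
    rw [measureReal_def]
    exact ENNReal.toReal_pos (Metric.measure_closedBall_pos volume _ hR).ne'
      measure_closedBall_lt_top.ne
  rw [setAverage_eq, e1, e2, smul_eq_mul]
  field_simp

end Dilation

/-! ### Regularizing the Riesz kernel with a tent function -/

section Tent

variable {d : ℕ}

/-- The total mass of the truncated cone `max 0 (1 - |u|)`. -/
def tentMass (d : ℕ) : ℝ := ∫ u : Rd d, max 0 (1 - ‖u‖)

/-- A Lipschitz bump function of integral one. -/
def tent (d : ℕ) (u : Rd d) : ℝ := (tentMass d)⁻¹ * max 0 (1 - ‖u‖)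

theorem continuous_tent_aux : Continuous fun u : Rd d => max 0 (1 - ‖u‖) := by fun_prop

theorem hasCompactSupport_tent_aux : HasCompactSupport fun u : Rd d => max 0 (1 - ‖u‖) := by
  refine HasCompactSupport.intro (isCompact_closedBall (0 : Rd d) 1) fun u hu => ?_
  have : 1 < ‖u‖ := by simpa using hu
  exact max_eq_left (by linarith)

theorem tentMass_pos : 0 < tentMass d := by
  refine continuous_tent_aux.integral_pos_of_hasCompactSupport_nonneg_nonzero
    hasCompactSupport_tent_aux (fun u => le_max_left _ _) (x := 0) ?_
  simp

theorem tent_nonneg (u : Rd d) : 0 ≤ tent d u := by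
  have := tentMass_pos (d := d)
  unfold tent; positivity

theorem tent_neg (u : Rd d) : tent d (-u) = tent d u := by simp [tent]

theorem continuous_tent : Continuous (tent d) := continuous_const.mul continuous_tent_aux

theorem hasCompactSupport_tent : HasCompactSupport (tent d) :=
  hasCompactSupport_tent_aux.mul_left

theorem integrable_tent : Integrable (tent d) :=
  continuous_tent.integrable_of_hasCompactSupport hasCompactSupport_tent

theorem integral_tent : ∫ u, tent d u = 1 := by
  have := tentMass_pos (d := d)
  unfold tent
  rw [integral_const_mul, ← tentMass]
  field_simp

theorem tent_eq_zero {u : Rd d} (hu : 1 ≤ ‖u‖) : tent d u = 0 := by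
  rw [tent, max_eq_left (by linarith), mul_zero]

theorem tent_le (u : Rd d) : tent d u ≤ (tentMass d)⁻¹ := by
  have := tentMass_pos (d := d)
  unfold tent
  refine mul_le_of_le_one_right (by positivity) (max_le zero_le_one ?_)
  linarith [norm_nonneg u]

theorem abs_tent_sub_le (u v : Rd d) : |tent d u - tent d v| ≤ (tentMass d)⁻¹ * ‖u - v‖ := by
  have := tentMass_pos (d := d)
  unfold tent
  rw [← mul_sub, abs_mul, abs_of_pos (by positivity : 0 < (tentMass d)⁻¹)]
  gcongr
  refine (abs_max_sub_max_le_max _ _ _ _).trans (max_le (by simp) ?_)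
  rw [sub_sub_sub_cancel_left, abs_sub_comm]
  exact abs_norm_sub_norm_le u v

/-- The Riesz kernel paired with the tent function, at unit scale. -/
def tentRieszIntegrand (l : Fin d) (y u : Rd d) : ℝ :=
  (tent d (y - u) - tent d y * (Metric.ball (0 : Rd d) 3).indicator 1 u) * rieszK l u

/-- The regularization of the Riesz kernel by the tent function. -/
def tentRiesz (l : Fin d) (y : Rd d) : ℝ := ∫ u, tentRieszIntegrand l y u

theorem measurable_tentRieszIntegrand (l : Fin d) :
    Measurable (Function.uncurry (tentRieszIntegrand l)) := by
  have h1 := (continuous_tent (d := d)).measurable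
  have h2 := measurable_rieszK l
  have h3 : Measurable ((Metric.ball (0 : Rd d) 3).indicator (1 : Rd d → ℝ)) :=
    measurable_one.indicator Metric.isOpen_ball.measurableSet
  unfold tentRieszIntegrand
  exact ((h1.comp (measurable_fst.sub measurable_snd)).sub
    ((h1.comp measurable_fst).mul (h3.comp measurable_snd))).mul (h2.comp measurable_snd)

/-- An integrable majorant of `tentRieszIntegrand l y`. -/
def tentMajorant (y u : Rd d) : ℝ :=
  (tentMass d)⁻¹ * ((Metric.ball (0 : Rd d) 3).indicator (fun u => ‖u‖ * (‖u‖ ^ d)⁻¹) u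
    + (Metric.closedBall y 1).indicator 1 u)

/-- Near the origin the Lipschitz bound of the tent removes one power of the singularity. Off the
ball the Riesz kernel is at most 1 and the shifted tent lives on the unit ball about y. Any radius
at least 1 could replace 3. -/
theorem abs_tentRieszIntegrand_le (l : Fin d) (y u : Rd d) :
    |tentRieszIntegrand l y u| ≤ tentMajorant y u := by
  have h0 := tentMass_pos (d := d)
  have hK := abs_rieszK_le l u
  rw [tentRieszIntegrand, tentMajorant, abs_mul]
  have hi : 0 ≤ (Metric.closedBall y 1).indicator (1 : Rd d → ℝ) u :=
    Set.indicator_nonneg (fun _ _ => zero_le_one) _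
  by_cases hu : u ∈ Metric.ball (0 : Rd d) 3
  · rw [Set.indicator_of_mem hu, Set.indicator_of_mem hu, Pi.one_apply, mul_one]
    have h1 := abs_tent_sub_le (y - u) y
    rw [sub_sub_cancel_left, norm_neg] at h1
    calc _ ≤ ((tentMass d)⁻¹ * ‖u‖) * (‖u‖ ^ d)⁻¹ := by gcongr
      _ = (tentMass d)⁻¹ * (‖u‖ * (‖u‖ ^ d)⁻¹ + 0) := by ring
      _ ≤ _ := by gcongr
  · rw [Set.indicator_of_notMem hu, Set.indicator_of_notMem hu, mul_zero, sub_zero, zero_add,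
      abs_of_nonneg (tent_nonneg _)]
    have hu3 : 3 ≤ ‖u‖ := by simpa using hu
    have hK1 : |rieszK l u| ≤ 1 := hK.trans (inv_le_one_of_one_le₀ (one_le_pow₀ (by linarith)))
    by_cases hy : u ∈ Metric.closedBall y 1
    · rw [Set.indicator_of_mem hy, Pi.one_apply, mul_one]
      calc _ ≤ (tentMass d)⁻¹ * 1 := by gcongr; exact tent_le _
        _ = _ := mul_one _
    · have : 1 ≤ ‖y - u‖ := by
        rw [Metric.mem_closedBall, dist_eq_norm, not_le, norm_sub_rev] at hy
        exact hy.le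
      rw [tent_eq_zero this, zero_mul]
      positivity

theorem integrable_tentMajorant [NeZero d] (y : Rd d) : Integrable (tentMajorant y) := by
  refine Integrable.const_mul (Integrable.add ?_ ?_) _
  · exact (integrableOn_norm_mul_inv_pow 3).integrable_indicator Metric.isOpen_ball.measurableSet
  · rw [integrable_indicator_iff Metric.isClosed_closedBall.measurableSet]
    exact integrableOn_const measure_closedBall_lt_top.ne

/-- Only the unit ball about y moves, and its volume does not. This makes the bound for `tentRiesz`
uniform in y. -/
theorem integral_tentMajorant_eq [NeZero d] (y : Rd d) :
    ∫ u, tentMajorant y u = ∫ u, tentMajorant (0 : Rd d) u := by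
  have h1 : ∀ y : Rd d, Integrable ((Metric.closedBall y 1).indicator (1 : Rd d → ℝ)) := fun y => by
    rw [integrable_indicator_iff Metric.isClosed_closedBall.measurableSet]
    exact integrableOn_const measure_closedBall_lt_top.ne
  have h2 : Integrable ((Metric.ball (0 : Rd d) 3).indicator (fun u => ‖u‖ * (‖u‖ ^ d)⁻¹)) :=
    (integrableOn_norm_mul_inv_pow 3).integrable_indicator Metric.isOpen_ball.measurableSet
  unfold tentMajorant
  rw [integral_const_mul, integral_const_mul, integral_add h2 (h1 y), integral_add h2 (h1 0),
    integral_indicator_one Metric.isClosed_closedBall.measurableSet,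
    integral_indicator_one Metric.isClosed_closedBall.measurableSet, measureReal_def,
    measureReal_def, Measure.addHaar_closedBall_center]

theorem measurable_tentRiesz (l : Fin d) : Measurable (tentRiesz l) :=
  (measurable_tentRieszIntegrand l).stronglyMeasurable.integral_prod_right.measurable

theorem abs_tentRiesz_le [NeZero d] (l : Fin d) (y : Rd d) :
    |tentRiesz l y| ≤ ∫ u, tentMajorant (0 : Rd d) u := by
  rw [← integral_tentMajorant_eq y, ← Real.norm_eq_abs]
  exact norm_integral_le_of_norm_le (integrable_tentMajorant y)
    (Eventually.of_forall fun u => (Real.norm_eq_abs _).trans_le <| abs_tentRieszIntegrand_le l y u)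

theorem tentRiesz_neg (l : Fin d) (y : Rd d) : tentRiesz l (-y) = -tentRiesz l y := by
  rw [tentRiesz, tentRiesz, ← integral_neg, ← integral_neg_eq_self]
  congr 1; ext u
  have h1 : (Metric.ball (0 : Rd d) 3).indicator (1 : Rd d → ℝ) (-u)
      = (Metric.ball (0 : Rd d) 3).indicator 1 u := by simp [Set.indicator]
  rw [tentRieszIntegrand, tentRieszIntegrand, rieszK_neg, h1, tent_neg, neg_sub_neg,
    ← neg_sub y u, tent_neg]
  ring

/-- Away from the singularity |y - w| is comparable with |y|, and the difference gains one power of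
|y| over the size |y|^{-d} of the kernel. That gain makes `tentError` integrable at infinity. -/
theorem abs_rieszK_sub_le (l : Fin d) {y w : Rd d} (hy : 2 ≤ ‖y‖) (hw : ‖w‖ ≤ 1) :
    |rieszK l (y - w) - rieszK l y| ≤ ((d + 2) * 2 ^ (2 * d + 1)) * (‖y‖ ^ (d + 1))⁻¹ := by
  set a := ‖y - w‖ with ha
  set b := ‖y‖ with hb
  have hab : |a - b| ≤ 1 := by
    have := abs_norm_sub_norm_le (y - w) y
    rw [sub_sub_cancel_left, norm_neg] at this
    exact this.trans hw
  have h1 := abs_le.1 hab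
  have hb0 : 0 < b := by linarith
  have ha0 : 0 < a := by linarith
  have ha2 : b / 2 ≤ a := by linarith
  have ha3 : a ≤ 2 * b := by linarith
  have hpow : |a ^ (d + 1) - b ^ (d + 1)| ≤ (d + 1) * (2 * b) ^ d := by
    have := abs_pow_sub_pow_le a b (d + 1)
    refine this.trans ?_
    have hmax : max |a| |b| ≤ 2 * b := by
      rw [abs_of_pos ha0, abs_of_pos hb0]; exact max_le ha3 (by linarith)
    have : 0 ≤ max |a| |b| := le_max_of_le_left (abs_nonneg a)
    calc |a - b| * ((d + 1 : ℕ) : ℝ) * max |a| |b| ^ (d + 1 - 1)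
        ≤ 1 * ((d + 1 : ℕ) : ℝ) * (2 * b) ^ (d + 1 - 1) := by gcongr
      _ = _ := by push_cast; simp
  have e : rieszK l (y - w) - rieszK l y
      = (-(w l) * b ^ (d + 1) - y l * (a ^ (d + 1) - b ^ (d + 1))) / (a ^ (d + 1) * b ^ (d + 1)) := by
    rw [rieszK, rieszK, ← ha, ← hb]
    rw [div_sub_div _ _ (by positivity) (by positivity)]
    simp only [PiLp.sub_apply]
    congr 1
    ring
  rw [e, abs_div, abs_of_pos (by positivity : 0 < a ^ (d + 1) * b ^ (d + 1)),
    div_le_iff₀ (by positivity)]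
  have hn : |(-(w l) * b ^ (d + 1) - y l * (a ^ (d + 1) - b ^ (d + 1)))|
      ≤ 1 * b ^ (d + 1) + b * ((d + 1) * (2 * b) ^ d) := by
    refine (abs_sub _ _).trans (add_le_add ?_ ?_)
    · rw [abs_mul, abs_neg, abs_of_pos (by positivity : 0 < b ^ (d + 1))]
      have := (abs_coord_le l w).trans hw
      gcongr
    · rw [abs_mul]
      have := abs_coord_le l y
      gcongr
  refine hn.trans ?_
  have h5 : (b / 2) ^ (d + 1) ≤ a ^ (d + 1) := by gcongr
  calc 1 * b ^ (d + 1) + b * ((d + 1) * (2 * b) ^ d)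
      = (1 + (d + 1) * 2 ^ d) * b ^ (d + 1) := by rw [mul_pow, pow_succ]; ring
    _ ≤ ((d + 2) * 2 ^ d) * b ^ (d + 1) := by
        gcongr
        have : (1 : ℝ) ≤ 2 ^ d := one_le_pow₀ (by norm_num)
        linarith
    _ = ((d + 2) * 2 ^ (2 * d + 1)) * (b / 2) ^ (d + 1) := by
        rw [div_pow]
        have : (2 : ℝ) ^ (2 * d + 1) = 2 ^ d * 2 ^ (d + 1) := by rw [← pow_add]; congr 1; ring
        rw [this]; field_simp
    _ ≤ ((d + 2) * 2 ^ (2 * d + 1)) * a ^ (d + 1) := by gcongr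
    _ = _ := by field_simp

/-- The difference of the regularized and of the truncated Riesz kernel. -/
def tentError (l : Fin d) (y : Rd d) : ℝ :=
  tentRiesz l y - {y : Rd d | 1 < ‖y‖}.indicator (rieszK l) y

theorem measurableSet_one_lt_norm : MeasurableSet {y : Rd d | 1 < ‖y‖} :=
  measurableSet_lt measurable_const measurable_norm

theorem measurable_tentError (l : Fin d) : Measurable (tentError l) :=
  (measurable_tentRiesz l).sub ((measurable_rieszK l).indicator measurableSet_one_lt_norm)

theorem tentError_neg (l : Fin d) (y : Rd d) : tentError l (-y) = -tentError l y := by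
  have h : {y : Rd d | 1 < ‖y‖}.indicator (rieszK l) (-y)
      = -{y : Rd d | 1 < ‖y‖}.indicator (rieszK l) y := by
    by_cases hy : 1 < ‖y‖
    · rw [Set.indicator_of_mem, Set.indicator_of_mem, rieszK_neg]
      · exact hy
      · simpa using hy
    · rw [Set.indicator_of_notMem, Set.indicator_of_notMem, neg_zero]
      · exact hy
      · simpa using hy
  rw [tentError, tentError, h, tentRiesz_neg]
  ring

/-- An odd function has integral zero. This cancellation will allow g(x) to be subtracted from g(x -
δy) at a Lebesgue point. -/
theorem integral_tentError (l : Fin d) : ∫ y, tentError l y = 0 := by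
  have h : ∫ y, tentError l y = -∫ y, tentError l y := by
    conv_lhs => rw [← integral_neg_eq_self]
    simp_rw [tentError_neg]
    rw [integral_neg]
  linarith

/-- For |y| < 2 both kernels are bounded. For |y| ≥ 2 the tent vanishes at y and the truncation is
inactive, so the error is the tent average of K(y - w) - K(y), which the smoothness estimate
controls. -/
theorem exists_abs_tentError_le [NeZero d] (l : Fin d) : ∃ C : ℝ, 0 ≤ C ∧
    ∀ y, |tentError l y| ≤ C * ((1 + ‖y‖) ^ (d + 1))⁻¹ := by
  set M := ∫ u, tentMajorant (0 : Rd d) u with hM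
  have hM0 : 0 ≤ M := (abs_nonneg _).trans (abs_tentRiesz_le l 0)
  set C₁ : ℝ := (d + 2) * 2 ^ (2 * d + 1) with hC₁
  refine ⟨(M + 1) * 3 ^ (d + 1) + C₁ * 2 ^ (d + 1), by positivity, fun y => ?_⟩
  rcases lt_or_ge ‖y‖ 2 with hy | hy
  · have h1 : |{y : Rd d | 1 < ‖y‖}.indicator (rieszK l) y| ≤ 1 := by
      by_cases h : 1 < ‖y‖
      · rw [Set.indicator_of_mem (by exact h)]
        exact (abs_rieszK_le l y).trans (inv_le_one_of_one_le₀ (one_le_pow₀ h.le))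
      · rw [Set.indicator_of_notMem (by exact h)]; simp
    have h2 : |tentError l y| ≤ M + 1 :=
      (abs_sub _ _).trans (add_le_add (abs_tentRiesz_le l y) h1)
    have h3 : (1 : ℝ) ≤ 3 ^ (d + 1) * ((1 + ‖y‖) ^ (d + 1))⁻¹ := by
      rw [← div_eq_mul_inv, one_le_div (by positivity)]
      gcongr; linarith
    have h4 : 0 ≤ C₁ * 2 ^ (d + 1) * ((1 + ‖y‖) ^ (d + 1))⁻¹ := by positivity
    calc |tentError l y| ≤ (M + 1) * 1 := by linarith
      _ ≤ (M + 1) * (3 ^ (d + 1) * ((1 + ‖y‖) ^ (d + 1))⁻¹) := by gcongr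
      _ ≤ _ := by nlinarith
  · have h1 : {y : Rd d | 1 < ‖y‖}.indicator (rieszK l) y = rieszK l y :=
      Set.indicator_of_mem (by show 1 < ‖y‖; linarith) _
    have h2 : tentRiesz l y = ∫ w, tent d w * rieszK l (y - w) := by
      rw [tentRiesz, ← integral_sub_left_eq_self _ volume y]
      congr 1; ext w
      rw [tentRieszIntegrand, tent_eq_zero (by linarith : 1 ≤ ‖y‖), zero_mul, sub_zero,
        sub_sub_cancel]
    have h3 : tentError l y = ∫ w, tent d w * (rieszK l (y - w) - rieszK l y) := by
      have hbd : ∀ w, ‖tent d w * (rieszK l (y - w) - rieszK l y)‖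
          ≤ tent d w * (C₁ * (‖y‖ ^ (d + 1))⁻¹) := by
        intro w
        rw [norm_mul, Real.norm_of_nonneg (tent_nonneg w), Real.norm_eq_abs]
        rcases le_or_gt 1 ‖w‖ with hw | hw
        · rw [tent_eq_zero hw]; simp
        · have := abs_rieszK_sub_le l hy hw.le
          have := tent_nonneg w
          gcongr
      have hi1 : Integrable fun w => tent d w * (rieszK l (y - w) - rieszK l y) := by
        refine (integrable_tent.mul_const (C₁ * (‖y‖ ^ (d + 1))⁻¹)).mono' ?_
          (Eventually.of_forall hbd)
        refine (continuous_tent.measurable.mul (Measurable.sub ?_ measurable_const)).aestronglyMeasurable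
        exact (measurable_rieszK l).comp (measurable_const.sub measurable_id)
      have hi2 : Integrable fun w => tent d w * rieszK l y := integrable_tent.mul_const _
      rw [tentError, h1, h2]
      have : rieszK l y = ∫ w, tent d w * rieszK l y := by
        rw [integral_mul_const, integral_tent, one_mul]
      conv_lhs => rw [this]
      have hi3 : Integrable fun w => tent d w * rieszK l (y - w) := by
        refine (hi1.add hi2).congr (Eventually.of_forall fun w => ?_)
        simp only [Pi.add_apply]; ring
      rw [← integral_sub hi3 hi2]
      congr 1; ext w; ring
    have h4 : |tentError l y| ≤ C₁ * (‖y‖ ^ (d + 1))⁻¹ := by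
      rw [h3, ← Real.norm_eq_abs]
      calc _ ≤ ∫ w, tent d w * (C₁ * (‖y‖ ^ (d + 1))⁻¹) := by
            refine norm_integral_le_of_norm_le (integrable_tent.mul_const _)
              (Eventually.of_forall fun w => ?_)
            rw [norm_mul, Real.norm_of_nonneg (tent_nonneg w), Real.norm_eq_abs]
            rcases le_or_gt 1 ‖w‖ with hw | hw
            · rw [tent_eq_zero hw]; simp
            · have := abs_rieszK_sub_le l hy hw.le
              have := tent_nonneg w
              gcongr
        _ = _ := by rw [integral_mul_const, integral_tent, one_mul]
    have h5 : (‖y‖ ^ (d + 1))⁻¹ ≤ 2 ^ (d + 1) * ((1 + ‖y‖) ^ (d + 1))⁻¹ := by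
      rw [← div_eq_mul_inv, inv_eq_one_div, div_le_div_iff₀ (by positivity) (by positivity), one_mul,
        ← mul_pow]
      gcongr
      linarith
    have h6 : 0 ≤ (M + 1) * 3 ^ (d + 1) * ((1 + ‖y‖) ^ (d + 1))⁻¹ := by positivity
    calc |tentError l y| ≤ C₁ * (‖y‖ ^ (d + 1))⁻¹ := h4
      _ ≤ C₁ * (2 ^ (d + 1) * ((1 + ‖y‖) ^ (d + 1))⁻¹) := by gcongr
      _ ≤ _ := by nlinarith

theorem integrable_tentError [NeZero d] (l : Fin d) : Integrable (tentError l) := by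
  obtain ⟨C, _, hC⟩ := exists_abs_tentError_le l
  exact ((integrable_inv_one_add_norm_pow d).const_mul C).mono'
    (measurable_tentError l).aestronglyMeasurable (Eventually.of_forall hC)

end Tent

/-! ### Almost everywhere existence of principal values -/

section PrincipalValue

variable {d : ℕ}

theorem rieszK_smul (l : Fin d) {δ : ℝ} (hδ : 0 < δ) (z : Rd d) :
    δ ^ d * rieszK l (δ • z) = rieszK l z := by
  rcases eq_or_ne z 0 with rfl | hz
  · simp [rieszK]
  · have : 0 < ‖z‖ := norm_pos_iff.2 hz
    rw [rieszK, rieszK, norm_smul, Real.norm_of_nonneg hδ.le, mul_pow, pow_succ δ d]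
    simp only [PiLp.smul_apply, smul_eq_mul]
    field_simp

/-- The Gaussian gives s|z| exp(-π s² |z|²) ≤ 1, so |z| s^d exp(-π s² |z|²) ≤ s^d s^{-1}, which is
integrable over the j-th interval. The bound depends on j and is needed only for integrability and
Fubini at fixed j. -/
theorem exists_abs_cutoff_mul_rieszK_le (l : Fin d) (j : ℕ) :
    ∃ M : ℝ, ∀ z : Rd d, |cutoff d j z * rieszK l z| ≤ M := by
  have hc := gaussConst_pos (d := d)
  refine ⟨(gaussConst d)⁻¹ * ∫ s in cutSet j, s ^ d * s⁻¹, fun z => ?_⟩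
  rw [cutoff_mul_rieszK, abs_mul, abs_of_pos (by positivity : 0 < (gaussConst d)⁻¹), abs_mul,
    abs_of_nonneg (integral_cutSet_nonneg j _)]
  refine mul_le_mul_of_nonneg_left ?_ (by positivity)
  refine (mul_le_mul_of_nonneg_right (abs_coord_le l z) (integral_cutSet_nonneg j _)).trans ?_
  rw [← integral_const_mul]
  have hcont : ContinuousOn (fun s : ℝ => s ^ d * s⁻¹) (Set.Icc ((j + 1 : ℝ)⁻¹) (j + 1)) := by
    refine ContinuousOn.mul (by fun_prop) (ContinuousOn.inv₀ continuousOn_id fun s hs => ?_)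
    exact (lt_of_lt_of_le (by positivity) hs.1).ne'
  refine setIntegral_mono_on ?_ ?_ (measurableSet_cutSet j) fun s hs => ?_
  · refine Integrable.const_mul ?_ _
    refine (Continuous.integrableOn_Icc (a := ((j + 1 : ℝ)⁻¹)) (b := j + 1) ?_).mono_set
      Set.Ioc_subset_Icc_self
    unfold gaussProfile; fun_prop
  · exact (hcont.integrableOn_Icc).mono_set Set.Ioc_subset_Icc_self
  · have hs0 := cutSet_pos hs
    rw [gaussProfile, mul_left_comm]
    refine mul_le_mul_of_nonneg_left ?_ (by positivity)
    rw [neg_mul, Real.exp_neg, ← div_eq_mul_inv, div_le_iff₀ (Real.exp_pos _)]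
    have h1 := Real.add_one_le_exp (Real.pi * s ^ 2 * ‖z‖ ^ 2)
    have h2 : s * ‖z‖ ≤ Real.pi * s ^ 2 * ‖z‖ ^ 2 + 1 := by
      nlinarith [sq_nonneg (s * ‖z‖ - 1), Real.pi_gt_three, mul_nonneg hs0.le (norm_nonneg z),
        sq_nonneg (s * ‖z‖)]
    calc ‖z‖ = s⁻¹ * (s * ‖z‖) := by field_simp
      _ ≤ _ := by gcongr; linarith

/-- Regularizations of the Riesz kernel by bounded even cutoffs converge to `tentRiesz`. -/
theorem tendsto_integral_tent_mul [NeZero d] (l : Fin d) {θ : ℕ → Rd d → ℝ}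
    (hm : ∀ j, Measurable (θ j)) (h0 : ∀ j z, 0 ≤ θ j z) (h1 : ∀ j z, θ j z ≤ 1)
    (hneg : ∀ j z, θ j (-z) = θ j z)
    (hlim : ∀ z, z ≠ 0 → Tendsto (fun j => θ j z) atTop (𝓝 1))
    (hb : ∀ j, ∃ M, ∀ z, |θ j z * rieszK l z| ≤ M) {h : Rd d → ℂ} (hh : Integrable h) :
    Tendsto (fun j => ∫ w, (tent d w : ℂ) * ∫ y, ((θ j (y - w) * rieszK l (y - w) : ℝ) : ℂ) * h y)
      atTop (𝓝 (∫ y, (tentRiesz l y : ℂ) * h y)) := by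
  -- With the tent value at y subtracted, these kernels have a majorant independent of j. For a
  -- fixed even cutoff the subtraction changes nothing, because its product with the odd kernel
  -- integrates to zero over the ball.
  set A : ℕ → Rd d → ℝ := fun j y => ∫ u, θ j u * tentRieszIntegrand l y u with hA
  have hbd : ∀ j y u, ‖θ j u * tentRieszIntegrand l y u‖ ≤ tentMajorant y u := by
    intro j y u
    rw [norm_mul, Real.norm_of_nonneg (h0 j u), Real.norm_eq_abs]
    exact (mul_le_of_le_one_left (abs_nonneg _) (h1 j u)).trans (abs_tentRieszIntegrand_le l y u)
  have hIm : ∀ j, Measurable (Function.uncurry fun y u => θ j u * tentRieszIntegrand l y u) :=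
    fun j => ((hm j).comp measurable_snd).mul (measurable_tentRieszIntegrand l)
  have hAm : ∀ j, Measurable (A j) := fun j =>
    (hIm j).stronglyMeasurable.integral_prod_right.measurable
  have hAb : ∀ j y, |A j y| ≤ ∫ u, tentMajorant (0 : Rd d) u := by
    intro j y
    rw [← integral_tentMajorant_eq y, ← Real.norm_eq_abs]
    exact norm_integral_le_of_norm_le (integrable_tentMajorant y) (Eventually.of_forall (hbd j y))
  have hAlim : ∀ y, Tendsto (fun j => A j y) atTop (𝓝 (tentRiesz l y)) := by
    intro y
    refine tendsto_integral_of_dominated_convergence _ (fun j => ?_) (integrable_tentMajorant y)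
      (fun j => Eventually.of_forall (hbd j y)) ?_
    · exact ((hIm j).comp measurable_prodMk_left).aestronglyMeasurable
    · refine Eventually.of_forall fun u => ?_
      rcases eq_or_ne u 0 with rfl | hu
      · simp [tentRieszIntegrand, rieszK]
      · simpa using (hlim u hu).mul_const (tentRieszIntegrand l y u)
  -- odd kernels do not see the subtracted constant
  have hAeq : ∀ j y, ∫ w, tent d w * (θ j (y - w) * rieszK l (y - w)) = A j y := by
    intro j y
    obtain ⟨M, hM⟩ := hb j
    have hkm : Measurable fun u => θ j u * rieszK l u := (hm j).mul (measurable_rieszK l)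
    have hi1 : Integrable fun u => tent d (y - u) * (θ j u * rieszK l u) :=
      (integrable_tent.comp_sub_left y).mul_bdd (c := M) hkm.aestronglyMeasurable
        (Eventually.of_forall hM)
    have hi2 : Integrable fun u => (Metric.ball (0 : Rd d) 3).indicator 1 u *
        (θ j u * rieszK l u) := by
      refine Integrable.mul_bdd (c := M) ?_ hkm.aestronglyMeasurable (Eventually.of_forall hM)
      rw [integrable_indicator_iff Metric.isOpen_ball.measurableSet]
      exact integrableOn_const measure_ball_lt_top.ne
    have hz : ∫ u, (Metric.ball (0 : Rd d) 3).indicator 1 u * (θ j u * rieszK l u) = 0 := by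
      have : ∫ u, (Metric.ball (0 : Rd d) 3).indicator 1 u * (θ j u * rieszK l u)
          = -∫ u, (Metric.ball (0 : Rd d) 3).indicator 1 u * (θ j u * rieszK l u) := by
        conv_lhs => rw [← integral_neg_eq_self]
        rw [← integral_neg]
        congr 1; ext u
        have h1 : (Metric.ball (0 : Rd d) 3).indicator (1 : Rd d → ℝ) (-u)
            = (Metric.ball (0 : Rd d) 3).indicator 1 u := by simp [Set.indicator]
        rw [hneg, rieszK_neg, h1]; ring
      linarith
    calc ∫ w, tent d w * (θ j (y - w) * rieszK l (y - w))
        = ∫ u, tent d (y - u) * (θ j u * rieszK l u) := by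
          rw [← integral_sub_left_eq_self _ volume y]; simp
      _ = (∫ u, tent d (y - u) * (θ j u * rieszK l u))
          - tent d y * ∫ u, (Metric.ball (0 : Rd d) 3).indicator 1 u * (θ j u * rieszK l u) := by
          rw [hz, mul_zero, sub_zero]
      _ = A j y := by
          rw [← integral_const_mul, ← integral_sub hi1 (hi2.const_mul _)]
          simp only [hA, tentRieszIntegrand]
          congr 1; ext u; ring
  have hswap : ∀ j, (∫ w, (tent d w : ℂ) *
      ∫ y, ((θ j (y - w) * rieszK l (y - w) : ℝ) : ℂ) * h y) = ∫ y, (A j y : ℂ) * h y := by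
    intro j
    obtain ⟨M, hM⟩ := hb j
    simp_rw [← integral_const_mul]
    rw [integral_integral_swap]
    · congr 1; ext y
      rw [← hAeq, ← integral_complex_ofReal, ← integral_mul_const]
      congr 1; ext w
      push_cast; ring
    · have hkm : Measurable fun q : Rd d × Rd d =>
          (θ j (q.2 - q.1) * rieszK l (q.2 - q.1) : ℝ) :=
        ((hm j).mul (measurable_rieszK l)).comp (measurable_snd.sub measurable_fst)
      have := ((integrable_tent (d := d)).ofReal (𝕜 := ℂ)).mul_prod hh
      refine (this.mul_bdd (c := M) (Complex.measurable_ofReal.comp hkm).aestronglyMeasurable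
        (Eventually.of_forall fun q => ?_)).congr (Eventually.of_forall fun q => ?_)
      · simp only [Function.comp, Complex.norm_real]
        exact hM _
      · simp only [Function.uncurry, Function.comp]
        push_cast
        simp only [Complex.coe_algebraMap]
        ring
  simp_rw [hswap]
  refine tendsto_integral_of_dominated_convergence
    (fun y => (∫ u, tentMajorant (0 : Rd d) u) * ‖h y‖) (fun j => ?_) (hh.norm.const_mul _)
    (fun j => Eventually.of_forall fun y => ?_) (Eventually.of_forall fun y => ?_)
  · exact (Complex.measurable_ofReal.comp (hAm j)).aestronglyMeasurable.mul hh.aestronglyMeasurable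
  · rw [norm_mul, Complex.norm_real]
    exact mul_le_mul_of_nonneg_right (hAb j y) (norm_nonneg _)
  · exact (Complex.continuous_ofReal.continuousAt.tendsto.comp (hAlim y)).mul_const _

/-- The averaged weak limit is the regularized Riesz transform. -/
theorem integral_tent_mul_weak_limit [NeZero d] (l : Fin d) {g v : Rd d → ℂ} (hg : Integrable g)
    (hv : ∀ φ : Rd d → ℝ, Integrable φ → MemLp φ 2 →
      Tendsto (fun j => ∫ x, (φ x : ℂ) * ∫ y, ((cutoff d j (x - y) * rieszK l (x - y) : ℝ) : ℂ) * g y)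
        atTop (𝓝 (∫ x, (φ x : ℂ) * v x))) (x : Rd d) {δ : ℝ} (hδ : 0 < δ) :
    ∫ u, (tent d u : ℂ) * v (x - δ • u) = ∫ y, (tentRiesz l y : ℂ) * g (x - δ • y) := by
  -- The tent rescaled to width δ about x is the test function. After undoing the dilation the same
  -- sequence has two limits, the weak one and the regularized one, and they must agree.
  set φ : Rd d → ℝ := fun u => tent d (δ⁻¹ • (x - u)) with hφ
  have hφx : ∀ w, φ (x - δ • w) = tent d w := by
    intro w
    simp only [hφ, sub_sub_cancel, smul_smul, inv_mul_cancel₀ hδ.ne', one_smul]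
  have hφc : Continuous φ := continuous_tent.comp (by fun_prop)
  have hφs : HasCompactSupport φ := by
    refine HasCompactSupport.intro (isCompact_closedBall x δ) fun u hu => tent_eq_zero ?_
    have hu : δ < ‖x - u‖ := by simpa [dist_eq_norm, norm_sub_rev] using hu
    rw [norm_smul, norm_inv, Real.norm_of_nonneg hδ.le, ← div_eq_inv_mul, one_le_div hδ]
    exact hu.le
  have h := hv φ (hφc.integrable_of_hasCompactSupport hφs) (hφc.memLp_of_hasCompactSupport hφs)
  have hδd : (0 : ℝ) < δ ^ d := by positivity
  have e1 : ∫ u, (φ u : ℂ) * v u = δ ^ d • ∫ u, (tent d u : ℂ) * v (x - δ • u) := by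
    rw [integral_comp_sub_smul _ x hδ]; simp_rw [hφx]
  have e2 : ∀ j, (∫ u, (φ u : ℂ) * ∫ y, ((cutoff d j (u - y) * rieszK l (u - y) : ℝ) : ℂ) * g y)
      = δ ^ d • ∫ w, (tent d w : ℂ) * ∫ y, ((cutoff d j (δ • (y - w)) * rieszK l (y - w) : ℝ) : ℂ)
        * g (x - δ • y) := by
    intro j
    rw [integral_comp_sub_smul _ x hδ]
    simp_rw [hφx]
    congr 2; ext w
    congr 1
    rw [integral_comp_sub_smul _ x hδ, ← integral_smul]
    congr 1; ext y
    have : x - δ • w - (x - δ • y) = δ • (y - w) := by rw [smul_sub]; abel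
    rw [this, ← rieszK_smul l hδ (y - w), Complex.real_smul]
    push_cast; ring
  simp_rw [e1, e2] at h
  have h2 := tendsto_integral_tent_mul l (θ := fun j z => cutoff d j (δ • z))
    (fun j => (measurable_cutoff j).comp (measurable_const_smul δ)) (fun j z => cutoff_nonneg j _)
    (fun j z => cutoff_le_one j _) (fun j z => by rw [smul_neg, cutoff_neg])
    (fun z hz => tendsto_cutoff (smul_ne_zero hδ.ne' hz)) (fun j => ?_)
    (integrable_comp_sub_smul hg x hδ.ne')
  · have h3 := tendsto_nhds_unique h (h2.const_smul (δ ^ d))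
    exact (smul_right_injective ℂ hδd.ne') h3
  · obtain ⟨M, hM⟩ := exists_abs_cutoff_mul_rieszK_le l j
    refine ⟨δ ^ d * M, fun z => ?_⟩
    rw [← rieszK_smul l hδ z, mul_left_comm, abs_mul, abs_of_pos hδd]
    exact mul_le_mul_of_nonneg_left (hM _) hδd.le

/-- The truncated Riesz transform. -/
def truncRiesz (l : Fin d) (ε : ℝ) (g : Rd d → ℂ) (x : Rd d) : ℂ :=
  ∫ y in {y : Rd d | ε < ‖x - y‖}, (rieszKernel l x y : ℂ) * g y

theorem rieszKernel_eq (l : Fin d) (x y : Rd d) : rieszKernel l x y = rieszK l (x - y) := rfl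

theorem measurableSet_lt_norm_sub (x : Rd d) (ε : ℝ) : MeasurableSet {y : Rd d | ε < ‖x - y‖} :=
  measurableSet_lt measurable_const (by fun_prop)

theorem truncRiesz_eq_dilation (l : Fin d) {δ : ℝ} (hδ : 0 < δ) (g : Rd d → ℂ) (x : Rd d) :
    truncRiesz l δ g x
      = ∫ y, (({y : Rd d | 1 < ‖y‖}.indicator (rieszK l) y : ℝ) : ℂ) * g (x - δ • y) := by
  rw [truncRiesz, ← integral_indicator (measurableSet_lt_norm_sub x δ),
    integral_comp_sub_smul _ x hδ, ← integral_smul]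
  congr 1; ext y
  have h : (x - δ • y ∈ {y : Rd d | δ < ‖x - y‖}) ↔ y ∈ {y : Rd d | 1 < ‖y‖} := by
    simp only [Set.mem_ofPred_eq, sub_sub_cancel, norm_smul, Real.norm_of_nonneg hδ.le]
    exact lt_mul_iff_one_lt_right hδ
  by_cases hy : y ∈ {y : Rd d | 1 < ‖y‖}
  · rw [Set.indicator_of_mem (h.2 hy), Set.indicator_of_mem hy, rieszKernel_eq, sub_sub_cancel,
      ← rieszK_smul l hδ y, Complex.real_smul]
    push_cast; ring
  · rw [Set.indicator_of_notMem (fun h' => hy (h.1 h')), Set.indicator_of_notMem hy]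
    simp

/-- Almost everywhere existence of the principal values defining the Riesz transforms. -/
theorem ae_exists_tendsto_truncRiesz [NeZero d] (l : Fin d) {g : Rd d → ℂ} (hg : Integrable g)
    {M : ℝ} (hM : ∀ x, ‖g x‖ ≤ M) :
    ∀ᵐ x, ∃ c : ℂ, Tendsto (fun ε => truncRiesz l ε g x) (𝓝[>] 0) (𝓝 c) := by
  have hM0 : 0 ≤ M := (norm_nonneg _).trans (hM 0)
  have hg2 : MemLp g 2 := by
    rw [memLp_two_iff_integrable_sq_norm hg.aestronglyMeasurable]
    refine (hg.norm.const_mul M).mono' (hg.aestronglyMeasurable.norm.pow 2)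
      (Eventually.of_forall fun x => ?_)
    rw [Real.norm_of_nonneg (by positivity), sq]
    exact mul_le_mul_of_nonneg_right (hM x) (norm_nonneg _)
  -- The principal value at x turns out to be v(x) whenever x is a Lebesgue point of both `g` and
  -- `v`.
  obtain ⟨v, hv2, hv⟩ := exists_weak_limit l hg hg2
  have hvl : LocallyIntegrable v := hv2.locallyIntegrable (by norm_num)
  filter_upwards [ae_tendsto_integral_norm_sub hg.locallyIntegrable,
    ae_tendsto_integral_norm_sub hvl] with x hgx hvx
  refine ⟨v x, ?_⟩
  have hE := integrable_tentError l
  have hEC : Integrable (fun y => (tentError l y : ℂ)) := hE.ofReal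
  -- the regularized transform tends to `v x`
  have hA : Tendsto (fun δ : ℝ => ∫ u, (tent d u : ℂ) * v (x - δ • u)) (𝓝[>] 0) (𝓝 (v x)) := by
    have hlim := (hvx 1 one_pos).const_mul (tentMass d)⁻¹
    rw [mul_zero] at hlim
    rw [tendsto_iff_norm_sub_tendsto_zero]
    refine squeeze_zero' (Eventually.of_forall fun _ => norm_nonneg _) ?_ hlim
    filter_upwards [self_mem_nhdsWithin] with δ hδ
    have hδ : 0 < δ := hδ
    have hvK : IntegrableOn (fun u => v (x - δ • u)) (Metric.closedBall 0 1) := by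
      have h1 : Integrable ((Metric.closedBall x δ).indicator v) :=
        (hvl.integrableOn_isCompact (isCompact_closedBall _ _)).integrable_indicator
          Metric.isClosed_closedBall.measurableSet
      refine (integrable_comp_sub_smul h1 x hδ.ne').integrableOn.congr_fun (fun u hu => ?_)
        Metric.isClosed_closedBall.measurableSet
      refine Set.indicator_of_mem ?_ _
      have hu : ‖u‖ ≤ 1 := by simpa using hu
      rw [Metric.mem_closedBall, dist_eq_norm, sub_sub_cancel_left, norm_neg, norm_smul,
        Real.norm_of_nonneg hδ.le]
      exact mul_le_of_le_one_right hδ.le hu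
    have hi1 : Integrable (fun u => (tent d u : ℂ) * v (x - δ • u)) := by
      have h1 : IntegrableOn (fun u => (tent d u : ℂ) * v (x - δ • u)) (Metric.closedBall 0 1) :=
        Integrable.bdd_mul (c := (tentMass d)⁻¹) hvK
          (Complex.continuous_ofReal.comp continuous_tent).aestronglyMeasurable
          (Eventually.of_forall fun u => by
            rw [Complex.norm_real, Real.norm_of_nonneg (tent_nonneg u)]; exact tent_le u)
      refine (integrableOn_iff_integrable_of_support_subset fun u hu => ?_).1 h1
      by_contra hu1
      have : 1 < ‖u‖ := by simpa using hu1
      exact hu (by simp [tent_eq_zero this.le])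
    have hi2 : Integrable (fun u => (tent d u : ℂ) * v x) := (integrable_tent.ofReal).mul_const _
    have e : v x = ∫ u, (tent d u : ℂ) * v x := by
      rw [integral_mul_const, integral_complex_ofReal, integral_tent]; simp
    conv_lhs => rw [e]
    rw [← integral_sub hi1 hi2, ← integral_const_mul,
      ← integral_indicator Metric.isClosed_closedBall.measurableSet]
    refine norm_integral_le_of_norm_le ?_ (Eventually.of_forall fun u => ?_)
    · rw [integrable_indicator_iff Metric.isClosed_closedBall.measurableSet]
      refine Integrable.const_mul (Integrable.norm (Integrable.sub ?_ ?_)) _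
      · exact hvK
      · exact integrableOn_const measure_closedBall_lt_top.ne
    · rw [← mul_sub, norm_mul, Complex.norm_real, Real.norm_of_nonneg (tent_nonneg u)]
      by_cases hu : u ∈ Metric.closedBall (0 : Rd d) 1
      · rw [Set.indicator_of_mem hu]
        exact mul_le_mul_of_nonneg_right (tent_le u) (norm_nonneg _)
      · rw [Set.indicator_of_notMem hu, tent_eq_zero, zero_mul]
        have : 1 < ‖u‖ := by simpa using hu
        exact this.le
  -- the error term tends to zero
  have hD : Tendsto (fun δ : ℝ => ∫ y, (tentError l y : ℂ) * g (x - δ • y)) (𝓝[>] 0) (𝓝 0) := by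
    obtain ⟨C, hC0, hC⟩ := exists_abs_tentError_le l
    have hC' : ∀ y, |tentError l y| ≤ C := fun y => (hC y).trans
      (mul_le_of_le_one_right hC0 (inv_le_one_of_one_le₀
        (one_le_pow₀ (by linarith [norm_nonneg y]))))
    rw [Metric.tendsto_nhds]
    intro η hη
    -- Outside a large ball the boundedness of `g` and the integrability of the error kernel
    -- suffice; inside, the Lebesgue point property is used with the kernel bounded by `C`.
    have htail : ∃ R : ℝ, 0 < R ∧ 2 * M * ∫ y in (Metric.closedBall (0 : Rd d) R)ᶜ, |tentError l y| < η / 2 := by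
      have h1 : AECover (volume : Measure (Rd d)) atTop (fun n : ℕ => Metric.closedBall (0 : Rd d) n) :=
        ⟨Eventually.of_forall fun y => by
          obtain ⟨n, hn⟩ := exists_nat_ge ‖y‖
          filter_upwards [eventually_ge_atTop n] with k hk
          have : (n : ℝ) ≤ k := by exact_mod_cast hk
          simp only [Metric.mem_closedBall, dist_zero_right]; linarith,
          fun n => Metric.isClosed_closedBall.measurableSet⟩
      have h2 := (h1.integral_tendsto_of_countably_generated hE.abs).const_sub (∫ y, |tentError l y|)
      rw [sub_self] at h2
      have h3 := h2.const_mul (2 * M)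
      rw [mul_zero] at h3
      obtain ⟨n, hn, hn1⟩ := ((h3.eventually_lt_const (half_pos hη)).and
        (eventually_ge_atTop 1)).exists
      refine ⟨n, by exact_mod_cast hn1, ?_⟩
      rwa [← integral_add_compl (Metric.isClosed_closedBall (x := (0 : Rd d)) (ε := n)).measurableSet
        hE.abs, add_sub_cancel_left] at hn
    obtain ⟨R, hR, htl⟩ := htail
    have h4 := (hgx R hR).const_mul C
    rw [mul_zero] at h4
    filter_upwards [h4.eventually_lt_const (half_pos hη), self_mem_nhdsWithin] with δ hδs hδ
    have hδ : 0 < δ := hδ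
    have hgδ := integrable_comp_sub_smul hg x hδ.ne'
    have hi1 : Integrable (fun y => (tentError l y : ℂ) * g (x - δ • y)) :=
      hEC.mul_bdd (c := M) hgδ.aestronglyMeasurable (Eventually.of_forall fun y => hM _)
    have hi2 : Integrable (fun y => (tentError l y : ℂ) * g x) := hEC.mul_const _
    have e : ∫ y, (tentError l y : ℂ) * g (x - δ • y)
        = ∫ y, (tentError l y : ℂ) * (g (x - δ • y) - g x) := by
      have : ∫ y, (tentError l y : ℂ) * g x = 0 := by
        rw [integral_mul_const, integral_complex_ofReal, integral_tentError]; simp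
      rw [← sub_zero (∫ y, (tentError l y : ℂ) * g (x - δ • y)), ← this, ← integral_sub hi1 hi2]
      simp_rw [mul_sub]
    have hi3 : Integrable (fun y => ‖(tentError l y : ℂ) * (g (x - δ • y) - g x)‖) := by
      refine Integrable.norm ?_
      simp_rw [mul_sub]
      exact hi1.sub hi2
    have hBm := (Metric.isClosed_closedBall (x := (0 : Rd d)) (ε := R)).measurableSet
    rw [dist_zero_right, e]
    refine (norm_integral_le_integral_norm _).trans_lt ?_
    rw [← integral_add_compl hBm hi3]
    have p1 : ∫ y in Metric.closedBall (0 : Rd d) R, ‖(tentError l y : ℂ) * (g (x - δ • y) - g x)‖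
        ≤ C * ∫ u in Metric.closedBall (0 : Rd d) R, ‖g (x - δ • u) - g x‖ := by
      rw [← integral_const_mul]
      refine integral_mono hi3.integrableOn ?_ fun y => ?_
      · refine Integrable.const_mul (Integrable.norm (Integrable.sub hgδ.integrableOn ?_)) _
        exact integrableOn_const measure_closedBall_lt_top.ne
      · simp only [norm_mul, Complex.norm_real, Real.norm_eq_abs]
        exact mul_le_mul_of_nonneg_right (hC' y) (norm_nonneg _)
    have p2 : ∫ y in (Metric.closedBall (0 : Rd d) R)ᶜ,
        ‖(tentError l y : ℂ) * (g (x - δ • y) - g x)‖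
        ≤ 2 * M * ∫ y in (Metric.closedBall (0 : Rd d) R)ᶜ, |tentError l y| := by
      rw [← integral_const_mul]
      refine integral_mono hi3.integrableOn (hE.abs.integrableOn.const_mul _) fun y => ?_
      simp only [norm_mul, Complex.norm_real, Real.norm_eq_abs]
      rw [mul_comm]
      refine mul_le_mul_of_nonneg_right ?_ (abs_nonneg _)
      exact (norm_sub_le _ _).trans (by linarith [hM (x - δ • y), hM x])
    linarith
  -- The truncated transform at scale δ is exactly the tent average of `v` minus the error term.
  have hfin := hA.sub hD
  rw [sub_zero] at hfin
  refine hfin.congr' ?_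
  filter_upwards [self_mem_nhdsWithin] with δ hδ
  have hδ : 0 < δ := hδ
  have hgδ := integrable_comp_sub_smul hg x hδ.ne'
  have hi1 : Integrable (fun y => (tentError l y : ℂ) * g (x - δ • y)) :=
    hEC.mul_bdd (c := M) hgδ.aestronglyMeasurable (Eventually.of_forall fun y => hM _)
  have hi2 : Integrable (fun y => (tentRiesz l y : ℂ) * g (x - δ • y)) := by
    refine hgδ.bdd_mul (c := ∫ u, tentMajorant (0 : Rd d) u)
      (Complex.measurable_ofReal.comp (measurable_tentRiesz l)).aestronglyMeasurable
      (Eventually.of_forall fun y => ?_)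
    simp only [Complex.norm_real]
    exact abs_tentRiesz_le l y
  rw [integral_tent_mul_weak_limit l hg hv x hδ, ← integral_sub hi2 hi1,
    truncRiesz_eq_dilation l hδ]
  congr 1; ext y
  rw [tentError]
  push_cast; ring

/-- The principal values converge to `riesz l g` almost everywhere. -/
theorem ae_tendsto_truncRiesz [NeZero d] (l : Fin d) {g : Rd d → ℂ} (hg : Integrable g)
    {M : ℝ} (hM : ∀ x, ‖g x‖ ≤ M) :
    ∀ᵐ x, Tendsto (fun ε => truncRiesz l ε g x) (𝓝[>] 0) (𝓝 (riesz l g x)) := by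
  filter_upwards [ae_exists_tendsto_truncRiesz l hg hM] with x hx
  exact tendsto_nhds_limUnder hx

end PrincipalValue

/-! ### From Riesz transforms to the fractional integral -/

section Nice

variable {d : ℕ}

/-- Bounded measurable functions vanishing off the set `S`. -/
structure BddOn (S : Set (Rd d)) (φ : Rd d → ℂ) : Prop where
  aesm : AEStronglyMeasurable φ volume
  bdd : ∃ M : ℝ, ∀ x, ‖φ x‖ ≤ M
  supp : ∀ x, x ∉ S → φ x = 0

theorem BddOn.mono {S T : Set (Rd d)} {φ : Rd d → ℂ} (h : BddOn S φ) (hST : S ⊆ T) : BddOn T φ :=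
  ⟨h.aesm, h.bdd, fun x hx => h.supp x fun hS => hx (hST hS)⟩

theorem BddOn.integrable {x₀ : Rd d} {ρ : ℝ} {φ : Rd d → ℂ}
    (h : BddOn (Metric.closedBall x₀ ρ) φ) : Integrable φ := by
  obtain ⟨M, hM⟩ := h.bdd
  have h1 : IntegrableOn φ (Metric.closedBall x₀ ρ) :=
    Measure.integrableOn_of_bounded measure_closedBall_lt_top.ne h.aesm
      (Eventually.of_forall hM)
  refine (integrableOn_iff_integrable_of_support_subset fun x hx => ?_).1 h1
  by_contra hxS
  exact hx (h.supp x hxS)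

theorem BddOn.bdd_nonneg {S : Set (Rd d)} {φ : Rd d → ℂ} (h : BddOn S φ) :
    ∃ M : ℝ, 0 ≤ M ∧ ∀ x, ‖φ x‖ ≤ M := by
  obtain ⟨M, hM⟩ := h.bdd
  exact ⟨M, (norm_nonneg _).trans (hM 0), hM⟩

theorem BddOn.ofReal_mul {S : Set (Rd d)} {φ : Rd d → ℂ} (h : BddOn S φ) {b : Rd d → ℝ}
    (hb : Measurable b) {β : ℝ} (hβ : ∀ x ∈ S, |b x| ≤ β) : BddOn S (fun x => (b x : ℂ) * φ x) := by
  obtain ⟨M, hM0, hM⟩ := h.bdd_nonneg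
  -- The term 0 * M keeps the bound nonnegative when S is empty, where nothing forces β ≥ 0.
  refine ⟨(Complex.measurable_ofReal.comp hb).aestronglyMeasurable.mul h.aesm, ⟨β ⊔ 0 * M ⊔ (β * M), fun x => ?_⟩,
    fun x hx => by rw [h.supp x hx, mul_zero]⟩
  by_cases hx : x ∈ S
  · rw [norm_mul, Complex.norm_real]
    exact le_max_of_le_right (mul_le_mul (hβ x hx) (hM x) (norm_nonneg _)
      ((abs_nonneg _).trans (hβ x hx)))
  · rw [h.supp x hx, mul_zero, norm_zero]
    exact le_max_of_le_left (le_max_of_le_right (by simp))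

theorem measurable_indicator_prod_lt (ε : ℝ) :
    MeasurableSet {q : Rd d × Rd d | ε < ‖q.1 - q.2‖} :=
  measurableSet_lt measurable_const (by fun_prop)

theorem aestronglyMeasurable_truncRiesz (l : Fin d) (ε : ℝ) {g : Rd d → ℂ}
    (hg : AEStronglyMeasurable g volume) : AEStronglyMeasurable (truncRiesz l ε g) volume := by
  have h : AEStronglyMeasurable (fun q : Rd d × Rd d =>
      {q : Rd d × Rd d | ε < ‖q.1 - q.2‖}.indicator
        (fun q => (rieszK l (q.1 - q.2) : ℂ) * g q.2) q) (volume.prod volume) := by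
    refine AEStronglyMeasurable.indicator ?_ (measurable_indicator_prod_lt ε)
    exact ((Complex.measurable_ofReal.comp ((measurable_rieszK l).comp
      (measurable_fst.sub measurable_snd))).aestronglyMeasurable).mul hg.comp_snd
  refine h.integral_prod_right'.congr (Eventually.of_forall fun x => ?_)
  simp only [truncRiesz]
  rw [← integral_indicator (measurableSet_lt_norm_sub x ε)]
  congr 1

theorem aestronglyMeasurable_riesz [NeZero d] (l : Fin d) {g : Rd d → ℂ} {x₀ : Rd d} {ρ : ℝ}
    (hg : BddOn (Metric.closedBall x₀ ρ) g) : AEStronglyMeasurable (riesz l g) volume := by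
  obtain ⟨M, hM⟩ := hg.bdd
  refine aestronglyMeasurable_of_tendsto_ae (𝓝[>] (0 : ℝ)) (f := fun ε => truncRiesz l ε g)
    (fun ε => aestronglyMeasurable_truncRiesz l ε hg.aesm) ?_
  exact ae_tendsto_truncRiesz l hg.integrable hM

/-- The kernel `|z|^{1-d}`. -/
def fracKernel (d : ℕ) (z : Rd d) : ℝ := ‖z‖ * (‖z‖ ^ d)⁻¹

/-- The squares of the coordinates add up to |z|². At z = 0 both sides are zero by the convention
for division by zero, also when d = 1. -/
theorem sum_mul_rieszK (z : Rd d) : ∑ l, z l * rieszK l z = fracKernel d z := by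
  rcases eq_or_ne z 0 with rfl | hz
  · simp [fracKernel]
  · have h0 : 0 < ‖z‖ := norm_pos_iff.2 hz
    have : ∑ l, z l * rieszK l z = (∑ l, ‖z l‖ ^ 2) / ‖z‖ ^ (d + 1) := by
      rw [Finset.sum_div]
      refine Finset.sum_congr rfl fun l _ => ?_
      rw [rieszK, Real.norm_eq_abs, sq_abs]; ring
    rw [this, ← EuclideanSpace.norm_sq_eq, fracKernel]
    field_simp
    ring

/-- The origin must be excluded, since `fracKernel d 0` is 0 in every dimension. This is where the
vanishing of the tensor on the diagonal will be used. -/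
theorem pow_mul_fracKernel [NeZero d] {z : Rd d} (hz : z ≠ 0) :
    ‖z‖ ^ (d - 1) * fracKernel d z = 1 := by
  have h0 : 0 < ‖z‖ := norm_pos_iff.2 hz
  obtain ⟨k, rfl⟩ := Nat.exists_eq_succ_of_ne_zero (NeZero.ne d)
  simp only [Nat.succ_eq_add_one, Nat.add_sub_cancel, fracKernel]
  field_simp
  try ring

theorem integrable_fracKernel_sub_mul [NeZero d] {φ : Rd d → ℂ} {x₀ : Rd d} {ρ : ℝ}
    (hφ : BddOn (Metric.closedBall x₀ ρ) φ) (x : Rd d) :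
    Integrable (fun y => (fracKernel d (x - y) : ℂ) * φ y) := by
  obtain ⟨M, hM⟩ := hφ.bdd
  set R := ‖x - x₀‖ + |ρ| + 1 with hR
  have h1 : Integrable ((Metric.ball (0 : Rd d) R).indicator (fracKernel d)) :=
    (integrableOn_norm_mul_inv_pow R).integrable_indicator Metric.isOpen_ball.measurableSet
  have h2 := ((h1.comp_sub_left x).ofReal (𝕜 := ℂ)).mul_bdd (c := M) hφ.aesm
    (Eventually.of_forall hM)
  refine h2.congr (Eventually.of_forall fun y => ?_)
  by_cases hy : y ∈ Metric.closedBall x₀ ρ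
  · simp only
    rw [Set.indicator_of_mem]
    · rfl
    · rw [Metric.mem_ball, dist_zero_right]
      rw [Metric.mem_closedBall, dist_eq_norm, norm_sub_rev] at hy
      calc ‖x - y‖ = ‖(x - x₀) + (x₀ - y)‖ := by congr 1; abel
        _ ≤ ‖x - x₀‖ + ‖x₀ - y‖ := norm_add_le _ _
        _ < R := by rw [hR]; linarith [le_abs_self ρ]
  · simp [hφ.supp y hy]

/-- The fractional integral of order one. -/
def fracInt (φ : Rd d → ℂ) (x : Rd d) : ℂ := ∫ y, (fracKernel d (x - y) : ℂ) * φ y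

theorem integrable_truncated [NeZero d] (l : Fin d) {φ : Rd d → ℂ} (hφ : Integrable φ) {ε : ℝ}
    (hε : 0 < ε) (x : Rd d) :
    IntegrableOn (fun y => (rieszKernel l x y : ℂ) * φ y) {y : Rd d | ε < ‖x - y‖} := by
  refine Integrable.bdd_mul (c := (ε ^ d)⁻¹) hφ.integrableOn ?_ ?_
  · exact (Complex.measurable_ofReal.comp ((measurable_rieszK l).comp
      (measurable_const.sub measurable_id))).aestronglyMeasurable
  · filter_upwards [ae_restrict_mem (measurableSet_lt_norm_sub x ε)] with y hy
    have hy : ε < ‖x - y‖ := hy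
    rw [Complex.norm_real, rieszKernel_eq]
    refine (abs_rieszK_le l _).trans ?_
    gcongr

/-- Multiplying the commutators of the Riesz transforms with the coordinates gives the fractional
integral. -/
theorem ae_sum_coord_mul_riesz_sub [NeZero d] {φ : Rd d → ℂ} {x₀ : Rd d} {ρ : ℝ}
    (hφ : BddOn (Metric.closedBall x₀ ρ) φ) (a : Rd d) (r : ℝ) :
    ∀ᵐ x, ∑ l, (((r⁻¹ * (x l - a l) : ℝ) : ℂ) * riesz l φ x
      - riesz l (fun y => ((r⁻¹ * (y l - a l) : ℝ) : ℂ) * φ y) x) = (r⁻¹ : ℂ) * fracInt φ x := by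
  have hu : ∀ l : Fin d, BddOn (Metric.closedBall x₀ ρ)
      (fun y => ((r⁻¹ * (y l - a l) : ℝ) : ℂ) * φ y) := by
    intro l
    refine hφ.ofReal_mul (b := fun y => r⁻¹ * (y l - a l)) (β := |r⁻¹| * (ρ + ‖x₀ - a‖))
      (by fun_prop) fun y hy => ?_
    rw [abs_mul]
    gcongr
    have h1 := abs_coord_le l (y - a)
    rw [Metric.mem_closedBall, dist_eq_norm] at hy
    calc |y l - a l| ≤ ‖y - a‖ := h1
      _ = ‖(y - x₀) + (x₀ - a)‖ := by congr 1; abel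
      _ ≤ ‖y - x₀‖ + ‖x₀ - a‖ := norm_add_le _ _
      _ ≤ _ := by linarith
  obtain ⟨M, hM⟩ := hφ.bdd
  have hall : ∀ᵐ x, ∀ l : Fin d, Tendsto (fun ε => truncRiesz l ε φ x) (𝓝[>] 0) (𝓝 (riesz l φ x)) ∧
      Tendsto (fun ε => truncRiesz l ε (fun y => ((r⁻¹ * (y l - a l) : ℝ) : ℂ) * φ y) x) (𝓝[>] 0)
        (𝓝 (riesz l (fun y => ((r⁻¹ * (y l - a l) : ℝ) : ℂ) * φ y) x)) := by
    rw [ae_all_iff]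
    intro l
    obtain ⟨M', hM'⟩ := (hu l).bdd
    filter_upwards [ae_tendsto_truncRiesz l hφ.integrable hM,
      ae_tendsto_truncRiesz l (hu l).integrable hM'] with x h1 h2 using ⟨h1, h2⟩
  filter_upwards [hall] with x hx
  have hL := tendsto_finsetSum Finset.univ fun l _ =>
    ((hx l).1.const_mul (((r⁻¹ * (x l - a l) : ℝ) : ℂ))).sub (hx l).2
  have hfi := integrable_fracKernel_sub_mul hφ x
  -- At equal truncation level ε the combination of Riesz transforms has the truncated kernel
  -- |x-y|^{1-d}. This kernel is locally integrable, so dominated convergence replaces the principal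
  -- value.
  have hR : Tendsto (fun ε : ℝ => ∫ y, {y : Rd d | ε < ‖x - y‖}.indicator
      (fun y => (fracKernel d (x - y) : ℂ) * φ y) y) (𝓝[>] 0) (𝓝 (fracInt φ x)) := by
    refine tendsto_integral_filter_of_dominated_convergence _
      (Eventually.of_forall fun ε => hfi.aestronglyMeasurable.indicator
        (measurableSet_lt_norm_sub x ε)) (Eventually.of_forall fun ε =>
        Eventually.of_forall fun y => norm_indicator_le_norm_self _ _) hfi.norm
      (Eventually.of_forall fun y => ?_)
    rcases eq_or_ne x y with rfl | hxy
    · have : ∀ ε : ℝ, {y : Rd d | ε < ‖x - y‖}.indicator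
          (fun y => (fracKernel d (x - y) : ℂ) * φ y) x = (fracKernel d (x - x) : ℂ) * φ x := by
        intro ε
        by_cases h : x ∈ {y : Rd d | ε < ‖x - y‖}
        · rw [Set.indicator_of_mem h]
        · rw [Set.indicator_of_notMem h]; simp [fracKernel]
      simp_rw [this]
      exact tendsto_const_nhds
    · refine tendsto_const_nhds.congr' ?_
      have h0 : 0 < ‖x - y‖ := norm_pos_iff.2 (sub_ne_zero.2 hxy)
      filter_upwards [nhdsWithin_le_nhds (Iio_mem_nhds h0)] with ε hε
      exact (Set.indicator_of_mem (s := {y : Rd d | ε < ‖x - y‖})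
        (show y ∈ {y : Rd d | ε < ‖x - y‖} from hε)
        (fun y => (fracKernel d (x - y) : ℂ) * φ y)).symm
  refine tendsto_nhds_unique hL ((hR.const_mul (r⁻¹ : ℂ)).congr' ?_)
  filter_upwards [self_mem_nhdsWithin] with ε hε
  have hε : 0 < ε := hε
  rw [integral_indicator (measurableSet_lt_norm_sub x ε), ← integral_const_mul]
  simp_rw [truncRiesz]
  have e1 : ∀ l : Fin d, (((r⁻¹ * (x l - a l) : ℝ) : ℂ) *
      ∫ y in {y : Rd d | ε < ‖x - y‖}, (rieszKernel l x y : ℂ) * φ y)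
      - ∫ y in {y : Rd d | ε < ‖x - y‖}, (rieszKernel l x y : ℂ) *
        (((r⁻¹ * (y l - a l) : ℝ) : ℂ) * φ y)
      = ∫ y in {y : Rd d | ε < ‖x - y‖}, ((r⁻¹ * ((x - y) l * rieszK l (x - y)) : ℝ) : ℂ) * φ y := by
    intro l
    rw [← integral_const_mul, ← integral_sub ((integrable_truncated l hφ.integrable hε x).const_mul _)
      (integrable_truncated l (hu l).integrable hε x)]
    congr 1; ext y
    rw [rieszKernel_eq, PiLp.sub_apply]
    push_cast; ring
  simp_rw [e1]
  rw [← integral_finsetSum]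
  · congr 1; ext y
    rw [← sum_mul_rieszK, ← Finset.sum_mul]
    push_cast
    rw [← Finset.mul_sum]; ring
  · intro l _
    have h3 := ((integrable_truncated l hφ.integrable hε x).const_mul
      (((r⁻¹ * (x l - a l) : ℝ) : ℂ))).sub (integrable_truncated l (hu l).integrable hε x)
    refine h3.congr (Eventually.of_forall fun y => ?_)
    simp only [Pi.sub_apply, rieszKernel_eq, PiLp.sub_apply]
    push_cast; ring

theorem integrable_prod_fracKernel [NeZero d] {ψ φ : Rd d → ℂ} {x₀ : Rd d} {ρ : ℝ}
    (hψ : BddOn (Metric.closedBall x₀ ρ) ψ) (hφ : BddOn (Metric.closedBall x₀ ρ) φ) :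
    Integrable (fun q : Rd d × Rd d => (fracKernel d (q.1 - q.2) : ℂ) * (ψ q.1 * φ q.2)) := by
  obtain ⟨M, hM⟩ := hψ.bdd
  have h1 : Integrable ((Metric.ball (0 : Rd d) (2 * |ρ| + 1)).indicator (fracKernel d)) :=
    (integrableOn_norm_mul_inv_pow _).integrable_indicator Metric.isOpen_ball.measurableSet
  have h2 := (hφ.integrable.convolution_integrand (ContinuousLinearMap.mul ℂ ℂ)
    (h1.ofReal (𝕜 := ℂ)))
  refine (h2.bdd_mul (c := M) hψ.aesm.comp_fst (Eventually.of_forall fun q => hM _)).congr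
    (Eventually.of_forall fun q => ?_)
  simp only [ContinuousLinearMap.mul_apply']
  by_cases h : q.1 ∈ Metric.closedBall x₀ ρ ∧ q.2 ∈ Metric.closedBall x₀ ρ
  · rw [Set.indicator_of_mem]
    · simp only [Complex.coe_algebraMap]; ring
    · rw [Metric.mem_ball, dist_zero_right, ← dist_eq_norm]
      have := dist_triangle_right q.1 q.2 x₀
      have h1 := Metric.mem_closedBall.1 h.1
      have h2 := Metric.mem_closedBall.1 h.2
      linarith [le_abs_self ρ]
  · rcases not_and_or.1 h with h | h
    · rw [hψ.supp _ h]; ring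
    · rw [hφ.supp _ h]; ring

theorem integral_mul_fracInt [NeZero d] {ψ φ : Rd d → ℂ} {x₀ : Rd d} {ρ : ℝ}
    (hψ : BddOn (Metric.closedBall x₀ ρ) ψ) (hφ : BddOn (Metric.closedBall x₀ ρ) φ) :
    Integrable (fun x => ψ x * fracInt φ x) ∧ ∫ x, ψ x * fracInt φ x
      = ∫ q : Rd d × Rd d, (fracKernel d (q.1 - q.2) : ℂ) * (ψ q.1 * φ q.2) := by
  have h := integrable_prod_fracKernel hψ hφ
  have e : ∀ x, ψ x * fracInt φ x = ∫ y, (fracKernel d (x - y) : ℂ) * (ψ x * φ y) := by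
    intro x
    rw [fracInt, ← integral_const_mul]
    congr 1; ext y; ring
  simp_rw [e]
  exact ⟨h.integral_prod_left, (integral_prod _ h).symm⟩

end Nice

/-! ### Removing the Riesz kernel from a tensor on a cube -/

section Bilinear

variable {d : ℕ}

theorem measurableSet_cube (a : Rd d) (r : ℝ) : MeasurableSet (cube a r) := by
  have : cube a r = ⋂ i, {x : Rd d | a i ≤ x i} ∩ {x : Rd d | x i ≤ a i + r} := by
    ext x; simp [cube]
  rw [this]
  exact MeasurableSet.iInter fun i => (measurableSet_le measurable_const (by fun_prop)).inter
    (measurableSet_le (by fun_prop) measurable_const)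

theorem isCompact_cube (a : Rd d) (r : ℝ) : IsCompact (cube a r) := by
  have h : cube a r = (EuclideanSpace.equiv (Fin d) ℝ) ⁻¹'
      (Set.pi Set.univ fun i => Set.Icc (a i) (a i + r)) := by
    ext x
    simp only [cube, Set.mem_preimage, Set.mem_pi, Set.mem_univ, true_implies, Set.mem_Icc]
    rfl
  rw [h]
  exact (EuclideanSpace.equiv (Fin d) ℝ).toHomeomorph.isClosedEmbedding.isCompact_preimage
    (isCompact_univ_pi fun i => isCompact_Icc)

theorem cube_subset_closedBall (a : Rd d) {r : ℝ} (hr : 0 ≤ r) :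
    cube a r ⊆ Metric.closedBall a (√d * r) := by
  intro x hx
  rw [Metric.mem_closedBall, dist_eq_norm, EuclideanSpace.norm_eq]
  calc √(∑ i, ‖(x - a) i‖ ^ 2) ≤ √(∑ _i : Fin d, r ^ 2) := by
        refine Real.sqrt_le_sqrt (Finset.sum_le_sum fun i _ => ?_)
        have := hx i
        rw [PiLp.sub_apply, Real.norm_eq_abs, sq_abs]
        nlinarith
    _ = √d * r := by
        rw [Finset.sum_const, Finset.card_univ, Fintype.card_fin, nsmul_eq_mul, Real.sqrt_mul
          (Nat.cast_nonneg d), Real.sqrt_sq hr]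

theorem BddOn.sum {S : Set (Rd d)} {ι : Type*} {s : Finset ι} {φ : ι → Rd d → ℂ}
    (h : ∀ i ∈ s, BddOn S (φ i)) : BddOn S (fun x => ∑ i ∈ s, φ i x) := by
  choose! M hM using fun i hi => (h i hi).bdd
  refine ⟨Finset.aestronglyMeasurable_fun_sum s fun i hi => (h i hi).aesm,
    ⟨∑ i ∈ s, M i, fun x => ?_⟩, fun x hx => Finset.sum_eq_zero fun i hi => (h i hi).supp x hx⟩
  exact (norm_sum_le _ _).trans (Finset.sum_le_sum fun i hi => hM i hi x)

variable {ι : Type} [Fintype ι]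

theorem aestronglyMeasurable_sum_mul_riesz [NeZero d] {x₀ : Rd d} {ρ : ℝ} {ψ φ : ι → Rd d → ℂ}
    (hψ : ∀ i, AEStronglyMeasurable (ψ i) volume)
    (hφ : ∀ i, BddOn (Metric.closedBall x₀ ρ) (φ i)) {b : Rd d → ℝ} (hb : Measurable b)
    (hb1 : ∀ x, |b x| ≤ 1) (l : Fin d) :
    AEStronglyMeasurable (fun x => ∑ i, ψ i x * riesz l (fun y => (b y : ℂ) * φ i y) x) volume :=
  Finset.aestronglyMeasurable_fun_sum _ fun i _ => (hψ i).mul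
    (aestronglyMeasurable_riesz l ((hφ i).ofReal_mul hb (β := 1) fun x _ => hb1 x))

/-- Bounds for the commutators of the Riesz transforms give a bound for the kernel of the
fractional integral. -/
theorem norm_integral_fracKernel_le [NeZero d] {a : Rd d} {r : ℝ} (hr : 0 < r)
    {ψ φ : ι → Rd d → ℂ} {N : ℝ} (hN : 0 ≤ N) (hψ : ∀ i, BddOn (cube a r) (ψ i))
    (hφ : ∀ i, BddOn (cube a r) (φ i))
    (h : ∀ (l : Fin d) (b : Rd d → ℝ), Measurable b → (∀ x, |b x| ≤ 1) →
      ∫⁻ x, ‖∑ i, ψ i x * riesz l (fun y => (b y : ℂ) * φ i y) x‖ₑ ≤ ENNReal.ofReal N)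
    {α β : Rd d → ℝ} (hα : Measurable α) (hβ : Measurable β) (hα1 : ∀ x, |α x| ≤ 1)
    (hβ1 : ∀ x, |β x| ≤ 1) :
    ‖∫ q : Rd d × Rd d, ((α q.1 * β q.2 : ℝ) : ℂ) *
      ((r⁻¹ : ℂ) * ((fracKernel d (q.1 - q.2) : ℂ) * ∑ i, ψ i q.1 * φ i q.2))‖ ≤ 2 * d * N := by
  have hQ := cube_subset_closedBall a hr.le
  have hψ' : ∀ i, BddOn (cube a r) (fun x => (α x : ℂ) * ψ i x) := fun i =>
    (hψ i).ofReal_mul hα (β := 1) fun x _ => hα1 x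
  have hφ' : ∀ i, BddOn (cube a r) (fun x => (β x : ℂ) * φ i x) := fun i =>
    (hφ i).ofReal_mul hβ (β := 1) fun x _ => hβ1 x
  have hJ := fun i => integral_mul_fracInt ((hψ' i).mono hQ) ((hφ' i).mono hQ)
  have hI := fun i => integrable_prod_fracKernel ((hψ' i).mono hQ) ((hφ' i).mono hQ)
  -- The rescaled coordinates take values in [0,1] on the cube. Cutting them off outside is harmless
  -- because all ψ and φ vanish there.
  set u : Fin d → Rd d → ℝ := fun l => (cube a r).indicator fun x => r⁻¹ * (x l - a l) with hu
  have hum : ∀ l, Measurable (u l) := fun l =>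
    Measurable.indicator (by fun_prop) (measurableSet_cube a r)
  have hu1 : ∀ l x, |u l x| ≤ 1 := by
    intro l x
    by_cases hx : x ∈ cube a r
    · simp only [hu, Set.indicator_of_mem hx]
      have := hx l
      rw [abs_of_nonneg (mul_nonneg (by positivity) (by linarith)), inv_mul_le_iff₀ hr]
      linarith
    · simp [hu, hx]
  set P : Fin d → (Rd d → ℝ) → Rd d → ℂ := fun l b x =>
    ∑ i, ψ i x * riesz l (fun y => (b y : ℂ) * φ i y) x with hP
  have hPm : ∀ l {b : Rd d → ℝ}, Measurable b → (∀ x, |b x| ≤ 1) →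
      AEStronglyMeasurable (P l b) volume := fun l b hb hb1 =>
    aestronglyMeasurable_sum_mul_riesz (fun i => (hψ i).aesm) (fun i => (hφ i).mono hQ) hb hb1 l
  have hb' : ∀ l, Measurable fun x => u l x * β x := fun l => (hum l).mul hβ
  have hb'1 : ∀ l x, |u l x * β x| ≤ 1 := fun l x => by
    rw [abs_mul]; exact mul_le_one₀ (hu1 l x) (abs_nonneg _) (hβ1 x)
  have e1 : ∫ q : Rd d × Rd d, ((α q.1 * β q.2 : ℝ) : ℂ) *
      ((r⁻¹ : ℂ) * ((fracKernel d (q.1 - q.2) : ℂ) * ∑ i, ψ i q.1 * φ i q.2))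
      = ∫ x, ∑ i, ((α x : ℂ) * ψ i x) * ((r⁻¹ : ℂ) * fracInt (fun y => (β y : ℂ) * φ i y) x) := by
    have e2 : ∀ q : Rd d × Rd d, ((α q.1 * β q.2 : ℝ) : ℂ) *
      ((r⁻¹ : ℂ) * ((fracKernel d (q.1 - q.2) : ℂ) * ∑ i, ψ i q.1 * φ i q.2))
      = ∑ i, (r⁻¹ : ℂ) * ((fracKernel d (q.1 - q.2) : ℂ) *
        (((α q.1 : ℂ) * ψ i q.1) * ((β q.2 : ℂ) * φ i q.2))) := by
      intro q
      rw [Finset.mul_sum, Finset.mul_sum, Finset.mul_sum]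
      refine Finset.sum_congr rfl fun i _ => ?_
      push_cast; ring
    simp_rw [e2]
    rw [integral_finsetSum _ fun i _ => (hI i).const_mul _]
    have e3 : ∀ x, ∑ i, ((α x : ℂ) * ψ i x) * ((r⁻¹ : ℂ) * fracInt (fun y => (β y : ℂ) * φ i y) x)
        = ∑ i, (r⁻¹ : ℂ) * (((α x : ℂ) * ψ i x) * fracInt (fun y => (β y : ℂ) * φ i y) x) :=
      fun x => Finset.sum_congr rfl fun i _ => by ring
    simp_rw [e3]
    rw [integral_finsetSum _ fun i _ => (hJ i).1.const_mul _]
    refine Finset.sum_congr rfl fun i _ => ?_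
    rw [integral_const_mul, integral_const_mul, (hJ i).2]
  -- Multiplication of the kernel by (x_l - y_l)/r acts once through the output and once through the
  -- input. These two terms, for each of the d transforms, account for the factor 2d.
  have hae : ∀ᵐ x, ∑ i, ((α x : ℂ) * ψ i x) *
      ((r⁻¹ : ℂ) * fracInt (fun y => (β y : ℂ) * φ i y) x)
      = ∑ l, (((α x * u l x : ℝ) : ℂ) * P l β x - (α x : ℂ) * P l (fun y => u l y * β y) x) := by
    have := ae_all_iff.2 fun i => ae_sum_coord_mul_riesz_sub ((hφ' i).mono hQ) a r
    filter_upwards [this] with x hx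
    by_cases hxQ : x ∈ cube a r
    · have hux : ∀ l, u l x = r⁻¹ * (x l - a l) := fun l => by
        simp only [hu, Set.indicator_of_mem hxQ]
      simp_rw [← hx, hux, hP, Finset.mul_sum, ← Finset.sum_sub_distrib]
      rw [Finset.sum_comm]
      refine Finset.sum_congr rfl fun l _ => Finset.sum_congr rfl fun i _ => ?_
      have : (fun y => ((r⁻¹ * (y l - a l) : ℝ) : ℂ) * ((β y : ℂ) * φ i y))
          = fun y => ((u l y * β y : ℝ) : ℂ) * φ i y := by
        ext y
        by_cases hy : y ∈ cube a r
        · simp only [hu, Set.indicator_of_mem hy]; push_cast; ring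
        · rw [(hφ i).supp y hy]; ring
      rw [this]
      push_cast; ring
    · simp [hP, (hψ _).supp x hxQ]
  rw [e1, integral_congr_ae hae]
  have hle : ‖∫ x, ∑ l, (((α x * u l x : ℝ) : ℂ) * P l β x
      - (α x : ℂ) * P l (fun y => u l y * β y) x)‖ₑ ≤ ENNReal.ofReal (2 * d * N) := by
    refine (enorm_integral_le_lintegral_enorm _).trans ?_
    calc ∫⁻ x, ‖∑ l, (((α x * u l x : ℝ) : ℂ) * P l β x
          - (α x : ℂ) * P l (fun y => u l y * β y) x)‖ₑ
        ≤ ∫⁻ x, ∑ l, (‖P l β x‖ₑ + ‖P l (fun y => u l y * β y) x‖ₑ) := by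
          refine lintegral_mono fun x => (enorm_sum_le _ _).trans (Finset.sum_le_sum fun l _ =>
            (enorm_sub_le).trans (add_le_add ?_ ?_))
          · rw [enorm_mul]
            refine mul_le_of_le_one_left' ?_
            rw [← ofReal_norm, Complex.norm_real, Real.norm_eq_abs, abs_mul]
            exact ENNReal.ofReal_le_one.2 (mul_le_one₀ (hα1 x) (abs_nonneg _) (hu1 l x))
          · rw [enorm_mul]
            refine mul_le_of_le_one_left' ?_
            rw [← ofReal_norm, Complex.norm_real, Real.norm_eq_abs]
            exact ENNReal.ofReal_le_one.2 (hα1 x)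
      _ = ∑ l, ((∫⁻ x, ‖P l β x‖ₑ) + ∫⁻ x, ‖P l (fun y => u l y * β y) x‖ₑ) := by
          rw [lintegral_finsetSum' (f := fun l x => ‖P l β x‖ₑ + ‖P l (fun y => u l y * β y) x‖ₑ) _
            fun l _ => ((hPm l hβ hβ1).enorm.add (hPm l (hb' l) (hb'1 l)).enorm)]
          refine Finset.sum_congr rfl fun l _ => ?_
          rw [lintegral_add_left' (hPm l hβ hβ1).enorm]
      _ ≤ ∑ _l : Fin d, (ENNReal.ofReal N + ENNReal.ofReal N) :=
          Finset.sum_le_sum fun l _ => add_le_add (h l β hβ hβ1) (h l _ (hb' l) (hb'1 l))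
      _ = ENNReal.ofReal (2 * d * N) := by
          rw [Finset.sum_const, Finset.card_univ, Fintype.card_fin, nsmul_eq_mul,
            ← ENNReal.ofReal_add hN hN, ← ENNReal.ofReal_natCast, ← ENNReal.ofReal_mul
            (Nat.cast_nonneg d)]
          congr 1; ring
  rw [← ofReal_norm] at hle
  exact (ENNReal.ofReal_le_ofReal_iff (by positivity)).1 hle

theorem abs_indicator_inv_mul_le_one {S : Set (Rd d)} {a : Rd d → ℝ} {α : ℝ} (hα0 : 0 ≤ α)
    (hα : ∀ x ∈ S, |a x| ≤ α) (x : Rd d) : |S.indicator (fun x => α⁻¹ * a x) x| ≤ 1 := by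
  by_cases hx : x ∈ S
  · rw [Set.indicator_of_mem hx, abs_mul, abs_inv, abs_of_nonneg hα0]
    exact inv_mul_le_one_of_le₀ (hα x hx) hα0
  · simp [hx]

/-- By homogeneity, multipliers bounded by one are enough. If a bound α or β is zero, the
corresponding function vanishes on S and the normalization with 0⁻¹ = 0 is still correct. -/
theorem schurBound_of_unit {S : Set (Rd d)} (hS : MeasurableSet S) {G : Rd d × Rd d → ℂ} {A : ℝ}
    (hne : S.Nonempty)
    (hG : ∀ q, ¬(q.1 ∈ S ∧ q.2 ∈ S) → G q = 0)
    (h : ∀ α β : Rd d → ℝ, Measurable α → Measurable β → (∀ x, |α x| ≤ 1) → (∀ x, |β x| ≤ 1) →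
      ‖∫ q : Rd d × Rd d, ((α q.1 * β q.2 : ℝ) : ℂ) * G q‖ ≤ A) : SchurBound S G A := by
  obtain ⟨x₁, hx₁⟩ := hne
  intro a b α β ha hb hα hβ
  have hα0 : 0 ≤ α := (abs_nonneg _).trans (hα x₁ hx₁)
  have hβ0 : 0 ≤ β := (abs_nonneg _).trans (hβ x₁ hx₁)
  have h1 := h (S.indicator fun x => α⁻¹ * a x) (S.indicator fun x => β⁻¹ * b x)
    ((ha.const_mul _).indicator hS) ((hb.const_mul _).indicator hS)
    (abs_indicator_inv_mul_le_one hα0 hα) (abs_indicator_inv_mul_le_one hβ0 hβ)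
  have e : ∀ q : Rd d × Rd d, ((a q.1 * b q.2 : ℝ) : ℂ) * G q = ((α * β : ℝ) : ℂ) *
      (((S.indicator (fun x => α⁻¹ * a x) q.1 * S.indicator (fun x => β⁻¹ * b x) q.2 : ℝ) : ℂ)
        * G q) := by
    intro q
    by_cases hq : q.1 ∈ S ∧ q.2 ∈ S
    · rw [Set.indicator_of_mem hq.1, Set.indicator_of_mem hq.2, ← mul_assoc, ← Complex.ofReal_mul]
      congr 2
      have e1 : α * (α⁻¹ * a q.1) = a q.1 := by
        rcases hα0.eq_or_lt with h0 | h0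
        · have := hα _ hq.1
          rw [← h0] at this ⊢
          rw [abs_nonpos_iff.1 this]; simp
        · field_simp
      have e2 : β * (β⁻¹ * b q.2) = b q.2 := by
        rcases hβ0.eq_or_lt with h0 | h0
        · have := hβ _ hq.2
          rw [← h0] at this ⊢
          rw [abs_nonpos_iff.1 this]; simp
        · field_simp
      linear_combination (-(b q.2)) * e1 - α * (α⁻¹ * a q.1) * e2
    · rw [hG q hq]; simp
  simp_rw [e]
  rw [integral_const_mul, norm_mul, Complex.norm_real, Real.norm_of_nonneg (by positivity)]
  gcongr

/-- Bounds for the commutators of the Riesz transforms, tested on bounded functions on a cube,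
control the integral of the underlying tensor over the cube. -/
theorem exists_norm_integral_tensor_le (d : ℕ) [NeZero d] : ∃ C : ℝ, 0 ≤ C ∧
    ∀ (a : Rd d) (r : ℝ), 0 < r → ∀ (ι : Type) [Fintype ι] (ψ φ : ι → Rd d → ℂ) (N : ℝ), 0 ≤ N →
    (∀ i, BddOn (cube a r) (ψ i)) → (∀ i, BddOn (cube a r) (φ i)) →
    (∀ x, ∑ i, ψ i x * φ i x = 0) →
    (∀ (l : Fin d) (b : Rd d → ℝ), Measurable b → (∀ x, |b x| ≤ 1) →
      ∫⁻ x, ‖∑ i, ψ i x * riesz l (fun y => (b y : ℂ) * φ i y) x‖ₑ ≤ ENNReal.ofReal N) →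
    ‖∫ q : Rd d × Rd d, ∑ i, ψ i q.1 * φ i q.2‖ ≤ C * r ^ d * N := by
  obtain ⟨C, hC0, hC⟩ := exists_schurBound_norm_sub_pow (d := d) (d - 1)
  -- The cube lies in a ball of radius √d r; its power d - 1 comes from the iterated Schur
  -- multiplier, and 2d from the commutators with the coordinates.
  refine ⟨C * √d ^ (d - 1) * (2 * d), by positivity, ?_⟩
  intro a r hr ι _ ψ φ N hN hψ hφ hdiag h
  have hQ := cube_subset_closedBall a hr.le
  have hd : (0 : ℝ) < d := Nat.cast_pos.2 (Nat.pos_of_ne_zero (NeZero.ne d))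
  have hρ : 0 < √d * r := by positivity
  set G : Rd d × Rd d → ℂ := fun q =>
    (r⁻¹ : ℂ) * ((fracKernel d (q.1 - q.2) : ℂ) * ∑ i, ψ i q.1 * φ i q.2) with hG
  have hGi : Integrable G := by
    have := (integrable_finsetSum Finset.univ fun i _ =>
      integrable_prod_fracKernel ((hψ i).mono hQ) ((hφ i).mono hQ)).const_mul (r⁻¹ : ℂ)
    refine this.congr (Eventually.of_forall fun q => ?_)
    simp only [hG, Finset.mul_sum]
  have hG0 : ∀ q : Rd d × Rd d, ¬(q.1 ∈ Metric.closedBall a (√d * r) ∧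
      q.2 ∈ Metric.closedBall a (√d * r)) → G q = 0 := by
    intro q hq
    have : ∑ i, ψ i q.1 * φ i q.2 = 0 := by
      refine Finset.sum_eq_zero fun i _ => ?_
      rcases not_and_or.1 hq with hq | hq
      · rw [((hψ i).mono hQ).supp _ hq, zero_mul]
      · rw [((hφ i).mono hQ).supp _ hq, mul_zero]
    simp only [hG, this, mul_zero]
  have hS : SchurBound (Metric.closedBall a (√d * r)) G (2 * d * N) :=
    schurBound_of_unit measurableSet_closedBall ⟨a, Metric.mem_closedBall_self hρ.le⟩ hG0
      fun α β hα hβ hα1 hβ1 => norm_integral_fracKernel_le hr hN hψ hφ h hα hβ hα1 hβ1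
  have hT := hC a (√d * r) G (2 * d * N) hρ (by positivity) hGi hG0 hS
  have h1 := hT (fun _ => 1) (fun _ => 1) 1 1 measurable_const measurable_const (by simp) (by simp)
  have e : ∀ q : Rd d × Rd d, (((1 : ℝ) * 1 : ℝ) : ℂ) * (((‖q.1 - q.2‖ ^ (d - 1) : ℝ) : ℂ) * G q)
      = (r⁻¹ : ℂ) * ∑ i, ψ i q.1 * φ i q.2 := by
    intro q
    -- On the diagonal the product of |x-y|^{d-1} with the fractional kernel is 0 instead of 1, but
    -- there the tensor vanishes by hypothesis.
    rcases eq_or_ne q.1 q.2 with hq | hq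
    · simp only [hG, hq, hdiag, mul_zero]
    · have := pow_mul_fracKernel (sub_ne_zero.2 hq)
      have : ((‖q.1 - q.2‖ ^ (d - 1) : ℝ) : ℂ) * (fracKernel d (q.1 - q.2) : ℂ) = 1 := by
        exact_mod_cast this
      simp only [hG]
      rw [mul_one, Complex.ofReal_one, one_mul]
      linear_combination ((r⁻¹ : ℂ) * ∑ i, ψ i q.1 * φ i q.2) * this
  simp_rw [e] at h1
  rw [integral_const_mul, norm_mul, ← Complex.ofReal_inv, Complex.norm_real, Real.norm_of_nonneg
    (by positivity), inv_mul_le_iff₀ hr] at h1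
  refine h1.trans (le_of_eq ?_)
  obtain ⟨k, rfl⟩ := Nat.exists_eq_succ_of_ne_zero (NeZero.ne d)
  simp only [Nat.succ_eq_add_one, Nat.add_sub_cancel]
  ring

end Bilinear

/-! ### Mixed norms of finite-rank kernels -/

section FiniteRank

variable {X : Type*} [MeasurableSpace X]

/-- Bounded measurable functions in the unit ball of `L^p(μ)`. -/
structure IsTest (p : ℝ) (μ : Measure X) (f : X → ℂ) : Prop where
  aesm : AEStronglyMeasurable f μ
  bdd : ∃ M : ℝ, ∀ x, ‖f x‖ ≤ M
  norm_le : ∫⁻ x, ‖f x‖ₑ ^ p ∂μ ≤ 1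

variable {μ : Measure X} {p q : ℝ}

theorem lintegral_enorm_rpow_lt_top [IsFiniteMeasure μ] {f : X → ℂ} (hf : ∃ M : ℝ, ∀ x, ‖f x‖ ≤ M) (hp : 0 ≤ p) :
    ∫⁻ x, ‖f x‖ₑ ^ p ∂μ < ∞ := by
  obtain ⟨M, hM⟩ := hf
  calc ∫⁻ x, ‖f x‖ₑ ^ p ∂μ ≤ ∫⁻ _x, ENNReal.ofReal M ^ p ∂μ := by
        refine lintegral_mono fun x => ENNReal.rpow_le_rpow ?_ hp
        rw [← ofReal_norm]
        exact ENNReal.ofReal_le_ofReal (hM x)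
    _ < ∞ := by
        rw [lintegral_const]
        exact ENNReal.mul_lt_top (ENNReal.rpow_lt_top_of_nonneg hp ENNReal.ofReal_ne_top)
          (measure_lt_top μ _)

theorem isTest_zero (hp : 0 < p) : IsTest p μ (fun _ => 0) :=
  ⟨aestronglyMeasurable_const, ⟨0, by simp⟩, by simp [ENNReal.zero_rpow_of_pos hp]⟩

theorem lintegral_enorm_const_mul_rpow (c : ℂ) (f : X → ℂ) (hp : 0 ≤ p) :
    ∫⁻ x, ‖c * f x‖ₑ ^ p ∂μ = ‖c‖ₑ ^ p * ∫⁻ x, ‖f x‖ₑ ^ p ∂μ := by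
  simp_rw [enorm_mul, ENNReal.mul_rpow_of_nonneg _ _ hp]
  rw [lintegral_const_mul' _ _ (ENNReal.rpow_ne_top_of_nonneg hp enorm_ne_top)]

/-- A bounded function becomes a test function after scaling. -/
theorem exists_isTest_const_mul [IsFiniteMeasure μ] {f : X → ℂ} (hfm : AEStronglyMeasurable f μ)
    (hf : ∃ M : ℝ, ∀ x, ‖f x‖ ≤ M) (hp : 0 < p) :
    ∃ t : ℝ, 0 < t ∧ IsTest p μ (fun x => (t : ℂ) * f x) ∧
      ∀ I : ℝ, 0 < I → ∫⁻ x, ‖f x‖ₑ ^ p ∂μ = ENNReal.ofReal I → t = I ^ (-(1 / p)) := by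
  have hlt := lintegral_enorm_rpow_lt_top (μ := μ) hf hp.le
  obtain ⟨M, hM⟩ := hf
  set I := (∫⁻ x, ‖f x‖ₑ ^ p ∂μ).toReal with hI
  have hII : ∫⁻ x, ‖f x‖ₑ ^ p ∂μ = ENNReal.ofReal I := (ENNReal.ofReal_toReal hlt.ne).symm
  have hI0 : 0 ≤ I := ENNReal.toReal_nonneg
  have bd : ∀ t : ℝ, ∃ M : ℝ, ∀ x, ‖(t : ℂ) * f x‖ ≤ M := fun t => ⟨|t| * M, fun x => by
    rw [norm_mul, Complex.norm_real, Real.norm_eq_abs]; gcongr; exact hM x⟩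
  rcases hI0.eq_or_lt with h0 | h0
  · refine ⟨1, one_pos, ⟨hfm.const_mul _, bd 1, ?_⟩, ?_⟩
    · rw [lintegral_enorm_const_mul_rpow _ _ hp.le, hII, ← h0]; simp
    · intro J hJ hJe
      rw [hJe, ← h0] at hII
      rw [ENNReal.ofReal_zero, ENNReal.ofReal_eq_zero] at hII
      linarith
  · refine ⟨I ^ (-(1 / p)), Real.rpow_pos_of_pos h0 _, ⟨hfm.const_mul _, bd _, ?_⟩, ?_⟩
    · rw [lintegral_enorm_const_mul_rpow _ _ hp.le, hII, ← ofReal_norm, Complex.norm_real,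
        Real.norm_of_nonneg (Real.rpow_pos_of_pos h0 _).le,
        ENNReal.ofReal_rpow_of_nonneg (Real.rpow_pos_of_pos h0 _).le hp.le,
        ← ENNReal.ofReal_mul (by positivity), ← Real.rpow_mul h0.le]
      have : -(1 / p) * p = -1 := by field_simp
      rw [this, Real.rpow_neg_one, inv_mul_cancel₀ h0.ne']; simp
    · intro J hJ hJe
      rw [hJe] at hII
      rw [(ENNReal.ofReal_eq_ofReal_iff hJ.le hI0).1 hII]

/-- The converse of Hölder's inequality for bounded functions. -/
theorem lintegral_rpow_le_of_forall_isTest [IsFiniteMeasure μ] (hpq : p.HolderConjugate q) {h : X → ℂ}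
    (hm : AEStronglyMeasurable h μ) (hb : ∃ M : ℝ, ∀ x, ‖h x‖ ≤ M) {M : ℝ}
    (hM : ∀ g, IsTest q μ g → ‖∫ x, g x * h x ∂μ‖ ≤ M) :
    ∫⁻ x, ‖h x‖ₑ ^ p ∂μ ≤ ENNReal.ofReal M ^ p := by
  have hp := hpq.pos
  have hp1 := hpq.lt
  have hq := hpq.symm.pos
  have hlt := lintegral_enorm_rpow_lt_top (μ := μ) hb hp.le
  obtain ⟨K, hK⟩ := hb
  set I := (∫⁻ x, ‖h x‖ₑ ^ p ∂μ).toReal with hI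
  have hII : ∫⁻ x, ‖h x‖ₑ ^ p ∂μ = ENNReal.ofReal I := (ENNReal.ofReal_toReal hlt.ne).symm
  have hI0 : 0 ≤ I := ENNReal.toReal_nonneg
  rcases hI0.eq_or_lt with h0 | h0
  · rw [hII, ← h0]; simp
  -- This is the extremal function of Hölder's inequality; boundedness of `h` makes it bounded and
  -- the integral `I` finite, so that it can be normalized to a test function.
  set g : X → ℂ := fun x => ((‖h x‖ ^ (p - 2) : ℝ) : ℂ) * (starRingEnd ℂ) (h x) with hg
  have hgn : ∀ x, ‖g x‖ = ‖h x‖ ^ (p - 1) := by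
    intro x
    rw [hg, norm_mul, Complex.norm_real, RCLike.norm_conj,
      Real.norm_of_nonneg (Real.rpow_nonneg (norm_nonneg _) _)]
    rcases (norm_nonneg (h x)).eq_or_lt with h1 | h1
    · rw [← h1, mul_zero, Real.zero_rpow (by linarith)]
    · rw [← Real.rpow_add_one h1.ne']; congr 1; ring
  have hgm : AEStronglyMeasurable g μ := by
    refine AEStronglyMeasurable.mul ?_ ?_
    · exact (Complex.measurable_ofReal.comp_aemeasurable
        (hm.norm.aemeasurable.pow_const _)).aestronglyMeasurable
    · exact (Complex.continuous_conj.comp_aestronglyMeasurable hm)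
  have hgb : ∃ M : ℝ, ∀ x, ‖g x‖ ≤ M := ⟨K ^ (p - 1), fun x => by
    rw [hgn]; exact Real.rpow_le_rpow (norm_nonneg _) (hK x) (by linarith)⟩
  have hgI : ∫⁻ x, ‖g x‖ₑ ^ q ∂μ = ENNReal.ofReal I := by
    rw [← hII]
    refine lintegral_congr fun x => ?_
    rw [← ofReal_norm, ← ofReal_norm, hgn, ENNReal.ofReal_rpow_of_nonneg
      (Real.rpow_nonneg (norm_nonneg _) _) hq.le, ENNReal.ofReal_rpow_of_nonneg (norm_nonneg _) hp.le,
      ← Real.rpow_mul (norm_nonneg _), hpq.sub_one_mul_conj]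
  obtain ⟨t, ht, htest, hte⟩ := exists_isTest_const_mul hgm hgb hq
  have hte := hte I h0 hgI
  have hint : ∫ x, ((t : ℂ) * g x) * h x ∂μ = ((t * I : ℝ) : ℂ) := by
    have e : ∀ x, ((t : ℂ) * g x) * h x = ((t * ‖h x‖ ^ p : ℝ) : ℂ) := by
      intro x
      have : (starRingEnd ℂ) (h x) * h x = ((‖h x‖ ^ 2 : ℝ) : ℂ) := by
        rw [mul_comm, Complex.mul_conj, Complex.normSq_eq_norm_sq]
      have h2 : ‖h x‖ ^ (p - 2) * ‖h x‖ ^ 2 = ‖h x‖ ^ p := by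
        rcases (norm_nonneg (h x)).eq_or_lt with h1 | h1
        · rw [← h1, Real.zero_rpow hp.ne']; simp
        · rw [← Real.rpow_natCast, ← Real.rpow_add h1]; congr 1; push_cast; ring
      rw [← h2]
      simp only [hg]
      push_cast at this ⊢
      linear_combination (t : ℂ) * ((‖h x‖ ^ (p - 2) : ℝ) : ℂ) * this
    simp_rw [e]
    rw [integral_complex_ofReal, integral_const_mul, hI]
    congr 2
    rw [integral_eq_lintegral_of_nonneg_ae (Eventually.of_forall fun x =>
      Real.rpow_nonneg (norm_nonneg _) _) (hm.norm.aemeasurable.pow_const _).aestronglyMeasurable]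
    congr 1
    refine lintegral_congr fun x => ?_
    rw [← ofReal_norm, ENNReal.ofReal_rpow_of_nonneg (norm_nonneg _) hp.le]
  have h1 := hM _ htest
  rw [hint, Complex.norm_real, Real.norm_of_nonneg (by positivity), hte] at h1
  have h2 : I ^ (-(1 / q)) * I = I ^ (1 / p) := by
    rw [← Real.rpow_add_one h0.ne']
    congr 1
    have := hpq.inv_add_inv_eq_one
    rw [one_div, one_div]; linarith
  rw [h2] at h1
  rw [hII]
  calc ENNReal.ofReal I = ENNReal.ofReal ((I ^ (1 / p)) ^ p) := by
        rw [← Real.rpow_mul h0.le, one_div_mul_cancel hp.ne', Real.rpow_one]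
    _ ≤ ENNReal.ofReal (M ^ p) := by gcongr
    _ = ENNReal.ofReal M ^ p := by
        rw [ENNReal.ofReal_rpow_of_nonneg ((by positivity : (0:ℝ) ≤ I ^ (1 / p)).trans h1) hp.le]

/-- Comparison with twice the maximum needs no convexity, so it covers exponents below one; p/q is
less than 1 when p < 2. -/
theorem add_rpow_le_two_mul (s t : ℝ≥0∞) {θ : ℝ} (hθ : 0 ≤ θ) :
    (s + t) ^ θ ≤ 2 ^ θ * (s ^ θ + t ^ θ) := by
  calc (s + t) ^ θ ≤ (2 * max s t) ^ θ := by
        gcongr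
        rw [two_mul]
        exact add_le_add (le_max_left _ _) (le_max_right _ _)
    _ = 2 ^ θ * (max s t) ^ θ := ENNReal.mul_rpow_of_nonneg _ _ hθ
    _ ≤ _ := by
        gcongr
        rcases le_total s t with h | h
        · rw [max_eq_right h]; exact le_add_self
        · rw [max_eq_left h]; exact le_self_add

/-- The mixed norm (to the power `p`) of a sum of a kernel and an elementary tensor. -/
theorem mixed_add_tensor_le [IsFiniteMeasure μ] (hp : 0 < p) (hq : 0 < q) {k : X → X → ℂ} {α β : X → ℂ}
    (hα : AEStronglyMeasurable α μ) (hβ : AEStronglyMeasurable β μ) :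
    ∫⁻ x, (∫⁻ y, ‖k x y + α x * β y‖ₑ ^ q ∂μ) ^ (p / q) ∂μ
      ≤ 2 ^ p * 2 ^ (p / q) * (∫⁻ x, (∫⁻ y, ‖k x y‖ₑ ^ q ∂μ) ^ (p / q) ∂μ
        + (∫⁻ x, ‖α x‖ₑ ^ p ∂μ) * (∫⁻ y, ‖β y‖ₑ ^ q ∂μ) ^ (p / q)) := by
  have hpq : 0 ≤ p / q := by positivity
  have h1 : ∀ x, (∫⁻ y, ‖k x y + α x * β y‖ₑ ^ q ∂μ) ^ (p / q)
      ≤ 2 ^ p * 2 ^ (p / q) * ((∫⁻ y, ‖k x y‖ₑ ^ q ∂μ) ^ (p / q)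
        + ‖α x‖ₑ ^ p * (∫⁻ y, ‖β y‖ₑ ^ q ∂μ) ^ (p / q)) := by
    intro x
    have h2 : ∫⁻ y, ‖k x y + α x * β y‖ₑ ^ q ∂μ
        ≤ 2 ^ q * (∫⁻ y, ‖k x y‖ₑ ^ q ∂μ + ‖α x‖ₑ ^ q * ∫⁻ y, ‖β y‖ₑ ^ q ∂μ) := by
      rw [← lintegral_enorm_const_mul_rpow _ _ hq.le, ← lintegral_add_right' _
        ((hβ.const_mul _).enorm.pow_const q), ← lintegral_const_mul' _ _ (by finiteness)]
      refine lintegral_mono fun y => ?_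
      exact (ENNReal.rpow_le_rpow (enorm_add_le _ _) hq.le).trans (add_rpow_le_two_mul _ _ hq.le)
    calc _ ≤ (2 ^ q * (∫⁻ y, ‖k x y‖ₑ ^ q ∂μ + ‖α x‖ₑ ^ q * ∫⁻ y, ‖β y‖ₑ ^ q ∂μ)) ^ (p / q) := by
          gcongr
      _ ≤ _ := by
          rw [ENNReal.mul_rpow_of_nonneg _ _ hpq, ← ENNReal.rpow_mul, mul_div_cancel₀ _ hq.ne',
            mul_assoc]
          refine mul_le_mul_right ((add_rpow_le_two_mul _ _ hpq).trans (le_of_eq ?_)) _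
          rw [ENNReal.mul_rpow_of_nonneg _ _ hpq, ← ENNReal.rpow_mul, mul_div_cancel₀ _ hq.ne']
  refine (lintegral_mono h1).trans ?_
  rw [lintegral_const_mul' _ _ (by finiteness), lintegral_add_right' _
    ((hα.enorm.pow_const p).mul_const _), lintegral_mul_const'' _ (hα.enorm.pow_const p)]

/-- Bounded measurable functions. -/
structure IsBddFun (μ : Measure X) (f : X → ℂ) : Prop where
  aesm : AEStronglyMeasurable f μ
  bdd : ∃ M : ℝ, ∀ x, ‖f x‖ ≤ M

theorem IsTest.isBddFun {f : X → ℂ} (h : IsTest p μ f) : IsBddFun μ f := ⟨h.aesm, h.bdd⟩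

theorem IsBddFun.integrable [IsFiniteMeasure μ] {f : X → ℂ} (h : IsBddFun μ f) : Integrable f μ := by
  obtain ⟨M, hM⟩ := h.bdd
  exact Integrable.of_bound h.aesm M (Eventually.of_forall hM)

theorem IsBddFun.mul {f g : X → ℂ} (hf : IsBddFun μ f) (hg : IsBddFun μ g) :
    IsBddFun μ (fun x => f x * g x) := by
  obtain ⟨M, hM⟩ := hf.bdd
  obtain ⟨K, hK⟩ := hg.bdd
  refine ⟨hf.aesm.mul hg.aesm, ⟨M * K, fun x => ?_⟩⟩
  rw [norm_mul]
  exact mul_le_mul (hM x) (hK x) (norm_nonneg _) ((norm_nonneg _).trans (hM x))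

theorem IsBddFun.const_mul {f : X → ℂ} (hf : IsBddFun μ f) (c : ℂ) :
    IsBddFun μ (fun x => c * f x) :=
  IsBddFun.mul ⟨aestronglyMeasurable_const, ‖c‖, fun _ => le_rfl⟩ hf

theorem IsBddFun.sub {f g : X → ℂ} (hf : IsBddFun μ f) (hg : IsBddFun μ g) :
    IsBddFun μ (fun x => f x - g x) := by
  obtain ⟨M, hM⟩ := hf.bdd
  obtain ⟨K, hK⟩ := hg.bdd
  exact ⟨hf.aesm.sub hg.aesm, ⟨M + K, fun x => (norm_sub_le _ _).trans (add_le_add (hM x) (hK x))⟩⟩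

theorem IsBddFun.sum {ι : Type*} {s : Finset ι} {f : ι → X → ℂ} (hf : ∀ i, IsBddFun μ (f i)) :
    IsBddFun μ (fun x => ∑ i ∈ s, f i x) := by
  choose M hM using fun i => (hf i).bdd
  exact ⟨Finset.aestronglyMeasurable_fun_sum s fun i _ => (hf i).aesm, ⟨∑ i ∈ s, M i, fun x =>
    (norm_sum_le _ _).trans (Finset.sum_le_sum fun i _ => hM i x)⟩⟩

theorem IsBddFun.conj {f : X → ℂ} (hf : IsBddFun μ f) :
    IsBddFun μ (fun x => (starRingEnd ℂ) (f x)) := by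
  obtain ⟨M, hM⟩ := hf.bdd
  exact ⟨Complex.continuous_conj.comp_aestronglyMeasurable hf.aesm, ⟨M, fun x => by
    rw [RCLike.norm_conj]; exact hM x⟩⟩

/-- The bilinear form of a kernel of finite rank. -/
def tensorForm {ι : Type*} (μ : Measure X) (s : Finset ι) (α β : ι → X → ℂ) (g f : X → ℂ) : ℂ :=
  ∑ i ∈ s, (∫ x, g x * α i x ∂μ) * ∫ y, f y * β i y ∂μ

variable {ι : Type*} {s : Finset ι} {α β : ι → X → ℂ}

theorem integral_mul_sum_mul [IsFiniteMeasure μ] {g : X → ℂ} (hg : IsBddFun μ g) (hα : ∀ i, IsBddFun μ (α i))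
    (s : Finset ι) (c : ι → ℂ) :
    ∫ x, g x * ∑ i ∈ s, c i * α i x ∂μ = ∑ i ∈ s, c i * ∫ x, g x * α i x ∂μ := by
  simp_rw [Finset.mul_sum]
  rw [integral_finsetSum _ fun i _ => (hg.mul ((hα i).const_mul (c i))).integrable]
  refine Finset.sum_congr rfl fun i _ => ?_
  rw [← integral_const_mul]
  congr 1; ext x; ring

/-- A kernel of finite rank with vanishing bilinear form vanishes almost everywhere. -/
theorem mixed_eq_zero_of_tensorForm_eq_zero [IsFiniteMeasure μ] (hp : 0 < p) (hq : 0 < q)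
    (hα : ∀ i, IsBddFun μ (α i)) (hβ : ∀ i, IsBddFun μ (β i))
    (h : ∀ g f, IsTest q μ g → IsTest p μ f → tensorForm μ s α β g f = 0) :
    ∫⁻ x, (∫⁻ y, ‖∑ i ∈ s, α i x * β i y‖ₑ ^ q ∂μ) ^ (p / q) ∂μ = 0 := by
  have h0 : ∀ g f, IsBddFun μ g → IsBddFun μ f → tensorForm μ s α β g f = 0 := by
    intro g f hg hf
    obtain ⟨t, ht, htt, -⟩ := exists_isTest_const_mul hg.aesm hg.bdd hq
    obtain ⟨t', ht', htt', -⟩ := exists_isTest_const_mul hf.aesm hf.bdd hp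
    have h1 := h _ _ htt htt'
    have h2 : tensorForm μ s α β (fun x => (t : ℂ) * g x) (fun x => (t' : ℂ) * f x)
        = ((t : ℂ) * t') * tensorForm μ s α β g f := by
      rw [tensorForm, tensorForm, Finset.mul_sum]
      refine Finset.sum_congr rfl fun i _ => ?_
      simp_rw [mul_assoc, integral_const_mul]
      ring
    rw [h2] at h1
    have ht : (t : ℂ) ≠ 0 := by exact_mod_cast ht.ne'
    have ht' : (t' : ℂ) ≠ 0 := by exact_mod_cast ht'.ne'
    simpa [ht, ht'] using h1
  set k : X × X → ℂ := fun z => ∑ i ∈ s, α i z.1 * β i z.2 with hk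
  have hz : ∀ z, ((‖k z‖ ^ 2 : ℝ) : ℂ) = ∑ j ∈ s, ∑ i ∈ s,
      ((starRingEnd ℂ) (α j z.1) * α i z.1) * ((starRingEnd ℂ) (β j z.2) * β i z.2) := by
    intro z
    rw [← Complex.normSq_eq_norm_sq, Complex.normSq_eq_conj_mul_self, hk]
    simp only [map_sum, map_mul]
    rw [Finset.sum_mul_sum]
    exact Finset.sum_congr rfl fun j _ => Finset.sum_congr rfl fun i _ => by ring
  have hint : ∀ i j, Integrable (fun z : X × X =>
      ((starRingEnd ℂ) (α j z.1) * α i z.1) * ((starRingEnd ℂ) (β j z.2) * β i z.2))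
      (μ.prod μ) := fun i j =>
    ((hα j).conj.mul (hα i)).integrable.mul_prod ((hβ j).conj.mul (hβ i)).integrable
  -- Testing the form on the conjugates of the j-th factors and summing over j gives the squared L²
  -- norm of the kernel.
  have hI : ∫ z, ((‖k z‖ ^ 2 : ℝ) : ℂ) ∂(μ.prod μ) = 0 := by
    simp_rw [hz]
    rw [integral_finsetSum _ fun j _ => integrable_finsetSum _ fun i _ => hint i j]
    refine Finset.sum_eq_zero fun j _ => ?_
    rw [integral_finsetSum _ fun i _ => hint i j, ← h0 _ _ (hα j).conj (hβ j).conj, tensorForm]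
    refine Finset.sum_congr rfl fun i _ => ?_
    exact integral_prod_mul (μ := μ) (ν := μ) (fun x => (starRingEnd ℂ) (α j x) * α i x)
      (fun y => (starRingEnd ℂ) (β j y) * β i y)
  have hki : Integrable (fun z => ‖k z‖ ^ 2) (μ.prod μ) := by
    have : Integrable (fun z => ((‖k z‖ ^ 2 : ℝ) : ℂ)) (μ.prod μ) := by
      simp_rw [hz]
      exact integrable_finsetSum _ fun j _ => integrable_finsetSum _ fun i _ => hint i j
    refine this.re.congr (Eventually.of_forall fun z => ?_)
    exact Complex.ofReal_re _
  rw [integral_complex_ofReal, Complex.ofReal_eq_zero, integral_eq_zero_iff_of_nonneg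
    (fun z => by positivity) hki] at hI
  have h2 := Measure.ae_ae_of_ae_prod hI
  rw [lintegral_eq_zero_of_ae_eq_zero]
  filter_upwards [h2] with x hx
  have : ∫⁻ y, ‖∑ i ∈ s, α i x * β i y‖ₑ ^ q ∂μ = 0 := by
    rw [lintegral_eq_zero_of_ae_eq_zero]
    filter_upwards [hx] with y hy
    have hy : ‖k (x, y)‖ ^ 2 = 0 := hy
    have hy : k (x, y) = 0 := by simpa using hy
    have hy : ∑ i ∈ s, α i x * β i y = 0 := hy
    rw [hy]
    simp [hq]
  rw [this]
  exact ENNReal.zero_rpow_of_pos (by positivity)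

/-- A kernel of rank at most `n` that is bounded as an operator on `L^p` has its mixed norm
bounded by a constant depending only on `n`. -/
theorem exists_mixed_le {X : Type*} [MeasurableSpace X] {ι : Type*} (hpq : p.HolderConjugate q)
    (n : ℕ) : ∃ C : ℝ≥0, ∀ (μ : Measure X) [IsFiniteMeasure μ] (s : Finset ι) (α β : ι → X → ℂ)
      (M : ℝ), s.card = n → (∀ i, IsBddFun μ (α i)) → (∀ i, IsBddFun μ (β i)) →
      (∀ g f, IsTest q μ g → IsTest p μ f → ‖tensorForm μ s α β g f‖ ≤ M) →
      ∫⁻ x, (∫⁻ y, ‖∑ i ∈ s, α i x * β i y‖ₑ ^ q ∂μ) ^ (p / q) ∂μ ≤ C * ENNReal.ofReal M ^ p := by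
  classical
  have hp := hpq.pos
  have hq := hpq.symm.pos
  induction n with
  | zero =>
    refine ⟨0, fun μ _ s α β M hs _ _ _ => ?_⟩
    rw [Finset.card_eq_zero.1 hs]
    simp [hq, hp]
  | succ n ih =>
    obtain ⟨C, hC⟩ := ih
    -- Here 3 bounds the relative growth of the form when the rank is lowered, the last 2 bounds the
    -- norm of γ, and the leading factor is the cost of the quasi-triangle inequality for the mixed
    -- norm.
    refine ⟨2 ^ p * 2 ^ (p / q) * (C * 3 ^ p + 2 ^ p), ?_⟩
    intro μ _ s α β M hs hα hβ hM
    set T : Set ℝ := {t | ∃ g f, IsTest q μ g ∧ IsTest p μ f ∧ t = ‖tensorForm μ s α β g f‖}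
      with hT
    have hbd : BddAbove T := ⟨M, by rintro t ⟨g, f, hg, hf, rfl⟩; exact hM g f hg hf⟩
    have hne : T.Nonempty := ⟨_, _, _, isTest_zero hq, isTest_zero hp, rfl⟩
    -- The given bound M may be far from attained. The exact supremum is used so that some pair of
    -- test functions reaches at least half of it.
    set M' := sSup T with hM'
    have hle : ∀ g f, IsTest q μ g → IsTest p μ f → ‖tensorForm μ s α β g f‖ ≤ M' :=
      fun g f hg hf => le_csSup hbd ⟨g, f, hg, hf, rfl⟩
    have hM'M : M' ≤ M := csSup_le hne (by rintro t ⟨g, f, hg, hf, rfl⟩; exact hM g f hg hf)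
    have hM'0 : 0 ≤ M' := (norm_nonneg _).trans (hle _ _ (isTest_zero hq) (isTest_zero hp))
    rcases hM'0.eq_or_lt with h0 | h0
    · rw [mixed_eq_zero_of_tensorForm_eq_zero hp hq hα hβ]
      · exact zero_le
      · intro g f hg hf
        exact norm_le_zero_iff.1 ((hle g f hg hf).trans h0.symm.le)
    obtain ⟨_, ⟨g₀, f₀, hg₀, hf₀, rfl⟩, hlt⟩ := exists_lt_of_lt_csSup hne
      (show M' / 2 < sSup T by linarith)
    set u : ι → ℂ := fun i => ∫ y, f₀ y * β i y ∂μ with hu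
    set v : ι → ℂ := fun i => ∫ x, g₀ x * α i x ∂μ with hv
    set w : ℂ := tensorForm μ s α β g₀ f₀ with hw
    have hwe : w = ∑ i ∈ s, v i * u i := rfl
    have hwpos : 0 < ‖w‖ := by linarith
    have hw0 : w ≠ 0 := norm_pos_iff.1 hwpos
    obtain ⟨i, his, hvi⟩ : ∃ i ∈ s, v i ≠ 0 := by
      by_contra! hcon
      exact hw0 (hwe.trans (Finset.sum_eq_zero fun i hi => by rw [hcon i hi, zero_mul]))
    -- Writing T for the operator with this kernel, δ is T f₀ and γ is the transpose of T applied to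
    -- g₀, divided by the pairing w. The difference of T and δ ⊗ γ is annihilated by f₀ and g₀ and
    -- has smaller rank.
    set γ : X → ℂ := fun y => ∑ j ∈ s, (w⁻¹ * v j) * β j y with hγ
    set δ : X → ℂ := fun x => ∑ j ∈ s, u j * α j x with hδ
    have hγb : IsBddFun μ γ := IsBddFun.sum fun j => (hβ j).const_mul _
    have hδb : IsBddFun μ δ := IsBddFun.sum fun j => (hα j).const_mul _
    set β' : ι → X → ℂ := fun j y => β j y - u j * γ y with hβ'
    set α' : ι → X → ℂ := fun j x => α j x - v j / v i * α i x with hα'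
    have hβ'b : ∀ j, IsBddFun μ (β' j) := fun j => (hβ j).sub (hγb.const_mul _)
    have hα'b : ∀ j, IsBddFun μ (α' j) := fun j => (hα j).sub ((hα i).const_mul _)
    -- linear algebra of the rank reduction
    have key : ∀ (A B : ι → ℂ), ∑ j ∈ s, A j * B j
        = ∑ j ∈ s.erase i, (A j - v j / v i * A i) * (B j - u j * ∑ j ∈ s, (w⁻¹ * v j) * B j)
          + (∑ j ∈ s, u j * A j) * ∑ j ∈ s, (w⁻¹ * v j) * B j := by
      intro A B
      set c := ∑ j ∈ s, (w⁻¹ * v j) * B j with hc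
      -- Because the products v_j u_j sum to w, the corrected right factors satisfy a linear
      -- relation whose coefficient at i is nonzero. Solving for the i-th factor removes one term.
      have h1 : ∑ j ∈ s, v j * (B j - u j * c) = 0 := by
        have : ∑ j ∈ s, v j * (B j - u j * c) = ∑ j ∈ s, v j * B j - (∑ j ∈ s, v j * u j) * c := by
          rw [Finset.sum_mul, ← Finset.sum_sub_distrib]
          exact Finset.sum_congr rfl fun j _ => by ring
        rw [this, ← hwe, hc, Finset.mul_sum, sub_eq_zero]
        refine Finset.sum_congr rfl fun j _ => ?_
        field_simp
      have h2 : ∑ j ∈ s.erase i, (A j - v j / v i * A i) * (B j - u j * c)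
          = ∑ j ∈ s, (A j - v j / v i * A i) * (B j - u j * c) := by
        rw [← Finset.add_sum_erase s _ his, div_self hvi]; ring
      have h3 : ∑ j ∈ s, (A j - v j / v i * A i) * (B j - u j * c)
          = ∑ j ∈ s, A j * B j - (∑ j ∈ s, u j * A j) * c
            - (A i / v i) * ∑ j ∈ s, v j * (B j - u j * c) := by
        rw [Finset.sum_mul, Finset.mul_sum, ← Finset.sum_sub_distrib, ← Finset.sum_sub_distrib]
        refine Finset.sum_congr rfl fun j _ => by field_simp
      rw [h2, h3, h1]; ring
    have hint₁ : ∀ g, IsBddFun μ g → ∀ j, ∫ x, g x * α' j x ∂μ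
        = (∫ x, g x * α j x ∂μ) - v j / v i * ∫ x, g x * α i x ∂μ := by
      intro g hg j
      rw [← integral_const_mul, ← integral_sub (hg.mul (hα j)).integrable
        ((hg.mul (hα i)).const_mul _).integrable]
      congr 1; ext x; simp only [hα']; ring
    have hint₃ : ∀ f, IsBddFun μ f → ∫ y, f y * γ y ∂μ
        = ∑ j ∈ s, (w⁻¹ * v j) * ∫ y, f y * β j y ∂μ := fun f hf =>
      integral_mul_sum_mul hf hβ s _
    have hint₄ : ∀ g, IsBddFun μ g → ∫ x, g x * δ x ∂μ
        = ∑ j ∈ s, u j * ∫ x, g x * α j x ∂μ := fun g hg => integral_mul_sum_mul hg hα s _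
    have hint₂ : ∀ f, IsBddFun μ f → ∀ j, ∫ y, f y * β' j y ∂μ
        = (∫ y, f y * β j y ∂μ) - u j * ∑ j ∈ s, (w⁻¹ * v j) * ∫ y, f y * β j y ∂μ := by
      intro f hf j
      rw [← hint₃ f hf, ← integral_const_mul, ← integral_sub (hf.mul (hβ j)).integrable
        ((hf.mul hγb).const_mul _).integrable]
      congr 1; ext x; simp only [hβ']; ring
    have hγf : ∀ f, IsBddFun μ f → ∫ y, f y * γ y ∂μ = w⁻¹ * tensorForm μ s α β g₀ f := by
      intro f hf
      rw [hint₃ f hf, tensorForm, Finset.mul_sum]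
      exact Finset.sum_congr rfl fun j _ => by ring
    have hδg : ∀ g, IsBddFun μ g → ∫ x, g x * δ x ∂μ = tensorForm μ s α β g f₀ := by
      intro g hg
      rw [hint₄ g hg, tensorForm]
      exact Finset.sum_congr rfl fun j _ => by ring
    have hγn : ∀ f, IsTest p μ f → ‖∫ y, f y * γ y ∂μ‖ ≤ 2 := by
      intro f hf
      rw [hγf f hf.isBddFun, norm_mul, norm_inv, inv_mul_le_iff₀ hwpos]
      linarith [hle g₀ f hg₀ hf]
    have hδn : ∀ g, IsTest q μ g → ‖∫ x, g x * δ x ∂μ‖ ≤ M' := by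
      intro g hg
      rw [hδg g hg.isBddFun]
      exact hle g f₀ hg hf₀
    have hform : ∀ g f, IsTest q μ g → IsTest p μ f →
        ‖tensorForm μ (s.erase i) α' β' g f‖ ≤ 3 * M' := by
      intro g f hg hf
      have h1 := key (fun j => ∫ x, g x * α j x ∂μ) (fun j => ∫ y, f y * β j y ∂μ)
      have h2 : tensorForm μ (s.erase i) α' β' g f = tensorForm μ s α β g f
          - (∫ x, g x * δ x ∂μ) * ∫ y, f y * γ y ∂μ := by
        rw [hint₃ f hf.isBddFun, hint₄ g hg.isBddFun, tensorForm, tensorForm, h1]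
        simp_rw [hint₁ g hg.isBddFun, hint₂ f hf.isBddFun]
        ring
      rw [h2]
      refine (norm_sub_le _ _).trans ?_
      rw [norm_mul]
      have := mul_le_mul (hδn g hg) (hγn f hf) (norm_nonneg _) hM'0
      linarith [hle g f hg hf]
    have hcard : (s.erase i).card = n := by rw [Finset.card_erase_of_mem his, hs]; rfl
    have hmain := hC μ (s.erase i) α' β' (3 * M') hcard hα'b hβ'b hform
    have hδ' := lintegral_rpow_le_of_forall_isTest hpq hδb.aesm hδb.bdd hδn
    have hγ' := lintegral_rpow_le_of_forall_isTest hpq.symm hγb.aesm hγb.bdd hγn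
    have hk : ∀ x y, ∑ j ∈ s, α j x * β j y = ∑ j ∈ s.erase i, α' j x * β' j y + δ x * γ y :=
      fun x y => key (fun j => α j x) (fun j => β j y)
    simp_rw [hk]
    refine (mixed_add_tensor_le hp hq hδb.aesm hγb.aesm).trans ?_
    have h3 : (∫⁻ y, ‖γ y‖ₑ ^ q ∂μ) ^ (p / q) ≤ 2 ^ p := by
      calc _ ≤ (ENNReal.ofReal 2 ^ q) ^ (p / q) := by gcongr
        _ = 2 ^ p := by
          rw [← ENNReal.rpow_mul, mul_div_cancel₀ _ hq.ne']; simp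
    have h4 : ENNReal.ofReal (3 * M') ^ p = 3 ^ p * ENNReal.ofReal M' ^ p := by
      rw [ENNReal.ofReal_mul (by norm_num), ENNReal.mul_rpow_of_nonneg _ _ hp.le]; simp
    have h5 : ENNReal.ofReal M' ^ p ≤ ENNReal.ofReal M ^ p := by gcongr
    rw [h4] at hmain
    calc _ ≤ 2 ^ p * 2 ^ (p / q) * (C * (3 ^ p * ENNReal.ofReal M' ^ p)
          + ENNReal.ofReal M' ^ p * 2 ^ p) := by gcongr
      _ ≤ 2 ^ p * 2 ^ (p / q) * (C * (3 ^ p * ENNReal.ofReal M ^ p)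
          + ENNReal.ofReal M ^ p * 2 ^ p) := by gcongr
      _ = _ := by
        have e1 : ((2 ^ p * 2 ^ (p / q) * (C * 3 ^ p + 2 ^ p) : ℝ≥0) : ℝ≥0∞)
            = 2 ^ p * 2 ^ (p / q) * (C * 3 ^ p + 2 ^ p) := by
          push_cast
          rw [ENNReal.coe_rpow_of_nonneg _ hp.le, ENNReal.coe_rpow_of_nonneg _ hp.le,
            ENNReal.coe_rpow_of_nonneg _ (by positivity)]
          rfl
        rw [e1]; ring

end FiniteRank

/-! ### Matrix powers, operator norms and cubes -/

section MatPow

variable {m : ℕ}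

theorem conjTranspose_matPow (A : Mat m) (s : ℝ) : (matPow A s)ᴴ = matPow A s :=
  (cfc_predicate (fun t : ℝ => t ^ s) A : IsSelfAdjoint _)

theorem pos_of_mem_spectrum {A : Mat m} (hA : A.PosDef) {t : ℝ} (ht : t ∈ spectrum ℝ A) :
    0 < t := by
  rw [hA.1.spectrum_real_eq_range_eigenvalues] at ht
  obtain ⟨i, rfl⟩ := ht
  exact hA.eigenvalues_pos i

theorem continuousOn_rpow_spectrum {A : Mat m} (hA : A.PosDef) (s : ℝ) :
    ContinuousOn (fun t : ℝ => t ^ s) (spectrum ℝ A) := fun _ ht =>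
  (Real.continuousAt_rpow_const _ _ (Or.inl (pos_of_mem_spectrum hA ht).ne')).continuousWithinAt

theorem matPow_mul_matPow_neg {A : Mat m} (hA : A.PosDef) (s : ℝ) :
    matPow A s * matPow A (-s) = 1 := by
  have hA' : IsSelfAdjoint A := hA.1
  rw [matPow, matPow, ← cfc_mul _ _ A (continuousOn_rpow_spectrum hA s)
    (continuousOn_rpow_spectrum hA (-s)), ← cfc_one ℝ A]
  refine cfc_congr fun t ht => ?_
  have := pos_of_mem_spectrum hA ht
  rw [← Real.rpow_add this]; simp

theorem matPow_matPow {A : Mat m} (hA : A.PosDef) (s t : ℝ) :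
    matPow (matPow A s) t = matPow A (s * t) := by
  have hA' : IsSelfAdjoint A := hA.1
  have h1 : ContinuousOn (fun x : ℝ => x ^ t) ((fun x : ℝ => x ^ s) '' spectrum ℝ A) := by
    rintro _ ⟨x, hx, rfl⟩
    exact (Real.continuousAt_rpow_const _ _ (Or.inl (Real.rpow_pos_of_pos
      (pos_of_mem_spectrum hA hx) _).ne')).continuousWithinAt
  rw [matPow, matPow, matPow, ← cfc_comp' (fun x : ℝ => x ^ t) (fun x : ℝ => x ^ s) A h1
    (continuousOn_rpow_spectrum hA s)]
  refine cfc_congr fun x hx => ?_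
  exact (Real.rpow_mul (pos_of_mem_spectrum hA hx).le _ _).symm

-- The functional calculus of a continuous function varies continuously along self-adjoint matrices.
-- Replacing the matrix by its Hermitian part gives a map that is continuous on all matrices and
-- hence usable for measurability.
open scoped Matrix.Norms.L2Operator in
theorem continuous_cfc_add_conjTranspose {f : ℝ → ℝ} (hf : Continuous f) :
    Continuous fun A : Mat m => cfc f ((2⁻¹ : ℝ) • (A + Aᴴ)) := by
  refine Continuous.cfc_of_mem_nhdsSet (𝕜 := ℝ) (s := Set.univ) f Filter.univ_mem ?_ ?_
    hf.continuousOn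
  · have h : Continuous fun A : Mat m => A + Aᴴ :=
      continuous_id.add (Continuous.matrix_conjTranspose (R := ℂ) continuous_id)
    exact Continuous.const_smul (M := ℝ) h 2⁻¹
  · intro A
    exact IsSelfAdjoint.smul (IsSelfAdjoint.all (2⁻¹ : ℝ)) (IsSelfAdjoint.add_star_self A)

/-- For negative s the function t^s is not continuous at zero, so t is first bounded below by
1/(n+1). At a positive definite matrix the approximation is exact once 1/(n+1) is below all the
finitely many eigenvalues. -/
theorem aemeasurable_matPow {d : ℕ} {W : Rd d → Mat m} (hW : IsMatrixWeight W) (s : ℝ)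
    (i j : Fin m) : AEMeasurable (fun x => matPow (W x) s i j) volume := by
  have hWm : AEMeasurable (fun x => (fun i j => W x i j : Fin m → Fin m → ℂ)) volume :=
    aemeasurable_pi_lambda _ fun i => aemeasurable_pi_lambda _ fun j => hW.measurable i j
  set f : ℕ → ℝ → ℝ := fun n t => (max t (1 / ((n : ℝ) + 1))) ^ s with hf
  have hpos : ∀ n : ℕ, (0 : ℝ) < 1 / ((n : ℝ) + 1) := fun n => by positivity
  have hfc : ∀ n, Continuous (f n) := fun n =>
    (continuous_id.max continuous_const).rpow_const fun t =>
      Or.inl ((hpos n).trans_le (le_max_right _ _)).ne'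
  refine aemeasurable_of_tendsto_metrizable_ae atTop
    (f := fun n x => cfc (f n) ((2⁻¹ : ℝ) • (W x + (W x)ᴴ)) i j) (fun n => ?_) ?_
  · have h1 : Continuous fun A : Fin m → Fin m → ℂ =>
        cfc (f n) ((2⁻¹ : ℝ) • ((Matrix.of A : Mat m) + (Matrix.of A : Mat m)ᴴ)) i j :=
      (continuous_apply_apply i j).comp (continuous_cfc_add_conjTranspose (hfc n))
    exact h1.measurable.comp_aemeasurable hWm
  · filter_upwards [hW.posDef] with x hx
    have e : (2⁻¹ : ℝ) • (W x + (W x)ᴴ) = W x := by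
      rw [hx.1.eq, ← two_smul ℝ, smul_smul]; simp
    simp_rw [e]
    refine tendsto_const_nhds.congr' ?_
    have hev : ∀ i, ∀ᶠ n : ℕ in atTop, 1 / ((n : ℝ) + 1) ≤ hx.1.eigenvalues i := fun i =>
      (tendsto_one_div_add_atTop_nhds_zero_nat.eventually_lt_const (hx.eigenvalues_pos i)).mono
        fun n hn => hn.le
    filter_upwards [eventually_all.2 hev] with n hn
    have : cfc (fun t : ℝ => t ^ s) (W x) = cfc (f n) (W x) := by
      refine cfc_congr fun t ht => ?_
      rw [hx.1.spectrum_real_eq_range_eigenvalues] at ht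
      obtain ⟨i, rfl⟩ := ht
      simp only [hf, max_eq_left (hn i)]
    rw [matPow, this]

theorem opENorm_conjTranspose (A : Mat m) : opENorm Aᴴ = opENorm A := by
  rw [opENorm, opENorm, ← ofReal_norm, ← ofReal_norm]
  congr 1
  rw [← Matrix.star_eq_conjTranspose, map_star]
  exact norm_star (Matrix.toEuclideanCLM (n := Fin m) (𝕜 := ℂ) A)

theorem opENorm_neg (A : Mat m) : opENorm (-A) = opENorm A := by
  rw [opENorm, opENorm, map_neg, enorm_neg]

/-- This crude comparison reduces the matrix problem to the m² scalar kernels given by the entries,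
at the cost of a constant depending on m and p. -/
theorem opENorm_le_sum (A : Mat m) : opENorm A ≤ ∑ i, ∑ j, ‖A i j‖ₑ := by
  have h : ‖Matrix.toEuclideanCLM (n := Fin m) (𝕜 := ℂ) A‖ ≤ ∑ i, ∑ j, ‖A i j‖ := by
    refine ContinuousLinearMap.opNorm_le_bound _ (by positivity) fun v => ?_
    have h1 : ‖Matrix.toEuclideanCLM (n := Fin m) (𝕜 := ℂ) A v‖
        ≤ ∑ i, ‖(Matrix.toEuclideanCLM (n := Fin m) (𝕜 := ℂ) A v) i‖ := by
      rw [EuclideanSpace.norm_eq]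
      refine Real.sqrt_le_iff.2 ⟨by positivity, ?_⟩
      exact Finset.sum_sq_le_sq_sum_of_nonneg fun i _ => norm_nonneg _
    refine h1.trans ?_
    rw [Finset.sum_mul]
    refine Finset.sum_le_sum fun i _ => ?_
    have h2 : (Matrix.toEuclideanCLM (n := Fin m) (𝕜 := ℂ) A v) i = ∑ j, A i j * v j := rfl
    rw [h2, Finset.sum_mul]
    refine (norm_sum_le _ _).trans (Finset.sum_le_sum fun j _ => ?_)
    rw [norm_mul]
    exact mul_le_mul_of_nonneg_left (PiLp.norm_apply_le v j) (norm_nonneg _)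
  rw [opENorm, ← ofReal_norm]
  refine (ENNReal.ofReal_le_ofReal h).trans (le_of_eq ?_)
  rw [ENNReal.ofReal_sum_of_nonneg fun i _ => by positivity]
  refine Finset.sum_congr rfl fun i _ => ?_
  rw [ENNReal.ofReal_sum_of_nonneg fun i _ => by positivity]
  simp_rw [ofReal_norm]

theorem volume_cube {d : ℕ} (a : Rd d) (r : ℝ) :
    volume (cube a r) = ENNReal.ofReal r ^ d := by
  have h : cube a r = (MeasurableEquiv.toLp 2 (Fin d → ℝ)).symm ⁻¹'
      (Set.Icc (fun i => a i) (fun i => a i + r)) := by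
    ext x
    simp only [cube, Set.mem_preimage, Set.mem_Icc, Pi.le_def]
    exact forall_and
  rw [h, (EuclideanSpace.volume_preserving_symm_measurableEquiv_toLp (Fin d)).measure_preimage
    measurableSet_Icc.nullMeasurableSet, Real.volume_Icc_pi]
  simp

end MatPow

/-! ### Testing the commutators where weights and symbol are bounded -/

section Truncation

variable {d m : ℕ}

theorem BddOn.mul_bdd {S : Set (Rd d)} {φ α : Rd d → ℂ} (hφ : BddOn S φ)
    (hα : AEStronglyMeasurable α volume) {K : ℝ} (hK : ∀ x ∈ S, ‖α x‖ ≤ K) :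
    BddOn S (fun x => φ x * α x) := by
  obtain ⟨M, hM0, hM⟩ := hφ.bdd_nonneg
  refine ⟨hφ.aesm.mul hα, ⟨M * |K|, fun x => ?_⟩, fun x hx => by rw [hφ.supp x hx, zero_mul]⟩
  by_cases hx : x ∈ S
  · rw [norm_mul]
    exact mul_le_mul (hM x) ((hK x hx).trans (le_abs_self K)) (norm_nonneg _) hM0
  · rw [hφ.supp x hx, zero_mul, norm_zero]; positivity

theorem IsTest.bddOn_indicator {S : Set (Rd d)} (hS : MeasurableSet S) {p : ℝ} {f : Rd d → ℂ}
    (hf : IsTest p (volume.restrict S) f) : BddOn S (S.indicator f) := by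
  obtain ⟨M, hM⟩ := hf.bdd
  exact ⟨(aestronglyMeasurable_indicator_iff hS).2 hf.aesm,
    ⟨M, fun x => (norm_indicator_le_norm_self f x).trans (hM x)⟩,
    fun x hx => Set.indicator_of_notMem hx f⟩

theorem IsTest.lintegral_indicator_le {S : Set (Rd d)} (hS : MeasurableSet S) {p : ℝ} (hp : 0 < p)
    {f : Rd d → ℂ} (hf : IsTest p (volume.restrict S) f) :
    ∫⁻ x, ‖S.indicator f x‖ₑ ^ p ≤ 1 := by
  refine le_trans (le_of_eq ?_) hf.norm_le
  rw [← lintegral_indicator hS]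
  refine lintegral_congr fun x => ?_
  by_cases hx : x ∈ S
  · simp [hx]
  · simp [hx, hp]

/-- The `x`-factors of the `i`-th row of the kernel `Y(x) (B(x) - B(y)) Z(y)` on `S × S`. -/
def leftFactor (S : Set (Rd d)) (Y B : Rd d → Mat m) (i : Fin m) : Fin m ⊕ Fin m → Rd d → ℂ
  | Sum.inl k => S.indicator fun x => (Y x * B x) i k
  | Sum.inr k => S.indicator fun x => -(Y x i k)

/-- The `y`-factors of the `j`-th column of the kernel `Y(x) (B(x) - B(y)) Z(y)` on `S × S`. -/
def rightFactor (S : Set (Rd d)) (B Z : Rd d → Mat m) (j : Fin m) : Fin m ⊕ Fin m → Rd d → ℂ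
  | Sum.inl k => S.indicator fun y => Z y k j
  | Sum.inr k => S.indicator fun y => (B y * Z y) k j

/-- Distributing over the difference B(x) - B(y) separates the variables with m terms for each
summand. The resulting number 2m of products is the only rank information that enters the final
constant. -/
theorem sum_leftFactor_mul_rightFactor {S : Set (Rd d)} {Y B Z : Rd d → Mat m} {i j : Fin m}
    {x y : Rd d} (hx : x ∈ S) (hy : y ∈ S) :
    ∑ k, leftFactor S Y B i k x * rightFactor S B Z j k y = (Y x * (B x - B y) * Z y) i j := by
  rw [Fintype.sum_sum_type]
  simp only [leftFactor, rightFactor, Set.indicator_of_mem hx, Set.indicator_of_mem hy]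
  rw [mul_sub, sub_mul, Matrix.sub_apply, mul_assoc (Y x) (B y), Matrix.mul_apply (M := Y x * B x),
    Matrix.mul_apply (M := Y x), sub_eq_add_neg, ← Finset.sum_neg_distrib]
  congr 1
  exact Finset.sum_congr rfl fun k _ => by ring

variable {S : Set (Rd d)} {Y B Z : Rd d → Mat m} {K : ℝ}

theorem aestronglyMeasurable_mul_apply
    (hY : ∀ i j, AEStronglyMeasurable (fun x => Y x i j) volume)
    (hB : ∀ i j, AEStronglyMeasurable (fun x => B x i j) volume) (i j : Fin m) :
    AEStronglyMeasurable (fun x => (Y x * B x) i j) volume := by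
  simp_rw [Matrix.mul_apply]
  exact Finset.aestronglyMeasurable_fun_sum _ fun k _ => (hY i k).mul (hB k j)

theorem norm_mul_apply_le {A D : Mat m} (hA : ∀ i j, ‖A i j‖ ≤ K) (hD : ∀ i j, ‖D i j‖ ≤ K)
    (i j : Fin m) : ‖(A * D) i j‖ ≤ m * (K * K) := by
  rw [Matrix.mul_apply]
  refine (norm_sum_le _ _).trans ?_
  calc ∑ k, ‖A i k * D k j‖ ≤ ∑ _k : Fin m, K * K := by
        refine Finset.sum_le_sum fun k _ => ?_
        rw [norm_mul]
        exact mul_le_mul (hA i k) (hD k j) (norm_nonneg _) ((norm_nonneg _).trans (hA i k))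
    _ = m * (K * K) := by simp

theorem bddOn_leftFactor (hS : MeasurableSet S)
    (hY : ∀ i j, AEStronglyMeasurable (fun x => Y x i j) volume)
    (hB : ∀ i j, AEStronglyMeasurable (fun x => B x i j) volume)
    (hYK : ∀ x ∈ S, ∀ i j, ‖Y x i j‖ ≤ K) (hBK : ∀ x ∈ S, ∀ i j, ‖B x i j‖ ≤ K) (i : Fin m)
    (k : Fin m ⊕ Fin m) : BddOn S (leftFactor S Y B i k) := by
  have key : ∀ {α : Rd d → ℂ} {L : ℝ}, AEStronglyMeasurable α volume → (∀ x ∈ S, ‖α x‖ ≤ L) →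
      BddOn S (S.indicator α) := by
    intro α L hα hL
    refine ⟨hα.indicator hS, ⟨|L|, fun x => ?_⟩, fun x hx => Set.indicator_of_notMem hx α⟩
    by_cases hx : x ∈ S
    · rw [Set.indicator_of_mem hx]; exact (hL x hx).trans (le_abs_self L)
    · rw [Set.indicator_of_notMem hx, norm_zero]; positivity
  rcases k with k | k
  · exact key (aestronglyMeasurable_mul_apply hY hB i k)
      fun x hx => norm_mul_apply_le (hYK x hx) (hBK x hx) i k
  · exact key (hY i k).neg fun x hx => by rw [norm_neg]; exact hYK x hx i k

theorem bddOn_rightFactor (hS : MeasurableSet S)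
    (hB : ∀ i j, AEStronglyMeasurable (fun x => B x i j) volume)
    (hZ : ∀ i j, AEStronglyMeasurable (fun x => Z x i j) volume)
    (hBK : ∀ x ∈ S, ∀ i j, ‖B x i j‖ ≤ K) (hZK : ∀ x ∈ S, ∀ i j, ‖Z x i j‖ ≤ K) (j : Fin m)
    (k : Fin m ⊕ Fin m) : BddOn S (rightFactor S B Z j k) := by
  have key : ∀ {α : Rd d → ℂ} {L : ℝ}, AEStronglyMeasurable α volume → (∀ x ∈ S, ‖α x‖ ≤ L) →
      BddOn S (S.indicator α) := by
    intro α L hα hL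
    refine ⟨hα.indicator hS, ⟨|L|, fun x => ?_⟩, fun x hx => Set.indicator_of_notMem hx α⟩
    by_cases hx : x ∈ S
    · rw [Set.indicator_of_mem hx]; exact (hL x hx).trans (le_abs_self L)
    · rw [Set.indicator_of_notMem hx, norm_zero]; positivity
  rcases k with k | k
  · exact key (hZ k j) fun x hx => hZK x hx k j
  · exact key (aestronglyMeasurable_mul_apply hB hZ k j)
      fun x hx => norm_mul_apply_le (hBK x hx) (hZK x hx) k j

theorem aemeasurable_enorm_act {F : Rd d → Cm m}
    (hY : ∀ i j, AEStronglyMeasurable (fun x => Y x i j) volume)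
    (hF : ∀ i, AEStronglyMeasurable (fun x => F x i) volume) :
    AEMeasurable (fun x => ‖act (Y x) (F x)‖ₑ) volume := by
  have h : AEMeasurable (fun x => act (Y x) (F x)) volume := by
    refine (PiLp.continuous_toLp 2 _).measurable.comp_aemeasurable
      (aemeasurable_pi_lambda _ fun i => ?_)
    have h1 : AEStronglyMeasurable (fun x => ∑ k, Y x i k * F x k) volume :=
      Finset.aestronglyMeasurable_fun_sum _ fun k _ => (hY i k).mul (hF k)
    exact h1.aemeasurable
  exact h.enorm

theorem enorm_apply_le (v : Cm m) (i : Fin m) : ‖v i‖ₑ ≤ ‖v‖ₑ := by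
  rw [← ofReal_norm, ← ofReal_norm]
  exact ENNReal.ofReal_le_ofReal (PiLp.norm_apply_le v i)

/-- The pairing of a commutator with a bounded test function. -/
theorem lintegral_pairing_le {p q : ℝ} (hpq : p.HolderConjugate q) {V : Rd d → Mat m}
    {E : Rd d → Cm m} {g : Rd d → ℂ} {N : ℝ} (i : Fin m)
    (hV : ∀ i j, AEStronglyMeasurable (fun x => matPow (V x) (1 / p) i j) volume)
    (hE : ∀ i, AEStronglyMeasurable (fun x => E x i) volume)
    (hg : AEStronglyMeasurable g volume) (hgq : ∫⁻ x, ‖g x‖ₑ ^ q ≤ 1)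
    (hN : wNorm p V E ≤ ENNReal.ofReal N) :
    ∫⁻ x, ‖g x * (act (matPow (V x) (1 / p)) (E x)) i‖ₑ ≤ ENNReal.ofReal N := by
  calc ∫⁻ x, ‖g x * (act (matPow (V x) (1 / p)) (E x)) i‖ₑ
      ≤ ∫⁻ x, (fun x => ‖act (matPow (V x) (1 / p)) (E x)‖ₑ) x * (fun x => ‖g x‖ₑ) x := by
        refine lintegral_mono fun x => ?_
        rw [enorm_mul, mul_comm]
        exact mul_le_mul' (enorm_apply_le _ i) le_rfl
    _ ≤ (∫⁻ x, ‖act (matPow (V x) (1 / p)) (E x)‖ₑ ^ p) ^ (1 / p) *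
        (∫⁻ x, ‖g x‖ₑ ^ q) ^ (1 / q) :=
        ENNReal.lintegral_mul_le_Lp_mul_Lq volume hpq (aemeasurable_enorm_act hV hE) hg.enorm
    _ ≤ ENNReal.ofReal N * 1 := by
        gcongr
        · exact hN
        · exact ENNReal.rpow_le_one hgq (by have := hpq.symm.pos; positivity)
    _ = _ := mul_one _

/-- On a set where everything is bounded, the finite-rank kernel
`V^{1/p}(x) (B(x) - B(y)) U^{-1/p}(y)` is controlled by the commutators. -/
theorem exists_tensorForm_le (d : ℕ) [NeZero d] : ∃ C : ℝ, 0 ≤ C ∧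
    ∀ (m : ℕ) (p q : ℝ) (U V B : Rd d → Mat m) (S : Set (Rd d)) (a : Rd d) (r K N : ℝ),
    p.HolderConjugate q → 0 < r → 0 ≤ N → MeasurableSet S → S ⊆ cube a r →
    (∀ i j, AEStronglyMeasurable (fun x => matPow (V x) (1 / p) i j) volume) →
    (∀ i j, AEStronglyMeasurable (fun x => B x i j) volume) →
    (∀ i j, AEStronglyMeasurable (fun x => matPow (U x) (-(1 / p)) i j) volume) →
    (∀ x ∈ S, ∀ i j, ‖matPow (V x) (1 / p) i j‖ ≤ K) → (∀ x ∈ S, ∀ i j, ‖B x i j‖ ≤ K) →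
    (∀ x ∈ S, ∀ i j, ‖matPow (U x) (-(1 / p)) i j‖ ≤ K) →
    (∀ x ∈ S, matPow (U x) (1 / p) * matPow (U x) (-(1 / p)) = 1) →
    (∀ l, commutatorNorm p U V B l ≤ ENNReal.ofReal N) →
    ∀ (i j : Fin m) (g f : Rd d → ℂ), IsTest q (volume.restrict S) g →
      IsTest p (volume.restrict S) f →
      ‖tensorForm (volume.restrict S) Finset.univ
        (leftFactor S (fun x => matPow (V x) (1 / p)) B i)
        (rightFactor S B (fun y => matPow (U y) (-(1 / p))) j) g f‖ ≤ C * r ^ d * N := by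
  obtain ⟨C, hC0, hC⟩ := exists_norm_integral_tensor_le d
  refine ⟨C, hC0, ?_⟩
  intro m p q U V B S a r K N hpq hr hN hS hSQ hYm hBm hZm hYK hBK hZK hUZ hcomm i j g f hg hf
  set Y : Rd d → Mat m := fun x => matPow (V x) (1 / p) with hY
  set Z : Rd d → Mat m := fun x => matPow (U x) (-(1 / p)) with hZ
  have hgS := hg.bddOn_indicator hS
  have hfS := hf.bddOn_indicator hS
  have hα := bddOn_leftFactor hS hYm hBm hYK hBK i
  have hβ := bddOn_rightFactor hS hBm hZm hBK hZK j
  set ψ : Fin m ⊕ Fin m → Rd d → ℂ := fun k x => S.indicator g x * leftFactor S Y B i k x with hψ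
  set φ : Fin m ⊕ Fin m → Rd d → ℂ := fun k x => S.indicator f x * rightFactor S B Z j k x with hφ
  have bdd_mul : ∀ {A D : Rd d → ℂ}, BddOn S A → BddOn S D → BddOn S (fun x => A x * D x) := by
    intro A D hA hD
    obtain ⟨M, hM⟩ := hD.bdd
    exact hA.mul_bdd hD.aesm fun x _ => hM x
  have hψS : ∀ k, BddOn S (ψ k) := fun k => bdd_mul hgS (hα k)
  have hφS : ∀ k, BddOn S (φ k) := fun k => bdd_mul hfS (hβ k)
  have hQ := cube_subset_closedBall a hr.le
  have hdiag : ∀ x, ∑ k, ψ k x * φ k x = 0 := by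
    intro x
    by_cases hx : x ∈ S
    · have h1 : ∑ k, ψ k x * φ k x = (S.indicator g x * S.indicator f x) *
          ∑ k, leftFactor S Y B i k x * rightFactor S B Z j k x := by
        rw [Finset.mul_sum]
        exact Finset.sum_congr rfl fun k _ => by simp only [hψ, hφ]; ring
      rw [h1, sum_leftFactor_mul_rightFactor hx hx]
      simp
    · exact Finset.sum_eq_zero fun k _ => by rw [(hψS k).supp x hx, zero_mul]
  have hbound : ∀ (l : Fin d) (b : Rd d → ℝ), Measurable b → (∀ x, |b x| ≤ 1) →
      ∫⁻ x, ‖∑ k, ψ k x * riesz l (fun y => (b y : ℂ) * φ k y) x‖ₑ ≤ ENNReal.ofReal N := by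
    intro l b hb hb1
    have hbφ : ∀ k, BddOn S (fun y => (b y : ℂ) * φ k y) := fun k =>
      (hφS k).ofReal_mul hb (β := 1) fun x _ => hb1 x
    -- The test function is b f U^{-1/p} e_j on S. Its image under B supplies the second half of the
    -- right factors, so the commutator produces all 2m terms at once.
    set F : Rd d → Cm m := fun y => WithLp.toLp 2 fun k => (b y : ℂ) * φ (Sum.inl k) y with hF
    have hBF : ∀ y k, act (B y) (F y) k = (b y : ℂ) * φ (Sum.inr k) y := by
      intro y k
      have h1 : act (B y) (F y) k = ∑ n, B y k n * ((b y : ℂ) * φ (Sum.inl n) y) := rfl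
      rw [h1]
      by_cases hy : y ∈ S
      · simp only [hφ, rightFactor, Set.indicator_of_mem hy, Matrix.mul_apply, Finset.mul_sum]
        exact Finset.sum_congr rfl fun n _ => by ring
      · rw [(hφS _).supp y hy, mul_zero]
        exact Finset.sum_eq_zero fun n _ => by rw [(hφS _).supp y hy]; ring
    have hFz : ∀ y, y ∉ S → F y = 0 := by
      intro y hy
      ext k
      change (b y : ℂ) * φ (Sum.inl k) y = 0
      rw [(hφS _).supp y hy, mul_zero]
    have hFm : AEStronglyMeasurable F volume :=
      (PiLp.continuous_toLp 2 _).comp_aestronglyMeasurable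
        (aemeasurable_pi_lambda _ fun k => (hbφ (Sum.inl k)).aesm.aemeasurable).aestronglyMeasurable
    have hF1 : MemLp F ∞ volume := by
      choose M hM using fun k => (hbφ (Sum.inl k)).bdd
      refine memLp_top_of_bound hFm (∑ k, M k) (Eventually.of_forall fun y => ?_)
      rw [EuclideanSpace.norm_eq]
      refine Real.sqrt_le_iff.2 ⟨Finset.sum_nonneg fun k _ => (norm_nonneg _).trans (hM k 0), ?_⟩
      refine (Finset.sum_sq_le_sq_sum_of_nonneg fun k _ => norm_nonneg _).trans ?_
      exact pow_le_pow_left₀ (Finset.sum_nonneg fun k _ => norm_nonneg _)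
        (Finset.sum_le_sum fun k _ => hM k y) 2
    have hF2 : HasCompactSupport F := HasCompactSupport.intro (isCompact_cube a r)
      fun y hy => hFz y fun h => hy (hSQ h)
    have hp := hpq.pos
    -- The factor U^{1/p} of the norm undoes U^{-1/p}, so the weighted norm of `F` is the unweighted
    -- norm of b f on S.
    have hF3 : wNorm p U F ≤ 1 := by
      rw [wNorm]
      refine ENNReal.rpow_le_one (le_trans (lintegral_mono fun y => ?_)
        (hf.lintegral_indicator_le hS hp)) (by positivity)
      by_cases hy : y ∈ S
      · have h1 : act (matPow (U y) (1 / p)) (F y)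
            = ((b y : ℂ) * f y) • EuclideanSpace.single j (1 : ℂ) := by
          ext n
          have h2 : act (matPow (U y) (1 / p)) (F y) n
              = ((b y : ℂ) * f y) * (matPow (U y) (1 / p) * Z y) n j := by
            have h3 : act (matPow (U y) (1 / p)) (F y) n
                = ∑ k, matPow (U y) (1 / p) n k * F y k := rfl
            rw [h3, Matrix.mul_apply, Finset.mul_sum]
            refine Finset.sum_congr rfl fun k _ => ?_
            simp only [hF, hφ, rightFactor, Set.indicator_of_mem hy]
            ring
          rw [h2, hUZ y hy, Matrix.one_apply]
          simp
        refine ENNReal.rpow_le_rpow ?_ hp.le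
        rw [h1, Set.indicator_of_mem hy, ← ofReal_norm, ← ofReal_norm, norm_smul, norm_mul,
          Complex.norm_real, PiLp.norm_single, norm_one, mul_one]
        refine ENNReal.ofReal_le_ofReal ?_
        exact mul_le_of_le_one_left (norm_nonneg _) (hb1 y)
      · rw [hFz y hy]
        have : act (matPow (U y) (1 / p)) 0 = 0 := by
          ext n
          simp [act]
        rw [this]
        simp [hp]
    have hN' : wNorm p V (commutator B l F) ≤ ENNReal.ofReal N := by
      refine le_trans ?_ (hcomm l)
      rw [commutatorNorm]
      refine le_iSup_of_le F (le_iSup_of_le hF1 (le_iSup_of_le hF2 ?_))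
      exact le_iSup (fun _ : wNorm p U F ≤ 1 => wNorm p V (commutator B l F)) hF3
    have hcomp : ∀ x k, commutator B l F x k
        = ∑ n, B x k n * riesz l (fun y => (b y : ℂ) * φ (Sum.inl n) y) x
          - riesz l (fun y => (b y : ℂ) * φ (Sum.inr k) y) x := by
      intro x k
      have h1 : commutator B l F x k
        = ∑ n, B x k n * riesz l (fun y => (b y : ℂ) * φ (Sum.inl n) y) x
          - riesz l (fun y => act (B y) (F y) k) x := rfl
      rw [h1]
      simp_rw [hBF]
    have hEm : ∀ k, AEStronglyMeasurable (fun x => commutator B l F x k) volume := by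
      intro k
      simp_rw [hcomp]
      exact (Finset.aestronglyMeasurable_fun_sum _ fun n _ => (hBm k n).mul
        (aestronglyMeasurable_riesz l ((hbφ _).mono (hSQ.trans hQ)))).sub
        (aestronglyMeasurable_riesz l ((hbφ _).mono (hSQ.trans hQ)))
    have hpair := lintegral_pairing_le hpq i hYm hEm hgS.aesm
      (hg.lintegral_indicator_le hS hpq.symm.pos) hN'
    refine le_trans (le_of_eq (lintegral_congr fun x => ?_)) hpair
    congr 1
    by_cases hx : x ∈ S
    · have h1 : act (matPow (V x) (1 / p)) (commutator B l F x) i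
          = ∑ k, Y x i k * commutator B l F x k := rfl
      rw [h1, Fintype.sum_sum_type]
      simp_rw [hcomp]
      simp only [hψ, leftFactor, Set.indicator_of_mem hx, Matrix.mul_apply]
      have h2 : ∑ k, g x * (∑ n, Y x i n * B x n k) *
          riesz l (fun y => (b y : ℂ) * φ (Sum.inl k) y) x
          = ∑ k, ∑ n, g x * (Y x i k * (B x k n *
            riesz l (fun y => (b y : ℂ) * φ (Sum.inl n) y) x)) := by
        rw [Finset.sum_comm]
        refine Finset.sum_congr rfl fun k _ => ?_
        rw [Finset.mul_sum, Finset.sum_mul]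
        exact Finset.sum_congr rfl fun n _ => by ring
      rw [h2, ← Finset.sum_add_distrib, Finset.mul_sum]
      refine Finset.sum_congr rfl fun k _ => ?_
      rw [mul_sub, mul_sub, Finset.mul_sum, Finset.mul_sum]
      ring
    · rw [Set.indicator_of_notMem hx, zero_mul]
      exact Finset.sum_eq_zero fun k _ => by rw [(hψS k).supp x hx, zero_mul]
  have hmain := hC a r hr (Fin m ⊕ Fin m) ψ φ N hN (fun k => (hψS k).mono hSQ)
    (fun k => (hφS k).mono hSQ) hdiag hbound
  refine le_trans (le_of_eq ?_) hmain
  congr 1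
  rw [Measure.volume_eq_prod, integral_finsetSum _ fun k _ => (((hψS k).mono (hSQ.trans hQ)).integrable.mul_prod
    ((hφS k).mono (hSQ.trans hQ)).integrable), tensorForm]
  refine Finset.sum_congr rfl fun k _ => ?_
  rw [← integral_indicator hS, ← integral_indicator hS]
  refine Eq.trans ?_ (integral_prod_mul (μ := (volume : Measure (Rd d))) (ν := volume)
    (ψ k) (φ k)).symm
  congr 2
  · ext x
    by_cases hx : x ∈ S
    · simp only [hψ, Set.indicator_of_mem hx]
    · rw [Set.indicator_of_notMem hx, (hψS k).supp x hx]
  · ext x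
    by_cases hx : x ∈ S
    · simp only [hφ, Set.indicator_of_mem hx]
    · rw [Set.indicator_of_notMem hx, (hφS k).supp x hx]

end Truncation

/-! ### Exhaustion, averages and duality -/

section Assembly

variable {d m : ℕ}

/-- The sets are sublevel sets of measurable representatives with a measurable null set removed, so
that bounds and the property `P` hold at every point of them. The estimates do not depend on n,
which allows a passage to the limit. -/
theorem exists_exhaustion {Q : Set (Rd d)} (hQ : MeasurableSet Q) {ι : Type*} [Finite ι]
    {h : ι → Rd d → ℂ} (hh : ∀ i, AEMeasurable (h i) volume) {P : Rd d → Prop}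
    (hP : ∀ᵐ x, P x) :
    ∃ S : ℕ → Set (Rd d), (∀ n, MeasurableSet (S n)) ∧ Monotone S ∧ (∀ n, S n ⊆ Q) ∧
      (∀ n, ∀ x ∈ S n, P x ∧ ∀ i, ‖h i x‖ ≤ n) ∧ Q =ᵐ[volume] ⋃ n, S n := by
  have hall : ∀ᵐ x, P x ∧ ∀ i, h i x = (hh i).mk (h i) x := by
    filter_upwards [hP, ae_all_iff.2 fun i => (hh i).ae_eq_mk] with x h1 h2 using ⟨h1, h2⟩
  obtain ⟨E, hE, hEm, hE0⟩ := exists_measurable_superset_of_null (ae_iff.1 hall)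
  have hgood : ∀ x, x ∉ E → P x ∧ ∀ i, h i x = (hh i).mk (h i) x := fun x hx => by
    by_contra hcon
    exact hx (hE hcon)
  refine ⟨fun n => Q ∩ Eᶜ ∩ {x | ∀ i, ‖(hh i).mk (h i) x‖ ≤ n}, fun n => ?_, ?_, ?_, ?_, ?_⟩
  · refine (hQ.inter hEm.compl).inter ?_
    have : {x | ∀ i, ‖(hh i).mk (h i) x‖ ≤ n} = ⋂ i, {x | ‖(hh i).mk (h i) x‖ ≤ n} := by
      ext x; simp
    rw [this]
    exact MeasurableSet.iInter fun i =>
      measurableSet_le (hh i).measurable_mk.norm measurable_const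
  · intro n k hnk x hx
    exact ⟨hx.1, fun i => (hx.2 i).trans (by exact_mod_cast hnk)⟩
  · exact fun n x hx => hx.1.1
  · intro n x hx
    refine ⟨(hgood x hx.1.2).1, fun i => ?_⟩
    rw [(hgood x hx.1.2).2 i]
    exact hx.2 i
  · have hE' : ∀ᵐ x, x ∉ E := measure_eq_zero_iff_ae_notMem.1 hE0
    filter_upwards [hE'] with x hx
    refine propext ⟨fun hxQ => ?_, fun hxU => ?_⟩
    · have hfin : BddAbove (Set.range fun i => ‖(hh i).mk (h i) x‖) := Set.finite_range _ |>.bddAbove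
      obtain ⟨M, hM⟩ := hfin
      obtain ⟨n, hn⟩ := exists_nat_ge M
      exact Set.mem_iUnion.2 ⟨n, ⟨hxQ, hx⟩, fun i => (hM ⟨i, rfl⟩).trans hn⟩
    · obtain ⟨n, hn⟩ := Set.mem_iUnion.1 hxU
      exact hn.1.1

theorem aemeasurable_setLIntegral {h : Rd d → Rd d → ℝ≥0∞}
    (hh : AEMeasurable (fun z : Rd d × Rd d => h z.1 z.2) volume) (s t : Set (Rd d)) :
    AEMeasurable (fun x => ∫⁻ y in s, h x y) (volume.restrict t) := by
  refine AEMeasurable.lintegral_prod_right' (f := fun z : Rd d × Rd d => h z.1 z.2) ?_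
  rw [Measure.prod_restrict]
  exact hh.restrict

/-- Monotone convergence for mixed norms. -/
theorem mixed_le_of_exhaustion {Q : Set (Rd d)} {S : ℕ → Set (Rd d)} (hS : Monotone S)
    (hQS : Q =ᵐ[volume] ⋃ n, S n) {h : Rd d → Rd d → ℝ≥0∞}
    (hh : AEMeasurable (fun z : Rd d × Rd d => h z.1 z.2) volume) {θ : ℝ} (hθ : 0 < θ) {A : ℝ≥0∞}
    (hA : ∀ n, ∫⁻ x in S n, (∫⁻ y in S n, h x y) ^ θ ≤ A) :
    ∫⁻ x in Q, (∫⁻ y in Q, h x y) ^ θ ≤ A := by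
  rw [Measure.restrict_congr_set hQS]
  have hdir : Directed (· ⊆ ·) S := hS.directed_le
  have h1 : ∀ x, (∫⁻ y in ⋃ n, S n, h x y) ^ θ = ⨆ n, (∫⁻ y in S n, h x y) ^ θ := by
    intro x
    rw [setLIntegral_iUnion_of_directed _ hdir]
    exact (ENNReal.orderIsoRpow θ hθ).map_iSup _
  simp_rw [h1]
  have hmono : ∀ x, Monotone fun n => (∫⁻ y in S n, h x y) ^ θ := fun x n k hnk =>
    ENNReal.rpow_le_rpow (lintegral_mono_set (hS hnk)) hθ.le
  rw [lintegral_iSup' (fun n => (aemeasurable_setLIntegral hh _ _).pow_const θ)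
    (Eventually.of_forall hmono)]
  refine iSup_le fun n => ?_
  rw [setLIntegral_iUnion_of_directed _ hdir]
  refine iSup_le fun k => ?_
  -- The inner and the outer exhaustion run separately; both are absorbed by the diagonal set with
  -- the larger index.
  refine le_trans ?_ (hA (max n k))
  exact (lintegral_mono fun x => hmono x (le_max_left n k)).trans
    (lintegral_mono_set (hS (le_max_right n k)))

theorem sum_rpow_le {ι : Type*} (s : Finset ι) (t : ι → ℝ≥0∞) {θ : ℝ} (hθ : 0 < θ) :
    (∑ c ∈ s, t c) ^ θ ≤ (s.card : ℝ≥0∞) ^ θ * ∑ c ∈ s, t c ^ θ := by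
  rcases s.eq_empty_or_nonempty with rfl | hs
  · simp [hθ]
  · obtain ⟨c, hc, hmax⟩ := s.exists_max_image t hs
    calc (∑ c ∈ s, t c) ^ θ ≤ ((s.card : ℝ≥0∞) * t c) ^ θ := by
          gcongr
          rw [← nsmul_eq_mul]
          exact Finset.sum_le_card_nsmul s t _ hmax
      _ = (s.card : ℝ≥0∞) ^ θ * t c ^ θ := ENNReal.mul_rpow_of_nonneg _ _ hθ.le
      _ ≤ _ := by
          gcongr
          exact Finset.single_le_sum (f := fun c => t c ^ θ) (fun _ _ => zero_le) hc

theorem mixed_sum_le {ι : Type*} (s : Finset ι) {h : ι → Rd d → Rd d → ℝ≥0∞} {Q : Set (Rd d)}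
    (hh : ∀ c, AEMeasurable (fun z : Rd d × Rd d => h c z.1 z.2) volume)
    (hh' : ∀ c x, AEMeasurable (h c x) volume) {q θ : ℝ} (hq : 0 < q) (hθ : 0 < θ) {A : ℝ≥0∞}
    (hA : ∀ c, ∫⁻ x in Q, (∫⁻ y in Q, h c x y ^ q) ^ θ ≤ A) :
    ∫⁻ x in Q, (∫⁻ y in Q, (∑ c ∈ s, h c x y) ^ q) ^ θ
      ≤ ((s.card : ℝ≥0∞) ^ q) ^ θ * (s.card : ℝ≥0∞) ^ θ * (s.card * A) := by
  have hcard : ((s.card : ℝ≥0∞) ^ q) ≠ ∞ :=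
    ENNReal.rpow_ne_top_of_nonneg hq.le (ENNReal.natCast_ne_top _)
  have hcard' : ((s.card : ℝ≥0∞) ^ q) ^ θ * (s.card : ℝ≥0∞) ^ θ ≠ ∞ :=
    ENNReal.mul_ne_top (ENNReal.rpow_ne_top_of_nonneg hθ.le hcard)
      (ENNReal.rpow_ne_top_of_nonneg hθ.le (ENNReal.natCast_ne_top _))
  calc ∫⁻ x in Q, (∫⁻ y in Q, (∑ c ∈ s, h c x y) ^ q) ^ θ
      ≤ ∫⁻ x in Q, ((s.card : ℝ≥0∞) ^ q) ^ θ * (s.card : ℝ≥0∞) ^ θ *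
          ∑ c ∈ s, (∫⁻ y in Q, h c x y ^ q) ^ θ := by
        refine lintegral_mono fun x => ?_
        have h1 : ∫⁻ y in Q, (∑ c ∈ s, h c x y) ^ q
            ≤ (s.card : ℝ≥0∞) ^ q * ∑ c ∈ s, ∫⁻ y in Q, h c x y ^ q := by
          rw [← lintegral_finsetSum' _ fun c _ => ((hh' c x).pow_const q).restrict,
            ← lintegral_const_mul' _ _ hcard]
          exact lintegral_mono fun y => sum_rpow_le s _ hq
        calc _ ≤ ((s.card : ℝ≥0∞) ^ q * ∑ c ∈ s, ∫⁻ y in Q, h c x y ^ q) ^ θ := by gcongr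
          _ = ((s.card : ℝ≥0∞) ^ q) ^ θ * (∑ c ∈ s, ∫⁻ y in Q, h c x y ^ q) ^ θ :=
              ENNReal.mul_rpow_of_nonneg _ _ hθ.le
          _ ≤ _ := by
              rw [mul_assoc]
              exact mul_le_mul_right (sum_rpow_le s _ hθ) _
    _ = ((s.card : ℝ≥0∞) ^ q) ^ θ * (s.card : ℝ≥0∞) ^ θ *
          ∑ c ∈ s, ∫⁻ x in Q, (∫⁻ y in Q, h c x y ^ q) ^ θ := by
        rw [lintegral_const_mul' _ _ hcard', lintegral_finsetSum']
        exact fun c _ => (aemeasurable_setLIntegral ((hh c).pow_const q) Q Q).pow_const θ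
    _ ≤ _ := by
        gcongr
        rw [← nsmul_eq_mul]
        exact Finset.sum_le_card_nsmul s _ _ fun c _ => hA c

/-- The kernel whose mixed norms define the weighted BMO quantity. -/
def bmoKernel (p : ℝ) (V U B : Rd d → Mat m) (x y : Rd d) : Mat m :=
  matPow (V x) (1 / p) * (B x - B y) * matPow (U y) (-(1 / p))

theorem aemeasurable_bmoKernel {p : ℝ} {U V B : Rd d → Mat m} (hU : IsMatrixWeight U)
    (hV : IsMatrixWeight V) (hB : IsLocInt B) (i j : Fin m) :
    AEMeasurable (fun z : Rd d × Rd d => bmoKernel p V U B z.1 z.2 i j) volume ∧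
      (∀ x, AEMeasurable (fun y => bmoKernel p V U B x y i j) volume) ∧
      ∀ y, AEMeasurable (fun x => bmoKernel p V U B x y i j) volume := by
  have hY := aemeasurable_matPow hV (1 / p)
  have hZ := aemeasurable_matPow hU (-(1 / p))
  have hB' : ∀ i j, AEMeasurable (fun x => B x i j) volume := fun i j =>
    (hB i j).aestronglyMeasurable.aemeasurable
  simp only [bmoKernel, Matrix.mul_apply, Matrix.sub_apply]
  refine ⟨?_, fun x => ?_, fun y => ?_⟩
  · rw [Measure.volume_eq_prod]
    exact Finset.aemeasurable_fun_sum _ fun k _ => (Finset.aemeasurable_fun_sum _ fun n _ =>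
      (hY i n).comp_fst.mul ((hB' n k).comp_fst.sub (hB' n k).comp_snd)).mul (hZ k j).comp_snd
  · exact Finset.aemeasurable_fun_sum _ fun k _ => (Finset.aemeasurable_fun_sum _ fun n _ =>
      aemeasurable_const.mul (aemeasurable_const.sub (hB' n k))).mul (hZ k j)
  · exact Finset.aemeasurable_fun_sum _ fun k _ => (Finset.aemeasurable_fun_sum _ fun n _ =>
      (hY i n).mul ((hB' n k).sub aemeasurable_const)).mul aemeasurable_const

/-- The entries of the kernel have their mixed norms on a cube bounded by the commutators. -/
theorem exists_mixed_bmoKernel_le (d m : ℕ) [NeZero d] {p q : ℝ} (hpq : p.HolderConjugate q) :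
    ∃ C : ℝ≥0, ∀ U V B : Rd d → Mat m, IsMatrixWeight U → IsMatrixWeight V → IsLocInt B →
      ∀ N : ℝ, 0 ≤ N → (∀ l, commutatorNorm p U V B l ≤ ENNReal.ofReal N) →
      ∀ (a : Rd d) (r : ℝ), 0 < r → ∀ i j,
      ∫⁻ x in cube a r, (∫⁻ y in cube a r, ‖bmoKernel p V U B x y i j‖ₑ ^ q) ^ (p / q)
        ≤ C * ENNReal.ofReal (r ^ d * N) ^ p ∧
      ∫⁻ y in cube a r, (∫⁻ x in cube a r, ‖bmoKernel p V U B x y i j‖ₑ ^ p) ^ (q / p)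
        ≤ C * ENNReal.ofReal (r ^ d * N) ^ q := by
  have hp := hpq.pos
  have hq := hpq.symm.pos
  obtain ⟨C₀, hC₀, h₀⟩ := exists_tensorForm_le d
  -- The rank is the number 2m of tensor terms; the second application, with exponents exchanged, is
  -- for the transposed kernel.
  obtain ⟨C₁, h₁⟩ := exists_mixed_le (X := Rd d) (ι := Fin m ⊕ Fin m) hpq
    (Finset.univ : Finset (Fin m ⊕ Fin m)).card
  obtain ⟨C₂, h₂⟩ := exists_mixed_le (X := Rd d) (ι := Fin m ⊕ Fin m) hpq.symm
    (Finset.univ : Finset (Fin m ⊕ Fin m)).card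
  refine ⟨max (C₁ * C₀.toNNReal ^ p) (C₂ * C₀.toNNReal ^ q), ?_⟩
  intro U V B hU hV hB N hN hcomm a r hr i j
  have hY := aemeasurable_matPow hV (1 / p)
  have hZ := aemeasurable_matPow hU (-(1 / p))
  have hBm : ∀ i j, AEStronglyMeasurable (fun x => B x i j) volume := fun i j =>
    (hB i j).aestronglyMeasurable
  obtain ⟨hk, hk₁, hk₂⟩ := aemeasurable_bmoKernel (p := p) hU hV hB i j
  obtain ⟨S, hSm, hSmono, hSQ, hSb, hSae⟩ := exists_exhaustion (measurableSet_cube a r)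
    (ι := (Fin m × Fin m) ⊕ (Fin m × Fin m) ⊕ (Fin m × Fin m))
    (h := Sum.elim (fun c x => matPow (V x) (1 / p) c.1 c.2)
      (Sum.elim (fun c x => B x c.1 c.2) (fun c x => matPow (U x) (-(1 / p)) c.1 c.2)))
    (by
      rintro (c | c | c)
      · exact hY _ _
      · exact (hBm _ _).aemeasurable
      · exact hZ _ _)
    (P := fun x => matPow (U x) (1 / p) * matPow (U x) (-(1 / p)) = 1)
    (hU.posDef.mono fun x hx => matPow_mul_matPow_neg hx _)
  have hfin : ∀ n, IsFiniteMeasure (volume.restrict (S n)) := fun n =>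
    ⟨by
      rw [Measure.restrict_apply_univ]
      exact (measure_mono (hSQ n)).trans_lt (isCompact_cube a r).measure_lt_top⟩
  have hYK : ∀ n, ∀ x ∈ S n, ∀ i j, ‖matPow (V x) (1 / p) i j‖ ≤ n := fun n x hx i j =>
    (hSb n x hx).2 (Sum.inl (i, j))
  have hBK : ∀ n, ∀ x ∈ S n, ∀ i j, ‖B x i j‖ ≤ n := fun n x hx i j =>
    (hSb n x hx).2 (Sum.inr (Sum.inl (i, j)))
  have hZK : ∀ n, ∀ x ∈ S n, ∀ i j, ‖matPow (U x) (-(1 / p)) i j‖ ≤ n := fun n x hx i j =>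
    (hSb n x hx).2 (Sum.inr (Sum.inr (i, j)))
  have hform := fun n => h₀ m p q U V B (S n) a r n N hpq hr hN (hSm n) (hSQ n)
    (fun i j => (hY i j).aestronglyMeasurable) hBm (fun i j => (hZ i j).aestronglyMeasurable)
    (hYK n) (hBK n) (hZK n) (fun x hx => (hSb n x hx).1) hcomm i j
  have hα := fun n k => bddOn_leftFactor (hSm n)
    (fun i j => (hY i j).aestronglyMeasurable) hBm (hYK n) (hBK n) i k
  have hβ := fun n k => bddOn_rightFactor (hSm n) hBm
    (fun i j => (hZ i j).aestronglyMeasurable) (hBK n) (hZK n) j k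
  have hα' := fun n k => (⟨(hα n k).aesm.restrict, (hα n k).bdd⟩ :
    IsBddFun (volume.restrict (S n)) (leftFactor (S n) (fun x => matPow (V x) (1 / p)) B i k))
  have hβ' := fun n k => (⟨(hβ n k).aesm.restrict, (hβ n k).bdd⟩ :
    IsBddFun (volume.restrict (S n))
      (rightFactor (S n) B (fun x => matPow (U x) (-(1 / p))) j k))
  have hconst : ∀ (D : ℝ≥0) (s : ℝ), 0 < s → (D : ℝ≥0∞) * ENNReal.ofReal (C₀ * r ^ d * N) ^ s
      = ((D * C₀.toNNReal ^ s : ℝ≥0) : ℝ≥0∞) * ENNReal.ofReal (r ^ d * N) ^ s := by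
    intro D s hs
    rw [mul_assoc C₀, ENNReal.ofReal_mul hC₀, ENNReal.mul_rpow_of_nonneg _ _ hs.le,
      ENNReal.coe_mul, ENNReal.coe_rpow_of_nonneg _ hs.le, mul_assoc]
    rfl
  constructor
  · refine mixed_le_of_exhaustion hSmono hSae (h := fun x y => ‖bmoKernel p V U B x y i j‖ₑ ^ q)
      (hk.enorm.pow_const q) (by positivity) fun n => ?_
    have := hfin n
    have h3 := h₁ (volume.restrict (S n)) Finset.univ _ _ _ rfl (hα' n) (hβ' n) (hform n)
    rw [hconst _ _ hp] at h3
    refine le_trans (le_of_eq ?_) (h3.trans ?_)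
    · refine setLIntegral_congr_fun (hSm n) fun x hx => ?_
      refine congrArg (· ^ (p / q)) (setLIntegral_congr_fun (hSm n) fun y hy => ?_)
      rw [sum_leftFactor_mul_rightFactor hx hy, bmoKernel]
    · gcongr
      exact le_max_left _ _
  · refine mixed_le_of_exhaustion hSmono hSae (h := fun y x => ‖bmoKernel p V U B x y i j‖ₑ ^ p)
      ?_ (by positivity) fun n => ?_
    · have : AEMeasurable (fun z : Rd d × Rd d => bmoKernel p V U B z.2 z.1 i j) volume :=
        hk.prod_swap
      exact this.enorm.pow_const p
    have := hfin n
    have h3 := h₂ (volume.restrict (S n)) Finset.univ _ _ (C₀ * r ^ d * N) rfl (hβ' n) (hα' n)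
      fun g f hg hf => by
        refine le_trans (le_of_eq ?_) (hform n f g hf hg)
        congr 1
        exact Finset.sum_congr rfl fun k _ => mul_comm _ _
    rw [hconst _ _ hq] at h3
    refine le_trans (le_of_eq ?_) (h3.trans ?_)
    · refine setLIntegral_congr_fun (hSm n) fun y hy => ?_
      refine congrArg (· ^ (q / p)) (setLIntegral_congr_fun (hSm n) fun x hx => ?_)
      simp_rw [mul_comm (rightFactor _ _ _ _ _ _)]
      rw [sum_leftFactor_mul_rightFactor hx hy, bmoKernel]
    · gcongr
      exact le_max_right _ _

/-- Passing from integrals to averages over a cube. -/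
theorem setLAverage_mixed_le {a : Rd d} {r : ℝ} (hr : 0 < r) {f : Rd d → Rd d → ℝ≥0∞} {s θ N : ℝ}
    (hθ : 0 < θ) (hs : s = 1 + θ) {C : ℝ≥0∞}
    (h : ∫⁻ x in cube a r, (∫⁻ y in cube a r, f x y) ^ θ ≤ C * ENNReal.ofReal (r ^ d * N) ^ s) :
    ⨍⁻ x in cube a r, (⨍⁻ y in cube a r, f x y ∂volume) ^ θ ∂volume
      ≤ C * ENNReal.ofReal N ^ s := by
  set v := ENNReal.ofReal r ^ d with hv
  have hv0 : v ≠ 0 := pow_ne_zero _ (by simpa using hr)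
  have hvt : v ≠ ∞ := ENNReal.pow_ne_top ENNReal.ofReal_ne_top
  have hs0 : 0 ≤ s := by linarith
  rw [ENNReal.ofReal_mul (by positivity), ENNReal.ofReal_pow hr.le,
    ENNReal.mul_rpow_of_nonneg _ _ hs0] at h
  simp_rw [setLAverage_eq, volume_cube, ← hv, ENNReal.div_rpow_of_nonneg _ _ hθ.le,
    ENNReal.div_eq_inv_mul]
  rw [lintegral_const_mul' _ _ (ENNReal.inv_ne_top.2 (by
    simp [ENNReal.rpow_eq_zero_iff, hv0, hvt]))]
  -- The outer average contributes |Q|^{-1} and the inner one |Q|^{-θ}; with s = 1 + θ they cancel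
  -- the power of r^d = |Q| exactly.
  have hvs : v ^ s = v * v ^ θ := by
    rw [hs, ENNReal.rpow_add _ _ hv0 hvt, ENNReal.rpow_one]
  have hvθ0 : v ^ θ ≠ 0 := by simp [ENNReal.rpow_eq_zero_iff, hv0, hvt]
  have hvθt : v ^ θ ≠ ∞ := ENNReal.rpow_ne_top_of_nonneg hθ.le hvt
  calc _ ≤ v⁻¹ * ((v ^ θ)⁻¹ * (C * (v ^ s * ENNReal.ofReal N ^ s))) := by gcongr
    _ = (v⁻¹ * v) * ((v ^ θ)⁻¹ * v ^ θ) * (C * ENNReal.ofReal N ^ s) := by rw [hvs]; ring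
    _ = _ := by
        rw [ENNReal.inv_mul_cancel hv0 hvt, ENNReal.inv_mul_cancel hvθ0 hvθt, one_mul, one_mul]

theorem setLAverage_mixed_sum_le {ι : Type*} (s : Finset ι) {h : ι → Rd d → Rd d → ℝ≥0∞}
    {f : Rd d → Rd d → ℝ≥0∞} {a : Rd d} {r : ℝ} (hr : 0 < r)
    (hh : ∀ c, AEMeasurable (fun z : Rd d × Rd d => h c z.1 z.2) volume)
    (hh' : ∀ c x, AEMeasurable (h c x) volume) {p q N : ℝ} (hpq : p.HolderConjugate q)
    {C : ℝ≥0∞} (hf : ∀ x y, f x y ≤ ∑ c ∈ s, h c x y)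
    (hA : ∀ c, ∫⁻ x in cube a r, (∫⁻ y in cube a r, h c x y ^ q) ^ (p / q)
      ≤ C * ENNReal.ofReal (r ^ d * N) ^ p) :
    ⨍⁻ x in cube a r, (⨍⁻ y in cube a r, f x y ^ q ∂volume) ^ (p / q) ∂volume
      ≤ (((s.card : ℝ≥0∞) ^ q) ^ (p / q) * (s.card : ℝ≥0∞) ^ (p / q) * (s.card * C))
        * ENNReal.ofReal N ^ p := by
  have hp := hpq.pos
  have hq := hpq.symm.pos
  have hs : p = 1 + p / q := by
    have := hpq.inv_add_inv_eq_one
    field_simp at this ⊢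
    linarith
  refine setLAverage_mixed_le (f := fun x y => f x y ^ q) hr (by positivity) hs ?_
  refine le_trans ?_ ((mixed_sum_le s hh hh' hq (by positivity) hA).trans (le_of_eq ?_))
  · exact lintegral_mono fun x => ENNReal.rpow_le_rpow (lintegral_mono fun y =>
      ENNReal.rpow_le_rpow (hf x y) hq.le) (by positivity)
  · ring

theorem exists_setLAverage_bmoKernel_le (d m : ℕ) [NeZero d] {p q : ℝ}
    (hpq : p.HolderConjugate q) :
    ∃ C : ℝ≥0, ∀ U V B : Rd d → Mat m, IsMatrixWeight U → IsMatrixWeight V → IsLocInt B →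
      ∀ N : ℝ, 0 ≤ N → (∀ l, commutatorNorm p U V B l ≤ ENNReal.ofReal N) →
      ∀ (a : Rd d) (r : ℝ), 0 < r →
      ⨍⁻ x in cube a r, (⨍⁻ y in cube a r, opENorm (bmoKernel p V U B x y) ^ q ∂volume) ^ (p / q)
        ∂volume ≤ C * ENNReal.ofReal N ^ p ∧
      ⨍⁻ y in cube a r, (⨍⁻ x in cube a r, opENorm (bmoKernel p V U B x y) ^ p ∂volume) ^ (q / p)
        ∂volume ≤ C * ENNReal.ofReal N ^ q := by
  have hp := hpq.pos
  have hq := hpq.symm.pos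
  obtain ⟨C, hC⟩ := exists_mixed_bmoKernel_le d m hpq
  set n : ℝ≥0∞ := ((Finset.univ : Finset (Fin m × Fin m)).card : ℝ≥0∞) with hn
  have hnt : ∀ {s : ℝ}, 0 < s → n ^ s ≠ ∞ := fun hs =>
    ENNReal.rpow_ne_top_of_nonneg hs.le (ENNReal.natCast_ne_top _)
  have hD : ∀ {s t : ℝ}, 0 < s → 0 < t →
      (n ^ s) ^ (t / s) * n ^ (t / s) * (n * C) ≠ ∞ := fun {s t} hs ht =>
    ENNReal.mul_ne_top (ENNReal.mul_ne_top (ENNReal.rpow_ne_top_of_nonneg (by positivity) (hnt hs))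
      (hnt (by positivity))) (ENNReal.mul_ne_top (ENNReal.natCast_ne_top _) ENNReal.coe_ne_top)
  refine ⟨max ((n ^ q) ^ (p / q) * n ^ (p / q) * (n * C)).toNNReal
    ((n ^ p) ^ (q / p) * n ^ (q / p) * (n * C)).toNNReal, ?_⟩
  intro U V B hU hV hB N hN hcomm a r hr
  have hk := fun c : Fin m × Fin m => aemeasurable_bmoKernel (p := p) hU hV hB c.1 c.2
  have hop : ∀ x y, opENorm (bmoKernel p V U B x y)
      ≤ ∑ c : Fin m × Fin m, ‖bmoKernel p V U B x y c.1 c.2‖ₑ := fun x y => by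
    rw [Fintype.sum_prod_type]
    exact opENorm_le_sum _
  set h : Fin m × Fin m → Rd d → Rd d → ℝ≥0∞ := fun c x y => ‖bmoKernel p V U B x y c.1 c.2‖ₑ
    with hh
  have h1 : ∀ c, AEMeasurable (fun z : Rd d × Rd d => h c z.1 z.2) volume := fun c =>
    (hk c).1.enorm
  have h2 : ∀ c, AEMeasurable (fun z : Rd d × Rd d => h c z.2 z.1) volume := fun c =>
    (h1 c).prod_swap
  have h3 : ∀ c x, AEMeasurable (h c x) volume := fun c x => ((hk c).2.1 x).enorm
  have h4 : ∀ c y, AEMeasurable (fun x => h c x y) volume := fun c y => ((hk c).2.2 y).enorm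
  constructor
  · refine (setLAverage_mixed_sum_le Finset.univ (h := h) hr h1 h3 hpq hop
      fun c => (hC U V B hU hV hB N hN hcomm a r hr c.1 c.2).1).trans ?_
    refine mul_le_mul_left ?_ _
    rw [← hn, ← ENNReal.coe_toNNReal (hD hq hp), ENNReal.coe_le_coe]
    exact le_max_left _ _
  · refine (setLAverage_mixed_sum_le Finset.univ
      (f := fun y x => opENorm (bmoKernel p V U B x y))
      (h := fun c y x => h c x y) hr h2 h4 hpq.symm
      (fun y x => hop x y)
      fun c => (hC U V B hU hV hB N hN hcomm a r hr c.1 c.2).2).trans ?_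
    refine mul_le_mul_left ?_ _
    rw [← hn, ← ENNReal.coe_toNNReal (hD hp hq), ENNReal.coe_le_coe]
    exact le_max_right _ _

theorem rpow_mul_rpow_one_div_le {C : ℝ≥0} {N : ℝ≥0∞} {s : ℝ} (hs : 0 < s) {L : ℝ≥0∞}
    (h : L ≤ C * N ^ s) : L ^ (1 / s) ≤ (C ^ (1 / s) : ℝ≥0) * N := by
  calc L ^ (1 / s) ≤ (C * N ^ s) ^ (1 / s) := by gcongr
    _ = _ := by
      rw [ENNReal.mul_rpow_of_nonneg _ _ (by positivity), ← ENNReal.rpow_mul,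
        mul_one_div_cancel hs.ne', ENNReal.rpow_one, ENNReal.coe_rpow_of_nonneg _ (by positivity)]

/-- The dual BMO quantity in terms of the kernel. -/
theorem setLAverage_dual_eq {p q : ℝ} (hpq : p.HolderConjugate q) {U V B : Rd d → Mat m}
    (hU : IsMatrixWeight U) (hV : IsMatrixWeight V) (Q : Set (Rd d)) :
    ⨍⁻ x in Q, (⨍⁻ y in Q, opENorm (matPow (matPow (U x) (-(q / p))) (1 / q) * ((B x)ᴴ - (B y)ᴴ) *
        matPow (matPow (V y) (-(q / p))) (-(1 / q))) ^ p ∂volume) ^ (q / p) ∂volume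
      = ⨍⁻ x in Q, (⨍⁻ y in Q, opENorm (bmoKernel p V U B y x) ^ p ∂volume) ^ (q / p) ∂volume := by
  have hp := hpq.pos
  have hq := hpq.symm.pos
  refine laverage_congr (ae_restrict_of_ae ?_)
  filter_upwards [hU.posDef] with x hx
  refine congrArg (· ^ (q / p)) (laverage_congr (ae_restrict_of_ae ?_))
  filter_upwards [hV.posDef] with y hy
  -- Taking the 1/q and -1/q powers of the dual weights returns U^{-1/p} and V^{1/p}, so the dual
  -- kernel is minus the adjoint of the original one with the variables exchanged.
  have e1 : -(q / p) * (1 / q) = -(1 / p) := by field_simp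
  have e2 : -(q / p) * (-(1 / q)) = 1 / p := by field_simp
  have e3 : matPow (U x) (-(1 / p)) * ((B x)ᴴ - (B y)ᴴ) * matPow (V y) (1 / p)
      = -(bmoKernel p V U B y x)ᴴ := by
    rw [bmoKernel, Matrix.conjTranspose_mul, Matrix.conjTranspose_mul, conjTranspose_matPow,
      conjTranspose_matPow, Matrix.conjTranspose_sub, ← mul_assoc, ← neg_mul, ← mul_neg, neg_sub]
  rw [matPow_matPow hx, matPow_matPow hy, e1, e2, e3, opENorm_neg, opENorm_conjTranspose]

theorem exists_max_bmoTilde_le (d m : ℕ) [NeZero d] {p : ℝ} (hp : 1 < p) :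
    ∃ C : ℝ≥0, ∀ U V B : Rd d → Mat m, IsMatrixWeight U → IsMatrixWeight V → IsLocInt B →
      max (bmoTilde p V U B)
          (bmoTilde p.conjExponent (dualWeight p U) (dualWeight p V) (fun x => (B x)ᴴ)) ≤
        (C : ℝ≥0∞) * ⨆ l : Fin d, commutatorNorm p U V B l := by
  have hpq : p.HolderConjugate p.conjExponent := Real.HolderConjugate.conjExponent hp
  set q := p.conjExponent with hq
  have hqp : q.conjExponent = p := hpq.symm.conjugate_eq.symm
  have hp0 := hpq.pos
  have hq0 := hpq.symm.pos
  obtain ⟨C, hC⟩ := exists_setLAverage_bmoKernel_le d m hpq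
  -- Adding 1 makes the constant nonzero, so that the right-hand side is infinite when the
  -- commutator norm is.
  refine ⟨max (C ^ (1 / p)) (C ^ (1 / q)) + 1, ?_⟩
  intro U V B hU hV hB
  set N := ⨆ l : Fin d, commutatorNorm p U V B l with hN
  rcases eq_or_ne N ∞ with hNt | hNt
  · rw [hNt, ENNReal.mul_top (by simp)]
    exact le_top
  have hNr : N = ENNReal.ofReal N.toReal := (ENNReal.ofReal_toReal hNt).symm
  have hcomm : ∀ l, commutatorNorm p U V B l ≤ ENNReal.ofReal N.toReal := fun l => by
    rw [← hNr]; exact le_iSup (fun l => commutatorNorm p U V B l) l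
  have hmain := hC U V B hU hV hB N.toReal ENNReal.toReal_nonneg hcomm
  rw [← hNr] at hmain
  refine max_le ?_ ?_
  · refine (rpow_mul_rpow_one_div_le hp0 (iSup_le fun a => iSup_le fun r => iSup_le fun hr =>
      (hmain a r hr).1)).trans ?_
    gcongr
    exact (le_max_left _ _).trans (le_add_of_nonneg_right zero_le)
  · rw [bmoTilde, hqp]
    refine (rpow_mul_rpow_one_div_le hq0 (iSup_le fun a => iSup_le fun r => iSup_le fun hr => ?_)
      ).trans (b := ((C ^ (1 / q) : ℝ≥0) : ℝ≥0∞) * N) ?_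
    · exact (setLAverage_dual_eq hpq hU hV _).le.trans (hmain a r hr).2
    gcongr
    exact (le_max_right _ _).trans (le_add_of_nonneg_right zero_le)

theorem bmoTilde_eq_zero_of_subsingleton [Subsingleton (Rd d)] {p : ℝ} (hp : 1 < p)
    (V U B : Rd d → Mat m) : bmoTilde p V U B = 0 := by
  have hpq : p.HolderConjugate p.conjExponent := Real.HolderConjugate.conjExponent hp
  have hp0 := hpq.pos
  have hq0 := hpq.symm.pos
  have h : ∀ x y, opENorm (matPow (V x) (1 / p) * (B x - B y) * matPow (U y) (-(1 / p))) = 0 := by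
    intro x y
    rw [Subsingleton.elim x y]
    rw [sub_self, mul_zero, zero_mul, opENorm, map_zero, ← ofReal_norm]
    simp
  have h1 : 0 < p / p.conjExponent := by positivity
  simp only [bmoTilde, h, ENNReal.zero_rpow_of_pos hq0, laverage_zero,
    ENNReal.zero_rpow_of_pos h1]
  simp [hp0]

end Assembly

end MatrixWeight

end

theorem theorem1p5 (d m : ℕ) (p : ℝ) (hp : 1 < p) :
    ∃ C : ℝ≥0, ∀ U V B : MatrixWeight.Rd d → MatrixWeight.Mat m,
      MatrixWeight.IsMatrixWeight U → MatrixWeight.IsMatrixWeight V → MatrixWeight.IsLocInt B →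
      max (MatrixWeight.bmoTilde p V U B)
          (MatrixWeight.bmoTilde p.conjExponent
            (MatrixWeight.dualWeight p U) (MatrixWeight.dualWeight p V) (fun x => (B x)ᴴ)) ≤
        (C : ℝ≥0∞) * ⨆ l : Fin d, MatrixWeight.commutatorNorm p U V B l := by
  rcases Nat.eq_zero_or_pos d with rfl | hd
  -- In dimension zero the supremum over the empty family of Riesz transforms is 0. The left side
  -- vanishes as well, since the space is a point and B(x) - B(y) = 0.
  · refine ⟨0, fun U V B _ _ _ => ?_⟩
    rw [MatrixWeight.bmoTilde_eq_zero_of_subsingleton hp,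
      MatrixWeight.bmoTilde_eq_zero_of_subsingleton (Real.HolderConjugate.conjExponent hp).symm.lt]
    simp
  · have : NeZero d := ⟨hd.ne'⟩
    exact MatrixWeight.exists_max_bmoTilde_le d m hp
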